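/- Let $\mathcal H$ be an infinite-dimensional separable complex Hilbert space, let $B(\mathcal H)^+$ be the cone of positive operators and $B(\mathcal H)^{++}$ the set of positive invertible operators on $\mathcal H$. An operator mean (in the sense of Kubo and Ando) is a map $\sigma:B(\mathcal H)^+\times B(\mathcal H)^+\to B(\mathcal H)^+$ that is jointly monotone, satisfies $C(A\sigma B)C\le (CAC)\sigma(CBC)$ for all $A,B,C\in B(\mathcal H)^+$, satisfies $A_k\sigma B_k\searrow A\sigma B$ whenever $A_k\searrow A$ and $B_k\searrow B$ (decreasing sequences converging in the strong operator topology), and satisfies $I\sigma I=I$. Its representing function $f_\sigma$ is given by $I\sigma(tI)=f_\sigma(t)I$, $t\ge0$; it is the nonnegative operator monotone function on $[0,\infty)$ with $f_\sigma(1)=1$ and $A\sigma B=A^{1/2}f_\sigma(A^{-1/2}BA^{-1/2})A^{1/2}$ for $A,B\in B(\mathcal H)^{++}$. A sequence of operator means $\tau_k$ converges properly to an operator mean $\tau$ if the following equivalent conditions hold: $f_{\tau_k}(t)\to f_\tau(t)$ for every $t>0$; $f_{\tau_k}\to f_\tau$ uniformly on $[\delta,\delta^{-1}]$ for every $\delta\in(0,1)$;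 $A\tau_kB\to A\tau B$ in the operator norm for all $A,B\in B(\mathcal H)^{++}$. For $s\in[0,1]$ and $r\in[-1,1]$ let $\mathfrak p_{s,r}$ be the weighted power mean, that is, the operation given on $B(\mathcal H)^{++}$ by $A\,\mathfrak p_{s,r}B=A^{1/2}f_{s,r}(A^{-1/2}BA^{-1/2})A^{1/2}$ with $f_{s,r}(t)=(1-s+st^r)^{1/r}$ for $r\neq0$ and $f_{s,0}(t)=t^s$. For an operator mean $\tau$, $s\in(0,1]$ and $r\in[-1,1]$ let $\tau_{s,r}:=\tau_{\mathfrak p_{s,r}}$ be the deformed mean: for $A,B\in B(\mathcal H)^{++}$, $A\,\tau_{s,r}B$ is the unique $X\in B(\mathcal H)^{++}$ with $X=(X\,\mathfrak p_{s,r}A)\,\tau\,(X\,\mathfrak p_{s,r}B)$. Both operations are extended to $A,B\in B(\mathcal H)^+$ as the strong limits of their values at $(A+\varepsilon I,B+\varepsilon I)$ as $\varepsilon\searrow0$. **Theorem.** Let $\tau$ be an operator mean. Then the representing function $f_\tau$ exists and is differentiable at $1$, $\alpha:=f_\tau'(1)\in[0,1]$, the equation defining $\tau_{s,r}$ has a unique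 solution for all $s\in(0,1]$, $r\in[-1,1]$, and the following hold. 1. If $s_k\in(0,1]$ and $r_k\in[-1,1]$, $k\in\mathbb N$, satisfy $s_k\to0$ and $r_k\to r$, then $\tau_{s_k,r_k}\to\mathfrak p_{\alpha,r}$ properly. 2. Put $\tau_{0,r}:=\mathfrak p_{\alpha,r}$ for $r\in[-1,1]$. Then $\tau_{s,r}$, $(s,r)\in[0,1]\times[-1,1]$, is a continuous two-parameter family of operator means: every $\tau_{s,r}$ is an operator mean, and if $s_k\in[0,1]$, $r_k\in[-1,1]$ satisfy $s_k\to s$ and $r_k\to r$, then $\tau_{s_k,r_k}\to\tau_{s,r}$ properly. -/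

import Mathlib

open Set Filter Topology

noncomputable section

namespace OpMean

variable {H : Type*} [NormedAddCommGroup H] [InnerProductSpace ℂ H] [CompleteSpace H]

/-- `A k ↘ A`: the sequence decreases in the Loewner order and converges to `A` in the
strong operator topology. -/
def DecreasesTo (A : ℕ → H →L[ℂ] H) (L : H →L[ℂ] H) : Prop :=
  Antitone A ∧ ∀ ξ : H, Tendsto (fun k => A k ξ) atTop (𝓝 (L ξ))

/-- Operator means in the sense of Kubo and Ando. A mean is a binary operation on the cone of
positive operators; it is given here by a function on all of `B(H)`, of which only the values at
pairs of positive operators matter. -/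
structure IsOperatorMean (σ : (H →L[ℂ] H) → (H →L[ℂ] H) → (H →L[ℂ] H)) : Prop where
  nonneg : ∀ A B : H →L[ℂ] H, 0 ≤ A → 0 ≤ B → 0 ≤ σ A B
  /-- joint monotonicity -/
  mono : ∀ A A' B B' : H →L[ℂ] H, 0 ≤ A → 0 ≤ B → A ≤ A' → B ≤ B' → σ A B ≤ σ A' B'
  /-- transformer inequality -/
  transformer : ∀ A B C : H →L[ℂ] H, 0 ≤ A → 0 ≤ B → 0 ≤ C →
    C * σ A B * C ≤ σ (C * A * C) (C * B * C)
  /-- downward continuity -/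
  downward : ∀ (A B : ℕ → H →L[ℂ] H) (A₀ B₀ : H →L[ℂ] H),
    (∀ k, 0 ≤ A k) → (∀ k, 0 ≤ B k) → 0 ≤ A₀ → 0 ≤ B₀ →
    DecreasesTo A A₀ → DecreasesTo B B₀ → DecreasesTo (fun k => σ (A k) (B k)) (σ A₀ B₀)
  /-- normalization -/
  normalized : σ 1 1 = 1

/-- `A^{1/2} f(A^{-1/2} B A^{-1/2}) A^{1/2}`, for positive invertible `A` and `B`. -/
def perspective (f : ℝ → ℝ) (A B : H →L[ℂ] H) : H →L[ℂ] H :=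
  A ^ (1 / 2 : ℝ) * cfc f (A ^ (-(1 / 2) : ℝ) * B * A ^ (-(1 / 2) : ℝ)) * A ^ (1 / 2 : ℝ)

open Classical in
/-- The extension of a binary operation `m` on positive invertible operators to all positive
operators by the strong limit of `m (A + ε I) (B + ε I)` as `ε ↘ 0`. -/
def extend (m : (H →L[ℂ] H) → (H →L[ℂ] H) → (H →L[ℂ] H)) (A B : H →L[ℂ] H) : H →L[ℂ] H :=
  if IsStrictlyPositive A ∧ IsStrictlyPositive B then m A B
  else Classical.epsilon fun L : H →L[ℂ] H =>
    ∀ ξ : H, Tendsto (fun ε : ℝ => m (A + ε • 1) (B + ε • 1) ξ) (𝓝[>] 0) (𝓝 (L ξ))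

/-- The value at `t` of the representing function of `σ`: the real number `c` such that
`I σ (t I) = c I`. -/
def reprFun (σ : (H →L[ℂ] H) → (H →L[ℂ] H) → (H →L[ℂ] H)) (t : ℝ) : ℝ :=
  Classical.epsilon fun c : ℝ => σ 1 (t • 1) = c • (1 : H →L[ℂ] H)

/-- `f` is the representing function of `σ`: a nonnegative (continuous) operator monotone function
on `[0, ∞)` with `f 1 = 1` such that `A σ B = A^{1/2} f(A^{-1/2} B A^{-1/2}) A^{1/2}` for all
positive invertible `A`, `B`. -/
structure Represents (f : ℝ → ℝ) (σ : (H →L[ℂ] H) → (H →L[ℂ] H) → (H →L[ℂ] H)) : Prop where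
  nonneg : ∀ t : ℝ, 0 ≤ t → 0 ≤ f t
  continuousOn : ContinuousOn f (Ici 0)
  operatorMonotone : ∀ A B : H →L[ℂ] H, 0 ≤ A → A ≤ B → cfc f A ≤ cfc f B
  map_one : f 1 = 1
  formula : ∀ A B : H →L[ℂ] H, IsStrictlyPositive A → IsStrictlyPositive B →
    σ A B = perspective f A B

/-- `f_{s,r}(t) = (1 - s + s t^r)^{1/r}` for `r ≠ 0` and `f_{s,0}(t) = t^s`; it is used for
`t > 0` only. -/
def powerFun (s r t : ℝ) : ℝ :=
  if r = 0 then t ^ s else (1 - s + s * t ^ r) ^ (1 / r)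

/-- The weighted power mean `𝔭_{s,r}`. -/
def powerMean (s r : ℝ) : (H →L[ℂ] H) → (H →L[ℂ] H) → (H →L[ℂ] H) :=
  extend (perspective (powerFun s r))

/-- `X` is a positive invertible solution of `X = (X σ A) τ (X σ B)`. -/
def IsFixedSolution (τ σ : (H →L[ℂ] H) → (H →L[ℂ] H) → (H →L[ℂ] H)) (A B X : H →L[ℂ] H) : Prop :=
  IsStrictlyPositive X ∧ X = τ (σ X A) (σ X B)

/-- The deformation `τ_σ` of `τ` by `σ`: for positive invertible `A`, `B` it is the positive
invertible solution of the fixed point equation, and it is then extended to positive operators. -/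
def deform (τ σ : (H →L[ℂ] H) → (H →L[ℂ] H) → (H →L[ℂ] H)) :
    (H →L[ℂ] H) → (H →L[ℂ] H) → (H →L[ℂ] H) :=
  extend fun A B => Classical.epsilon fun X => IsFixedSolution τ σ A B X

open Classical in
/-- The two-parameter family `τ_{s,r}`: the deformation of `τ` by `𝔭_{s,r}` for `s ≠ 0`, and
`𝔭_{α,r}` with `α = f_τ'(1)` for `s = 0`. -/
def deformFamily (τ : (H →L[ℂ] H) → (H →L[ℂ] H) → (H →L[ℂ] H)) (s r : ℝ) :
    (H →L[ℂ] H) → (H →L[ℂ] H) → (H →L[ℂ] H) :=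
  if s = 0 then powerMean (deriv (reprFun τ) 1) r else deform τ (powerMean s r)

/-- Proper convergence of operator means, with all of the three conditions (pairwise equivalent
for operator means) that describe it. -/
structure TendstoProperly (τs : ℕ → (H →L[ℂ] H) → (H →L[ℂ] H) → (H →L[ℂ] H))
    (τ : (H →L[ℂ] H) → (H →L[ℂ] H) → (H →L[ℂ] H)) : Prop where
  pointwise : ∀ t : ℝ, 0 < t → Tendsto (fun k => reprFun (τs k) t) atTop (𝓝 (reprFun τ t))
  uniform : ∀ δ : ℝ, 0 < δ → δ < 1 →
    TendstoUniformlyOn (fun k => reprFun (τs k)) (reprFun τ) atTop (Icc δ δ⁻¹)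
  norm : ∀ A B : H →L[ℂ] H, IsStrictlyPositive A → IsStrictlyPositive B →
    Tendsto (fun k => τs k A B) atTop (𝓝 (τ A B))

end OpMean

end

set_option linter.unusedSectionVars false

noncomputable section

namespace OpMean

/-! ### Perspectives of functions and congruence -/

section

variable {H : Type*} [NormedAddCommGroup H] [InnerProductSpace ℂ H] [CompleteSpace H]

/-! Everything is reduced to functions of one real variable. On one side, an operator mean commutes
with invertible positive congruences (`IsOperatorMean.conj_eq`) and `I τ B` is `f_τ(B)`
(`IsOperatorMean.one_left`), so on invertible pairs it is the perspective of its representing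
function. On the other side, a positive continuous normalized function whose perspective is jointly
monotone (`IsMeanFun`) yields an operator mean once it is extended by strong limits
(`IsMeanFun.isOperatorMean`).

A congruence carries a pair `(A, B)` to `(I, C)`. There a scalar solution `x(t)` of `x = (x σ 1) τ
(x σ t)` gives the operator solution `x(C)`, because everything in sight is a function of `C`.
Uniqueness among all positive invertible operators, and monotonicity of the solution in `(A, B)`,
both follow from the comparison principle `le_of_le_deformMap`: if `X ≤ l Y` with `l > 1`, `X` a
sub-solution and `Y` a super-solution, then one application of the fixed point map strictly improves
`l`. The weighted power means themselves are shown to be monotone in this way, as deformations of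
the arithmetic mean.

The limit `s → 0` looks singular, since `𝔭_{0,r}` ignores its second argument. Put `x = exp y`, `t =
exp w`, take logarithms of the scalar equation and divide by `s`. The result, `logDefect f s r w y =
0`, extends continuously to `s = 0` and `r = 0` and is strictly decreasing in `y`, so its root is
jointly continuous in all parameters (`IsScalarMean.continuousOn_logSolution`). At `s = 0` only `α =
f'(1)` survives from `f`, and for `r ≠ 0` the equation reads `(1 - α)(exp(-r y) - 1) + α (exp(r (w -
y)) - 1) = 0` up to the factor `1 / r`, whose root is the power mean (`IsScalarMean.solution_zero`).
Joint continuity gives locally uniform convergence of representing functions, and the functional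
calculus turns this into norm convergence.

Differentiability of `f` at `1` is what gives the quotient a limit. Jensen's inequality for vector
states makes `f` concave, so the one-sided derivatives exist and are ordered. The dual inequality,
for rank one minorants, says that `1 / f(1/t)` is midpoint concave at `1`. Since `t ↦ 1/t` exchanges
the two sides of `1`, this orders the one-sided derivatives the other way. -/

theorem isSelfAdjoint_conj {A C : H →L[ℂ] H} (hC : IsSelfAdjoint C) (hA : IsSelfAdjoint A) :
    IsSelfAdjoint (C * A * C) := by
  have := hA.conjugate C
  rwa [hC.star_eq] at this

theorem conj_le_conj {A B C : H →L[ℂ] H} (hC : IsSelfAdjoint C) (h : A ≤ B) :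
    C * A * C ≤ C * B * C := by
  have := star_right_conjugate_le_conjugate h C
  rwa [hC.star_eq] at this

theorem conj_nonneg {A C : H →L[ℂ] H} (hC : IsSelfAdjoint C) (h : 0 ≤ A) : 0 ≤ C * A * C := by
  simpa using conj_le_conj hC h

theorem isStrictlyPositive_conj {A C : H →L[ℂ] H} (hC : IsStrictlyPositive C)
    (hA : IsStrictlyPositive A) : IsStrictlyPositive (C * A * C) :=
  IsStrictlyPositive.conjugate_of_isUnit_of_isSelfAdjoint A C hC.isUnit hC.isSelfAdjoint hA

theorem rpow_half_mul_self {A : H →L[ℂ] H} (hA : IsStrictlyPositive A) :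
    A ^ (1 / 2 : ℝ) * A ^ (1 / 2 : ℝ) = A := by
  rw [← CFC.rpow_add hA.isUnit, add_halves, CFC.rpow_one A hA.nonneg]

/-- The functional calculus commutes with unitary conjugation. -/
theorem cfc_unitary_conj {f : ℝ → ℝ} {U B : H →L[ℂ] H} (h₁ : star U * U = 1) (h₂ : U * star U = 1)
    (hB : IsSelfAdjoint B) (hf : ContinuousOn f (spectrum ℝ B)) :
    cfc f (U * B * star U) = U * cfc f B * star U := by
  have hU : U ∈ unitary (H →L[ℂ] H) := Unitary.mem_iff.2 ⟨h₁, h₂⟩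
  have hφ : Continuous (Unitary.conjStarAlgAut ℂ (H →L[ℂ] H) ⟨U, hU⟩) := by
    change Continuous fun x : H →L[ℂ] H => U * x * star U
    fun_prop
  have := StarAlgHomClass.map_cfc (S := ℂ) (Unitary.conjStarAlgAut ℂ (H →L[ℂ] H) ⟨U, hU⟩) f B hf hφ hB
    (hB.conjugate U)
  exact this.symm

/-- The square root of `A` may be replaced by any invertible `T` with `T T* = A`: then `A^{-1/2} T`
is unitary, and the functional calculus commutes with unitary conjugation. -/
theorem perspective_eq_of_mul_star {f : ℝ → ℝ} {T S A B : H →L[ℂ] H} (hTS : T * S = 1)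
    (hST : S * T = 1) (hT : T * star T = A) (hB : IsSelfAdjoint B)
    (hf : ContinuousOn f (spectrum ℝ (S * B * star S))) :
    perspective f A B = T * cfc f (S * B * star S) * star T := by
  have hTu : IsUnit T := ⟨⟨T, S, hTS, hST⟩, rfl⟩
  have hA : IsStrictlyPositive A := by
    have := (hTu.isStrictlyPositive_star_right_conjugate_iff (a := (1 : H →L[ℂ] H))).2
      isStrictlyPositive_one
    rwa [mul_one, hT] at this
  set a := A ^ (1 / 2 : ℝ) with ha
  set b := A ^ (-(1 / 2) : ℝ) with hb
  have hab : a * b = 1 := CFC.rpow_mul_rpow_neg (1 / 2 : ℝ) hA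
  have hba : b * a = 1 := CFC.rpow_neg_mul_rpow (1 / 2 : ℝ) hA
  have haa : a * a = A := rpow_half_mul_self hA
  have hbs : star b = b := (hA.rpow (y := -(1 / 2))).isSelfAdjoint.star_eq
  have hSs : star T * star S = 1 := by rw [← star_mul, hST, star_one]
  have hUU : (b * T) * star (b * T) = 1 := by
    rw [star_mul, hbs]
    calc b * T * (star T * b) = b * (T * star T) * b := by simp only [mul_assoc]
      _ = (b * a) * (a * b) := by rw [hT, ← haa]; simp only [mul_assoc]
      _ = 1 := by rw [hba, hab, mul_one]
  have hinv : (b * T) * (S * a) = 1 := by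
    calc b * T * (S * a) = b * (T * S) * a := by simp only [mul_assoc]
      _ = 1 := by rw [hTS, mul_one, hba]
  have hinv' : (S * a) * (b * T) = 1 := by
    calc S * a * (b * T) = S * (a * b) * T := by simp only [mul_assoc]
      _ = 1 := by rw [hab, mul_one, hST]
  have hstar : star (b * T) = S * a := by
    calc star (b * T) = (S * a) * (b * T) * star (b * T) := by rw [hinv', one_mul]
      _ = S * a := by rw [mul_assoc, hUU, mul_one]
  have hUU' : star (b * T) * (b * T) = 1 := by rw [hstar, hinv']
  have hconj : b * B * b = (b * T) * (S * B * star S) * star (b * T) := by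
    rw [star_mul, hbs]
    calc b * B * b = b * ((T * S) * B * (star S * star T)) * b := by
          rw [hTS, ← star_mul, hTS, star_one, one_mul, mul_one]
      _ = _ := by simp only [mul_assoc]
  rw [perspective, ← ha, ← hb, hconj, cfc_unitary_conj hUU' hUU (hB.conjugate S) hf]
  have h1 : a * (b * T) = T := by rw [← mul_assoc, hab, one_mul]
  have h2 : star (b * T) * a = star T := by
    rw [star_mul, hbs, mul_assoc, hba, mul_one]
  calc a * (b * T * cfc f (S * B * star S) * star (b * T)) * a
      = (a * (b * T)) * cfc f (S * B * star S) * (star (b * T) * a) := by simp only [mul_assoc]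
    _ = _ := by rw [h1, h2]

theorem continuousOn_spectrum {f : ℝ → ℝ} (hf : ContinuousOn f (Ioi 0)) {A : H →L[ℂ] H}
    (hA : IsStrictlyPositive A) : ContinuousOn f (spectrum ℝ A) :=
  hf.mono fun _ hx => hA.spectrum_pos hx

/-- A pair of positive invertible operators is congruent to a pair `(1, C)`. -/
theorem exists_congruence {A B : H →L[ℂ] H} (hA : IsStrictlyPositive A)
    (hB : IsStrictlyPositive B) : ∃ T C : H →L[ℂ] H, IsStrictlyPositive T ∧ IsStrictlyPositive C ∧
      A = T * T ∧ B = T * C * T ∧ ∀ f, perspective f A B = T * cfc f C * T := by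
  refine ⟨A ^ (1 / 2 : ℝ), A ^ (-(1 / 2) : ℝ) * B * A ^ (-(1 / 2) : ℝ), hA.rpow (y := 1 / 2),
    isStrictlyPositive_conj (hA.rpow (y := -(1 / 2))) hB, (rpow_half_mul_self hA).symm, ?_,
    fun f => rfl⟩
  have hab : A ^ (1 / 2 : ℝ) * A ^ (-(1 / 2) : ℝ) = 1 := CFC.rpow_mul_rpow_neg (1 / 2 : ℝ) hA
  have hba : A ^ (-(1 / 2) : ℝ) * A ^ (1 / 2 : ℝ) = 1 := CFC.rpow_neg_mul_rpow (1 / 2 : ℝ) hA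
  calc B = (A ^ (1 / 2 : ℝ) * A ^ (-(1 / 2) : ℝ)) * B * (A ^ (-(1 / 2) : ℝ) * A ^ (1 / 2 : ℝ)) := by
        rw [hab, hba, one_mul, mul_one]
    _ = _ := by simp only [mul_assoc]

theorem isStrictlyPositive_cfc {f : ℝ → ℝ} {C : H →L[ℂ] H} (hC : IsSelfAdjoint C)
    (hf : ContinuousOn f (spectrum ℝ C)) (hpos : ∀ t ∈ spectrum ℝ C, 0 < f t) :
    IsStrictlyPositive (cfc f C) :=
  (cfc_isStrictlyPositive_iff f C hf hC).2 hpos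

theorem isStrictlyPositive_perspective {f : ℝ → ℝ} (hf : ContinuousOn f (Ioi 0))
    (hpos : ∀ t, 0 < t → 0 < f t) {A B : H →L[ℂ] H} (hA : IsStrictlyPositive A)
    (hB : IsStrictlyPositive B) : IsStrictlyPositive (perspective f A B) := by
  obtain ⟨T, C, hT, hC, -, -, h⟩ := exists_congruence hA hB
  rw [h]
  exact isStrictlyPositive_conj hT (isStrictlyPositive_cfc hC.isSelfAdjoint
    (continuousOn_spectrum hf hC) fun t ht => hpos t (hC.spectrum_pos ht))

/-- If `A = T T`, then `C A C` factors through `C T`, and relative to this factor the second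
argument reduces to the same operator `D` as before. -/
theorem perspective_conj {f : ℝ → ℝ} (hf : ContinuousOn f (Ioi 0)) {A B C : H →L[ℂ] H}
    (hA : IsStrictlyPositive A) (hB : IsStrictlyPositive B) (hC : IsStrictlyPositive C) :
    perspective f (C * A * C) (C * B * C) = C * perspective f A B * C := by
  obtain ⟨T, D, hT, hD, rfl, rfl, h⟩ := exists_congruence hA hB
  obtain ⟨T', hTT', hT'T⟩ : ∃ T', (C * T) * T' = 1 ∧ T' * (C * T) = 1 := by
    exact isUnit_iff_exists.1 (hC.isUnit.mul hT.isUnit)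
  have hs : star (C * T) = T * C := by
    rw [star_mul, hC.isSelfAdjoint.star_eq, hT.isSelfAdjoint.star_eq]
  have hs' : (T * C) * star T' = 1 := by rw [← hs, ← star_mul, hT'T, star_one]
  have e : T' * (C * (T * D * T) * C) * star T' = D := by
    calc T' * (C * (T * D * T) * C) * star T' = (T' * (C * T)) * D * ((T * C) * star T') := by
          simp only [mul_assoc]
      _ = D := by rw [hT'T, hs', one_mul, mul_one]
  rw [perspective_eq_of_mul_star hTT' hT'T, e, h, hs]
  · simp only [mul_assoc]
  · rw [hs]; simp only [mul_assoc]
  · exact isSelfAdjoint_conj hC.isSelfAdjoint hB.isSelfAdjoint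
  · rw [e]; exact continuousOn_spectrum hf hD

theorem cfc_mul_cfc {C : H →L[ℂ] H} {a b : ℝ → ℝ} (ha : ContinuousOn a (spectrum ℝ C))
    (hb : ContinuousOn b (spectrum ℝ C)) : cfc a C * cfc b C = cfc (fun t => a t * b t) C :=
  (cfc_mul a b C ha hb).symm

theorem isSelfAdjoint_cfc (a : ℝ → ℝ) (C : H →L[ℂ] H) : IsSelfAdjoint (cfc a C) :=
  cfc_predicate (p := IsSelfAdjoint) a C

/-- For commuting arguments the perspective is computed pointwise on the spectrum. The factor of
`a(C)` is `√a (C)`, which is inverted explicitly in the calculus of `C`. -/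
theorem perspective_cfc {g a b : ℝ → ℝ} (hg : ContinuousOn g (Ioi 0)) {C : H →L[ℂ] H}
    (hC : IsSelfAdjoint C) (ha : ContinuousOn a (spectrum ℝ C)) (hb : ContinuousOn b (spectrum ℝ C))
    (hapos : ∀ t ∈ spectrum ℝ C, 0 < a t) (hbpos : ∀ t ∈ spectrum ℝ C, 0 < b t) :
    perspective g (cfc a C) (cfc b C) = cfc (fun t => a t * g (b t / a t)) C := by
  have hsp : ∀ t ∈ spectrum ℝ C, 0 < √(a t) := fun t ht => Real.sqrt_pos.2 (hapos t ht)
  have hsa : ContinuousOn (fun t => √(a t)) (spectrum ℝ C) := ha.sqrt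
  have hsi : ContinuousOn (fun t => (√(a t))⁻¹) (spectrum ℝ C) :=
    hsa.inv₀ fun t ht => (hsp t ht).ne'
  have hq : ContinuousOn (fun t => b t / a t) (spectrum ℝ C) :=
    hb.div ha fun t ht => (hapos t ht).ne'
  have hqp : ∀ t ∈ spectrum ℝ C, 0 < b t / a t := fun t ht => div_pos (hbpos t ht) (hapos t ht)
  have hgq : ContinuousOn g ((fun t => b t / a t) '' spectrum ℝ C) :=
    hg.mono (by rintro _ ⟨t, ht, rfl⟩; exact hqp t ht)
  have hgq' : ContinuousOn (fun t => g (b t / a t)) (spectrum ℝ C) := hg.comp hq hqp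
  have e1 : cfc (fun t => √(a t)) C * cfc (fun t => (√(a t))⁻¹) C = 1 := by
    rw [cfc_mul_cfc hsa hsi, ← cfc_one ℝ C hC]
    exact cfc_congr fun t ht => mul_inv_cancel₀ (hsp t ht).ne'
  have e2 : cfc (fun t => (√(a t))⁻¹) C * cfc (fun t => √(a t)) C = 1 := by
    rw [cfc_mul_cfc hsi hsa, ← cfc_one ℝ C hC]
    exact cfc_congr fun t ht => inv_mul_cancel₀ (hsp t ht).ne'
  have e3 : cfc (fun t => √(a t)) C * cfc (fun t => √(a t)) C = cfc a C := by
    rw [cfc_mul_cfc hsa hsa]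
    exact cfc_congr fun t ht => Real.mul_self_sqrt (hapos t ht).le
  have hS : cfc (fun t => (√(a t))⁻¹) C * cfc b C * star (cfc (fun t => (√(a t))⁻¹) C) =
      cfc (fun t => b t / a t) C := by
    rw [(isSelfAdjoint_cfc (fun t => (√(a t))⁻¹) C).star_eq, cfc_mul_cfc hsi hb,
      cfc_mul_cfc (a := fun t => (√(a t))⁻¹ * b t) (hsi.mul hb) hsi]
    refine cfc_congr fun t ht => ?_
    calc _ = b t / (√(a t) * √(a t)) := by field_simp
      _ = _ := by rw [Real.mul_self_sqrt (hapos t ht).le]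
  rw [perspective_eq_of_mul_star e1 e2 ?_ (isSelfAdjoint_cfc b C) ?_, hS,
    ← cfc_comp' g (fun t => b t / a t) C hgq hq hC, (isSelfAdjoint_cfc (fun t => √(a t)) C).star_eq,
    cfc_mul_cfc hsa hgq',
    cfc_mul_cfc (a := fun t => √(a t) * g (b t / a t)) (hsa.mul hgq') hsa]
  · refine cfc_congr fun t ht => ?_
    calc _ = (√(a t) * √(a t)) * g (b t / a t) := by ring
      _ = _ := by rw [Real.mul_self_sqrt (hapos t ht).le]
  · rw [(isSelfAdjoint_cfc (fun t => √(a t)) C).star_eq, e3]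
  · rw [hS, cfc_map_spectrum (fun t => b t / a t) C hC hq]
    exact hgq

/-- Perspectives of commuting pairs, up to congruence. -/
theorem perspective_conj_cfc {g a b : ℝ → ℝ} (hg : ContinuousOn g (Ioi 0)) {T C : H →L[ℂ] H}
    (hT : IsStrictlyPositive T) (hC : IsSelfAdjoint C)
    (ha : ContinuousOn a (spectrum ℝ C)) (hb : ContinuousOn b (spectrum ℝ C))
    (hapos : ∀ t ∈ spectrum ℝ C, 0 < a t) (hbpos : ∀ t ∈ spectrum ℝ C, 0 < b t) :
    perspective g (T * cfc a C * T) (T * cfc b C * T) =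
      T * cfc (fun t => a t * g (b t / a t)) C * T := by
  rw [perspective_conj hg (isStrictlyPositive_cfc hC ha hapos) (isStrictlyPositive_cfc hC hb hbpos) hT,
    perspective_cfc hg hC ha hb hapos hbpos]

theorem perspective_smul {f : ℝ → ℝ} (hf : ContinuousOn f (Ioi 0)) {A B : H →L[ℂ] H}
    (hA : IsStrictlyPositive A) (hB : IsStrictlyPositive B) {c : ℝ} (hc : 0 < c) :
    perspective f (c • A) (c • B) = c • perspective f A B := by
  have h := perspective_conj hf hA hB
    (IsStrictlyPositive.smul (Real.sqrt_pos.2 hc) (isStrictlyPositive_one (A := H →L[ℂ] H)))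
  have e : ∀ X : H →L[ℂ] H, (√c • (1 : H →L[ℂ] H)) * X * (√c • 1) = c • X := fun X => by
    simp only [smul_mul_assoc, one_mul, mul_smul_comm, mul_one, smul_smul,
      Real.mul_self_sqrt hc.le]
  rwa [e, e, e] at h

theorem perspective_one_left {f : ℝ → ℝ} (B : H →L[ℂ] H) : perspective f 1 B = cfc f B := by
  simp [perspective, CFC.one_rpow]

theorem perspective_one_smul {f : ℝ → ℝ} (t : ℝ) :
    perspective f (1 : H →L[ℂ] H) (t • 1) = f t • 1 := by
  rw [perspective_one_left, ← Algebra.algebraMap_eq_smul_one, cfc_algebraMap,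
    Algebra.algebraMap_eq_smul_one]

theorem perspective_congr {f g : ℝ → ℝ} (h : EqOn f g (Ioi 0)) {A B : H →L[ℂ] H}
    (hA : IsStrictlyPositive A) (hB : IsStrictlyPositive B) :
    perspective f A B = perspective g A B := by
  obtain ⟨T, C, hT, hC, -, -, h'⟩ := exists_congruence hA hB
  rw [h', h', cfc_congr (fun t ht => h (hC.spectrum_pos ht))]

theorem perspective_transpose {g : ℝ → ℝ} (hg : ContinuousOn g (Ioi 0)) {A B : H →L[ℂ] H}
    (hA : IsStrictlyPositive A) (hB : IsStrictlyPositive B) :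
    perspective g B A = perspective (fun t => t * g t⁻¹) A B := by
  obtain ⟨T, C, hT, hC, rfl, rfl, h⟩ := exists_congruence hA hB
  have := perspective_conj_cfc hg hT hC.isSelfAdjoint (a := fun t => t) (b := fun _ => 1)
    continuousOn_id continuousOn_const (fun t ht => hC.spectrum_pos ht) (fun _ _ => one_pos)
  rw [cfc_id' ℝ C hC.isSelfAdjoint, cfc_const_one ℝ C hC.isSelfAdjoint, mul_one] at this
  rw [this, h]
  simp only [one_div]

/-- Operator monotonicity of `g` controls the second argument only. Exchanging the arguments
replaces `g` by `t g(1/t)`, so monotonicity of this transpose controls the first. -/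
theorem perspective_mono_left_of_transpose {g : ℝ → ℝ} (hg : ContinuousOn g (Ioi 0))
    (h : ∀ C D : H →L[ℂ] H, IsStrictlyPositive C → C ≤ D → cfc g C ≤ cfc g D)
    (h' : ∀ C D : H →L[ℂ] H, IsStrictlyPositive C → C ≤ D →
      cfc (fun t => t * g t⁻¹) C ≤ cfc (fun t => t * g t⁻¹) D)
    {A A' B B' : H →L[ℂ] H} (hA : IsStrictlyPositive A) (hB : IsStrictlyPositive B)
    (hAA' : A ≤ A') (hBB' : B ≤ B') : perspective g A B ≤ perspective g A' B' := by
  have key : ∀ (f : ℝ → ℝ), (∀ C D : H →L[ℂ] H, IsStrictlyPositive C → C ≤ D → cfc f C ≤ cfc f D) →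
      ∀ A B B' : H →L[ℂ] H, IsStrictlyPositive A → IsStrictlyPositive B → B ≤ B' →
        perspective f A B ≤ perspective f A B' := fun f hf A B B' hA hB hBB' => by
    have hs := (hA.rpow (y := -(1 / 2)))
    exact conj_le_conj (hA.rpow (y := 1 / 2)).isSelfAdjoint
      (hf _ _ (isStrictlyPositive_conj hs hB) (conj_le_conj hs.isSelfAdjoint hBB'))
  have hA' := hA.of_le hAA'
  have hB' := hB.of_le hBB'
  refine (key g h A B B' hA hB hBB').trans ?_
  rw [perspective_transpose hg hB' hA, perspective_transpose hg hB' hA']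
  exact key _ h' B' A A' hB' hA hAA'

/-- The positive functions whose perspective is jointly monotone. -/
structure IsMeanFun (H : Type*) [NormedAddCommGroup H] [InnerProductSpace ℂ H] [CompleteSpace H]
    (f : ℝ → ℝ) : Prop where
  continuousOn : ContinuousOn f (Ioi 0)
  pos : ∀ t, 0 < t → 0 < f t
  map_one : f 1 = 1
  mono : ∀ A A' B B' : H →L[ℂ] H, IsStrictlyPositive A → IsStrictlyPositive B → A ≤ A' → B ≤ B' →
    perspective f A B ≤ perspective f A' B'

end

/-! ### Monotone perspectives, the comparison principle and power functions -/

section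

variable {H : Type*} [NormedAddCommGroup H] [InnerProductSpace ℂ H] [CompleteSpace H]

theorem cfc_rpow {C : H →L[ℂ] H} (hC : IsStrictlyPositive C) (r : ℝ) :
    cfc (fun t : ℝ => t ^ r) C = C ^ r :=
  (CFC.rpow_eq_cfc_real hC.nonneg).symm

/-- The transpose of `t ^ r` is `t ^ (1 - r)`, so the Löwner–Heinz inequality applies to both
variables. -/
theorem isMeanFun_rpow {r : ℝ} (hr : r ∈ Icc (0 : ℝ) 1) : IsMeanFun H fun t => t ^ r where
  continuousOn := fun t ht => (Real.continuousAt_rpow_const t r (.inl ht.ne')).continuousWithinAt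
  pos := fun t ht => Real.rpow_pos_of_pos ht r
  map_one := Real.one_rpow r
  mono := fun A A' B B' hA hB hAA' hBB' => by
    have key : ∀ p ∈ Icc (0 : ℝ) 1, ∀ C D : H →L[ℂ] H, IsStrictlyPositive C → C ≤ D →
        cfc (fun t : ℝ => t ^ p) C ≤ cfc (fun t : ℝ => t ^ p) D := fun p hp C D hC hCD => by
      rw [cfc_rpow hC, cfc_rpow (hC.of_le hCD)]
      exact CFC.rpow_le_rpow hp hCD
    have key' : ∀ C : H →L[ℂ] H, IsStrictlyPositive C →
        cfc (fun t : ℝ => t * t⁻¹ ^ r) C = cfc (fun t : ℝ => t ^ (1 - r)) C := fun C hC =>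
      cfc_congr fun t ht => by
        have h := hC.spectrum_pos ht
        change t * t⁻¹ ^ r = t ^ (1 - r)
        rw [Real.inv_rpow h.le, Real.rpow_sub h, Real.rpow_one, div_eq_mul_inv]
    refine perspective_mono_left_of_transpose (fun t ht => (Real.continuousAt_rpow_const t r
      (.inl (ne_of_gt ht))).continuousWithinAt) (key r hr) (fun C D hC hCD => ?_) hA hB hAA' hBB'
    rw [key' C hC, key' D (hC.of_le hCD)]
    exact key _ ⟨by linarith [hr.2], by linarith [hr.1]⟩ C D hC hCD

theorem perspective_affine {A B : H →L[ℂ] H} (hA : IsStrictlyPositive A)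
    (hB : IsStrictlyPositive B) (s : ℝ) :
    perspective (fun t => 1 - s + s * t) A B = (1 - s) • A + s • B := by
  obtain ⟨T, C, hT, hC, rfl, rfl, h⟩ := exists_congruence hA hB
  rw [h, cfc_const_add (1 - s) (fun t => s * t) C (by fun_prop) hC.isSelfAdjoint,
    cfc_const_mul_id s C hC.isSelfAdjoint, Algebra.algebraMap_eq_smul_one, mul_add, add_mul]
  simp only [mul_smul_comm, smul_mul_assoc, mul_one]

theorem isMeanFun_affine {s : ℝ} (hs : s ∈ Icc (0 : ℝ) 1) :
    IsMeanFun H fun t => 1 - s + s * t where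
  continuousOn := by fun_prop
  pos := fun t ht => by
    rcases hs.1.eq_or_lt with rfl | h
    · simp
    · nlinarith [hs.2, mul_pos h ht]
  map_one := by ring
  mono := fun A A' B B' hA hB hAA' hBB' => by
    rw [perspective_affine hA hB, perspective_affine (hA.of_le hAA') (hB.of_le hBB')]
    exact add_le_add (smul_le_smul_of_nonneg_left hAA' (by linarith [hs.2]))
      (smul_le_smul_of_nonneg_left hBB' hs.1)

theorem continuousOn_adjoint {f : ℝ → ℝ} (hf : ContinuousOn f (Ioi 0))
    (hpos : ∀ t, 0 < t → 0 < f t) : ContinuousOn (fun t => (f t⁻¹)⁻¹) (Ioi 0) := by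
  refine ContinuousOn.inv₀ (hf.comp (continuousOn_id.inv₀ fun t ht => (ne_of_gt ht)) ?_) ?_
  · exact fun t ht => inv_pos.2 (mem_Ioi.1 ht)
  · exact fun t ht => (hpos _ (inv_pos.2 ht)).ne'

theorem ringInverse_eq {A B : H →L[ℂ] H} (h : A * B = 1) (h' : B * A = 1) :
    Ring.inverse A = B :=
  Ring.inverse_unit ⟨A, B, h, h'⟩

/-- After a congruence to `(I, C)` both sides are explicit functions of `C`, conjugated by `T` or by
its inverse, and inversion acts pointwise. -/
theorem ringInverse_perspective {f : ℝ → ℝ} (hf : ContinuousOn f (Ioi 0))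
    (hpos : ∀ t, 0 < t → 0 < f t) {A B : H →L[ℂ] H} (hA : IsStrictlyPositive A)
    (hB : IsStrictlyPositive B) :
    Ring.inverse (perspective f (Ring.inverse A) (Ring.inverse B)) =
      perspective (fun t => (f t⁻¹)⁻¹) A B := by
  obtain ⟨T, C, hT, hC, rfl, rfl, h⟩ := exists_congruence hA hB
  obtain ⟨S, hTS, hST⟩ := isUnit_iff_exists.1 hT.isUnit
  have hS : IsStrictlyPositive S := by
    rw [← ringInverse_eq hTS hST]; exact hT.ringInverse
  have hsp : ∀ t ∈ spectrum ℝ C, 0 < t := fun t ht => hC.spectrum_pos ht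
  have hi : ContinuousOn (fun t : ℝ => t⁻¹) (spectrum ℝ C) :=
    continuousOn_id.inv₀ fun t ht => (hsp t ht).ne'
  have hCi : C * cfc (fun t : ℝ => t⁻¹) C = 1 := by
    nth_rw 1 [← cfc_id' ℝ C hC.isSelfAdjoint]
    rw [cfc_mul_cfc (a := fun t => t) continuousOn_id hi, ← cfc_one ℝ C hC.isSelfAdjoint]
    exact cfc_congr fun t ht => mul_inv_cancel₀ (hsp t ht).ne'
  have hiC : cfc (fun t : ℝ => t⁻¹) C * C = 1 := by
    nth_rw 2 [← cfc_id' ℝ C hC.isSelfAdjoint]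
    rw [cfc_mul_cfc (b := fun t => t) hi continuousOn_id, ← cfc_one ℝ C hC.isSelfAdjoint]
    exact cfc_congr fun t ht => inv_mul_cancel₀ (hsp t ht).ne'
  have e1 : Ring.inverse (T * T) = S * cfc (fun _ => (1 : ℝ)) C * S := by
    rw [cfc_const_one ℝ C hC.isSelfAdjoint, mul_one]
    refine ringInverse_eq ?_ ?_
    · calc T * T * (S * S) = T * (T * S) * S := by simp only [mul_assoc]
        _ = 1 := by rw [hTS, mul_one, hTS]
    · calc S * S * (T * T) = S * (S * T) * T := by simp only [mul_assoc]
        _ = 1 := by rw [hST, mul_one, hST]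
  have e2 : Ring.inverse (T * C * T) = S * cfc (fun t : ℝ => t⁻¹) C * S := by
    refine ringInverse_eq ?_ ?_
    · calc T * C * T * (S * cfc (fun t : ℝ => t⁻¹) C * S)
          = T * (C * (T * S) * cfc (fun t : ℝ => t⁻¹) C) * S := by simp only [mul_assoc]
        _ = 1 := by rw [hTS, mul_one, hCi, mul_one, hTS]
    · calc S * cfc (fun t : ℝ => t⁻¹) C * S * (T * C * T)
          = S * (cfc (fun t : ℝ => t⁻¹) C * (S * T) * C) * T := by simp only [mul_assoc]
        _ = 1 := by rw [hST, mul_one, hiC, mul_one, hST]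
  rw [e1, e2, perspective_conj_cfc hf hS hC.isSelfAdjoint continuousOn_const hi
    (fun _ _ => one_pos) (fun t ht => inv_pos.2 (hsp t ht)), h]
  have hc1 : ContinuousOn (fun t => 1 * f (t⁻¹ / 1)) (spectrum ℝ C) := by
    simp only [one_mul, div_one]
    exact hf.comp hi fun t ht => inv_pos.2 (hsp t ht)
  have hc2 : ContinuousOn (fun t => (f t⁻¹)⁻¹) (spectrum ℝ C) :=
    continuousOn_spectrum (continuousOn_adjoint hf hpos) hC
  have hne : ∀ t ∈ spectrum ℝ C, f t⁻¹ ≠ 0 := fun t ht => (hpos _ (inv_pos.2 (hsp t ht))).ne'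
  have m1 : cfc (fun t => 1 * f (t⁻¹ / 1)) C * cfc (fun t => (f t⁻¹)⁻¹) C = 1 := by
    rw [cfc_mul_cfc hc1 hc2, ← cfc_one ℝ C hC.isSelfAdjoint]
    exact cfc_congr fun t ht => by simpa using mul_inv_cancel₀ (hne t ht)
  have m2 : cfc (fun t => (f t⁻¹)⁻¹) C * cfc (fun t => 1 * f (t⁻¹ / 1)) C = 1 := by
    rw [cfc_mul_cfc hc2 hc1, ← cfc_one ℝ C hC.isSelfAdjoint]
    exact cfc_congr fun t ht => by simpa using inv_mul_cancel₀ (hne t ht)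
  refine ringInverse_eq ?_ ?_
  · calc _ = S * (cfc (fun t => 1 * f (t⁻¹ / 1)) C * (S * T) * cfc (fun t => (f t⁻¹)⁻¹) C) * T := by
          simp only [mul_assoc]
      _ = 1 := by rw [hST, mul_one, m1, mul_one, hST]
  · calc _ = T * (cfc (fun t => (f t⁻¹)⁻¹) C * (T * S) * cfc (fun t => 1 * f (t⁻¹ / 1)) C) * S := by
          simp only [mul_assoc]
      _ = 1 := by rw [hTS, mul_one, m2, mul_one, hTS]

/-- Inversion reverses the operator order and is applied twice, before and after the perspective. -/
theorem IsMeanFun.adjoint {f : ℝ → ℝ} (hf : IsMeanFun H f) :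
    IsMeanFun H fun t => (f t⁻¹)⁻¹ where
  continuousOn := continuousOn_adjoint hf.continuousOn hf.pos
  pos := fun t ht => inv_pos.2 (hf.pos _ (inv_pos.2 ht))
  map_one := by simp [hf.map_one]
  mono := fun A A' B B' hA hB hAA' hBB' => by
    have hA' := hA.of_le hAA'
    have hB' := hB.of_le hBB'
    rw [← ringInverse_perspective hf.continuousOn hf.pos hA hB,
      ← ringInverse_perspective hf.continuousOn hf.pos hA' hB']
    exact CStarAlgebra.ringInverse_le_ringInverse
      (hf.mono _ _ _ _ hA'.ringInverse hB'.ringInverse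
        (CStarAlgebra.ringInverse_le_ringInverse hAA' hA)
        (CStarAlgebra.ringInverse_le_ringInverse hBB' hB))
      (isStrictlyPositive_perspective hf.continuousOn hf.pos hA'.ringInverse hB'.ringInverse)

/-- The map whose positive invertible fixed point is the deformed mean. -/
def deformMap (f g : ℝ → ℝ) (A B X : H →L[ℂ] H) : H →L[ℂ] H :=
  perspective f (perspective g X A) (perspective g X B)

theorem exists_lt_one_forall_le {g : ℝ → ℝ} (hg : ContinuousOn g (Ioi 0))
    (hpos : ∀ t, 0 < t → 0 < g t) (hmono : StrictMonoOn g (Ioi 0)) {K : Set ℝ} (hK : IsCompact K)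
    (hK0 : K ⊆ Ioi 0) {l : ℝ} (hl : 1 < l) :
    ∃ κ, 0 < κ ∧ κ < 1 ∧ ∀ t ∈ K, g (t / l) ≤ κ * g t := by
  have hl0 : 0 < l := one_pos.trans hl
  have hd : ∀ t ∈ K, 0 < t / l := fun t ht => div_pos (hK0 ht) hl0
  rcases K.eq_empty_or_nonempty with rfl | hne
  · exact ⟨1 / 2, by norm_num, by norm_num, by simp⟩
  have hc : ContinuousOn (fun t => g (t / l) / g t) K :=
    (hg.comp (by fun_prop) hd).div (hg.mono hK0) fun t ht => (hpos t (hK0 ht)).ne'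
  obtain ⟨t₀, ht₀, hmax⟩ := hK.exists_isMaxOn hne hc
  refine ⟨g (t₀ / l) / g t₀, div_pos (hpos _ (hd _ ht₀)) (hpos _ (hK0 ht₀)), ?_, fun t ht => ?_⟩
  · rw [div_lt_one (hpos _ (hK0 ht₀))]
    exact hmono (hd _ ht₀) (hK0 ht₀) (div_lt_self (hK0 ht₀) hl)
  · exact (div_le_iff₀ (hpos t (hK0 ht))).1 (hmax ht)

/-- Strict subhomogeneity in the first variable. In the coordinates `(I, C)` the left side is `l g(C
/ l)`, and strict monotonicity of `g` on the compact spectrum gives `g(t / l) ≤ κ g(t)` with a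
uniform `κ < 1`. -/
theorem exists_perspective_smul_le {g : ℝ → ℝ} (hg : ContinuousOn g (Ioi 0))
    (hpos : ∀ t, 0 < t → 0 < g t) (hmono : StrictMonoOn g (Ioi 0)) {Y A : H →L[ℂ] H}
    (hY : IsStrictlyPositive Y) (hA : IsStrictlyPositive A) {l : ℝ} (hl : 1 < l) :
    ∃ κ, 0 < κ ∧ κ < 1 ∧ perspective g (l • Y) A ≤ (κ * l) • perspective g Y A := by
  obtain ⟨T, C, hT, hC, rfl, rfl, h⟩ := exists_congruence hY hA
  have hsub : spectrum ℝ C ⊆ Ioi 0 := fun t ht => hC.spectrum_pos ht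
  have hl0 : 0 < l := one_pos.trans hl
  obtain ⟨κ, hκ0, hκ1, hκ⟩ := exists_lt_one_forall_le hg hpos hmono
    (ContinuousFunctionalCalculus.isCompact_spectrum (R := ℝ) (p := IsSelfAdjoint) C) hsub hl
  refine ⟨κ, hκ0, hκ1, ?_⟩
  have hg' := continuousOn_spectrum hg hC
  have e := perspective_conj_cfc hg hT hC.isSelfAdjoint (a := fun _ => l) (b := fun t => t)
    continuousOn_const continuousOn_id (fun _ _ => hl0) hsub
  rw [cfc_id' ℝ C hC.isSelfAdjoint, cfc_const l C hC.isSelfAdjoint,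
    Algebra.algebraMap_eq_smul_one, mul_smul_comm, mul_one, smul_mul_assoc] at e
  have e' : (κ * l) • (T * cfc g C * T) = T * cfc (fun t => (κ * l) * g t) C * T := by
    rw [cfc_const_mul (κ * l) g C hg', mul_smul_comm, smul_mul_assoc]
  rw [e, h, e']
  refine conj_le_conj hT.isSelfAdjoint (cfc_mono (fun t ht => ?_) ?_ ?_)
  · calc l * g (t / l) ≤ l * (κ * g t) := mul_le_mul_of_nonneg_left (hκ t ht) hl0.le
      _ = κ * l * g t := by ring
  · exact continuousOn_const.mul (hg.comp (by fun_prop) fun t ht => div_pos (hsub ht) hl0)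
  · exact continuousOn_const.mul hg'

theorem exists_le_smul {X Y : H →L[ℂ] H} (hX : IsSelfAdjoint X) (hY : IsStrictlyPositive Y) :
    ∃ l : ℝ, 1 ≤ l ∧ X ≤ l • Y := by
  rcases subsingleton_or_nontrivial (H →L[ℂ] H) with h | h
  · exact ⟨1, le_rfl, (Subsingleton.elim _ _).le⟩
  obtain ⟨c, hc, hcY⟩ := (CFC.exists_pos_algebraMap_le_iff (A := H →L[ℂ] H) (a := Y)
    hY.isSelfAdjoint).2 fun x hx => hY.spectrum_pos hx
  have hX' := hX.le_algebraMap_norm_self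
  refine ⟨max 1 (‖X‖ / c), le_max_left _ _, hX'.trans ?_⟩
  calc algebraMap ℝ (H →L[ℂ] H) ‖X‖ = (‖X‖ / c) • algebraMap ℝ (H →L[ℂ] H) c := by
        rw [Algebra.algebraMap_eq_smul_one, Algebra.algebraMap_eq_smul_one, smul_smul,
          div_mul_cancel₀ _ hc.ne']
    _ ≤ (‖X‖ / c) • Y := smul_le_smul_of_nonneg_left hcY (by positivity)
    _ ≤ _ := smul_le_smul_of_nonneg_right (le_max_right _ _) hY.nonneg

/-- Comparison principle: sub-solutions of the fixed point equation are below super-solutions. -/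
theorem le_of_le_deformMap {f g : ℝ → ℝ} (hf : IsMeanFun H f) (hg : IsMeanFun H g)
    (hmono : StrictMonoOn g (Ioi 0)) {A B X Y : H →L[ℂ] H} (hA : IsStrictlyPositive A)
    (hB : IsStrictlyPositive B) (hX : IsStrictlyPositive X) (hY : IsStrictlyPositive Y)
    (hXl : X ≤ deformMap f g A B X) (hYl : deformMap f g A B Y ≤ Y) : X ≤ Y := by
  -- The best factor is taken among `l ≥ 1`: the infimum is then attained because `S` is closed, and
  -- the claim is exactly that it equals `1`.
  set S : Set ℝ := {l | 1 ≤ l ∧ X ≤ l • Y} with hS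
  have hcl : IsClosed S := by
    have h1 : IsClosed {l : ℝ | 1 ≤ l} := isClosed_Ici
    have h2 : IsClosed {l : ℝ | X ≤ l • Y} :=
      isClosed_le (f := fun _ : ℝ => X) (g := fun l : ℝ => l • Y) continuous_const (by fun_prop)
    exact h1.inter h2
  have hbdd : BddBelow S := ⟨1, fun l hl => hl.1⟩
  obtain ⟨h1, hle⟩ : sInf S ∈ S := hcl.csInf_mem (exists_le_smul hX.isSelfAdjoint hY) hbdd
  set l := sInf S with hl
  rcases h1.eq_or_lt with h | h
  · rwa [← h, one_smul] at hle
  exfalso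
  have hl0 : 0 < l := one_pos.trans h
  obtain ⟨κ, hκ0, hκ1, hκ⟩ : ∃ κ, 0 < κ ∧ κ < 1 ∧
      perspective g (l • Y) A ≤ (κ * l) • perspective g Y A ∧
      perspective g (l • Y) B ≤ (κ * l) • perspective g Y B := by
    obtain ⟨a, ha0, ha1, ha⟩ := exists_perspective_smul_le hg.continuousOn hg.pos hmono hY hA h
    obtain ⟨b, hb0, hb1, hb⟩ := exists_perspective_smul_le hg.continuousOn hg.pos hmono hY hB h
    refine ⟨max a b, ha0.trans_le (le_max_left _ _), max_lt ha1 hb1, ha.trans ?_, hb.trans ?_⟩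
    · exact smul_le_smul_of_nonneg_right (mul_le_mul_of_nonneg_right (le_max_left _ _) hl0.le)
        (isStrictlyPositive_perspective hg.continuousOn hg.pos hY hA).nonneg
    · exact smul_le_smul_of_nonneg_right (mul_le_mul_of_nonneg_right (le_max_right _ _) hl0.le)
        (isStrictlyPositive_perspective hg.continuousOn hg.pos hY hB).nonneg
  have spA := isStrictlyPositive_perspective hg.continuousOn hg.pos hX hA
  have spB := isStrictlyPositive_perspective hg.continuousOn hg.pos hX hB
  have spA' := isStrictlyPositive_perspective hg.continuousOn hg.pos hY hA
  have spB' := isStrictlyPositive_perspective hg.continuousOn hg.pos hY hB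
  -- One application of the fixed point map, with monotonicity and homogeneity, improves the factor
  -- from `l` to `κ l`.
  have hle' : X ≤ (κ * l) • Y := by
    calc X ≤ deformMap f g A B X := hXl
      _ ≤ perspective f ((κ * l) • perspective g Y A) ((κ * l) • perspective g Y B) :=
        hf.mono _ _ _ _ spA spB ((hg.mono _ _ _ _ hX hA hle le_rfl).trans hκ.1)
          ((hg.mono _ _ _ _ hX hB hle le_rfl).trans hκ.2)
      _ = (κ * l) • deformMap f g A B Y :=
        perspective_smul hf.continuousOn spA' spB' (mul_pos hκ0 hl0)
      _ ≤ (κ * l) • Y := smul_le_smul_of_nonneg_left hYl (mul_pos hκ0 hl0).le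
  have hlt : κ * l < l := by nlinarith
  -- The maximum with `1` keeps the factor admissible and is still below `l`, as `1 < l`; this
  -- contradicts minimality.
  have hmem : max 1 (κ * l) ∈ S :=
    ⟨le_max_left _ _, hle'.trans (smul_le_smul_of_nonneg_right (le_max_right _ _) hY.nonneg)⟩
  exact absurd (csInf_le hbdd hmem) (not_le.2 (max_lt h hlt))

theorem deformMap_mono {f g : ℝ → ℝ} (hf : IsMeanFun H f) (hg : IsMeanFun H g)
    {A A' B B' X : H →L[ℂ] H} (hA : IsStrictlyPositive A) (hB : IsStrictlyPositive B)
    (hX : IsStrictlyPositive X) (hAA' : A ≤ A') (hBB' : B ≤ B') :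
    deformMap f g A B X ≤ deformMap f g A' B' X :=
  hf.mono _ _ _ _ (isStrictlyPositive_perspective hg.continuousOn hg.pos hX hA)
    (isStrictlyPositive_perspective hg.continuousOn hg.pos hX hB)
    (hg.mono _ _ _ _ hX hA le_rfl hAA') (hg.mono _ _ _ _ hX hB le_rfl hBB')

/-- `x` solves the scalar fixed point equation `x = (x σ 1) τ (x σ t)`. -/
def IsScalarSolution (f g x : ℝ → ℝ) : Prop :=
  ∀ t, 0 < t → x t * g (1 / x t) * f (x t * g (t / x t) / (x t * g (1 / x t))) = x t

/-- With `A = T T` and `B = T C T`, the candidate is `T x(C) T`, so every perspective involved is of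
a commuting pair and the equation reduces to the scalar one on the spectrum of `C`. -/
theorem perspective_eq_deformMap {f g x : ℝ → ℝ} (hf : ContinuousOn f (Ioi 0))
    (hg : ContinuousOn g (Ioi 0)) (hgpos : ∀ t, 0 < t → 0 < g t) (hx : ContinuousOn x (Ioi 0))
    (hxpos : ∀ t, 0 < t → 0 < x t) (hsol : IsScalarSolution f g x) {A B : H →L[ℂ] H}
    (hA : IsStrictlyPositive A) (hB : IsStrictlyPositive B) :
    deformMap f g A B (perspective x A B) = perspective x A B := by
  obtain ⟨T, C, hT, hC, rfl, rfl, h⟩ := exists_congruence hA hB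
  have hsp : ∀ t ∈ spectrum ℝ C, 0 < t := fun t ht => hC.spectrum_pos ht
  have hxs : ContinuousOn x (spectrum ℝ C) := hx.mono hsp
  have hxp : ∀ t ∈ spectrum ℝ C, 0 < x t := fun t ht => hxpos t (hsp t ht)
  have e1 := perspective_conj_cfc hg hT hC.isSelfAdjoint (a := x) (b := fun _ => 1) hxs
    continuousOn_const hxp (fun _ _ => one_pos)
  have e2 := perspective_conj_cfc hg hT hC.isSelfAdjoint (a := x) (b := fun t => t) hxs
    continuousOn_id hxp hsp
  rw [cfc_const_one ℝ C hC.isSelfAdjoint, mul_one] at e1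
  rw [cfc_id' ℝ C hC.isSelfAdjoint] at e2
  rw [deformMap, h, e1, e2, perspective_conj_cfc hf hT hC.isSelfAdjoint]
  · exact congrArg (fun Z => T * Z * T) (cfc_congr fun t ht => hsol t (hsp t ht))
  · exact hxs.mul (hg.comp (continuousOn_const.div hxs fun t ht => (hxp t ht).ne')
      fun t ht => div_pos one_pos (hxp t ht))
  · exact hxs.mul (hg.comp (continuousOn_id.div hxs fun t ht => (hxp t ht).ne')
      fun t ht => div_pos (hsp t ht) (hxp t ht))
  · exact fun t ht => mul_pos (hxp t ht) (hgpos _ (div_pos one_pos (hxp t ht)))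
  · exact fun t ht => mul_pos (hxp t ht) (hgpos _ (div_pos (hsp t ht) (hxp t ht)))

/-- Two solutions are each a sub-solution and a super-solution, so comparison applies in both
directions. -/
theorem eq_perspective_of_eq_deformMap {f g x : ℝ → ℝ} (hf : IsMeanFun H f) (hg : IsMeanFun H g)
    (hmono : StrictMonoOn g (Ioi 0)) (hx : ContinuousOn x (Ioi 0))
    (hxpos : ∀ t, 0 < t → 0 < x t) (hsol : IsScalarSolution f g x) {A B X : H →L[ℂ] H}
    (hA : IsStrictlyPositive A) (hB : IsStrictlyPositive B) (hX : IsStrictlyPositive X)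
    (h : X = deformMap f g A B X) : X = perspective x A B := by
  have hp := isStrictlyPositive_perspective hx hxpos hA hB
  have e := perspective_eq_deformMap hf.continuousOn hg.continuousOn hg.pos hx hxpos hsol hA hB
  exact le_antisymm (le_of_le_deformMap hf hg hmono hA hB hX hp h.le e.le)
    (le_of_le_deformMap hf hg hmono hA hB hp hX e.ge h.ge)

/-- The deformation of a mean function is a mean function. -/
theorem IsMeanFun.deform {f g x : ℝ → ℝ} (hf : IsMeanFun H f) (hg : IsMeanFun H g)
    (hmono : StrictMonoOn g (Ioi 0)) (hx : ContinuousOn x (Ioi 0))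
    (hxpos : ∀ t, 0 < t → 0 < x t) (hx1 : x 1 = 1) (hsol : IsScalarSolution f g x) :
    IsMeanFun H x where
  continuousOn := hx
  pos := hxpos
  map_one := hx1
  mono := fun A A' B B' hA hB hAA' hBB' => by
    have hA' := hA.of_le hAA'
    have hB' := hB.of_le hBB'
    have hp := isStrictlyPositive_perspective hx hxpos hA hB
    have hp' := isStrictlyPositive_perspective hx hxpos hA' hB'
    refine le_of_le_deformMap hf hg hmono hA hB hp hp'
      (perspective_eq_deformMap hf.continuousOn hg.continuousOn hg.pos hx hxpos hsol hA hB).ge ?_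
    exact (deformMap_mono hf hg hA hB hp' hAA' hBB').trans
      (perspective_eq_deformMap hf.continuousOn hg.continuousOn hg.pos hx hxpos hsol hA' hB').le

theorem powerFun_pos {s r t : ℝ} (hs : s ∈ Icc (0 : ℝ) 1) (ht : 0 < t) : 0 < powerFun s r t := by
  have h := Real.rpow_pos_of_pos ht r
  rw [powerFun]
  split_ifs
  · exact Real.rpow_pos_of_pos ht s
  · refine Real.rpow_pos_of_pos ?_ _
    rcases hs.1.eq_or_lt with rfl | h'
    · simp
    · nlinarith [hs.2, mul_pos h' h]

theorem powerFun_base_pos {s r t : ℝ} (hs : s ∈ Icc (0 : ℝ) 1) (ht : 0 < t) :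
    0 < 1 - s + s * t ^ r := by
  have h := Real.rpow_pos_of_pos ht r
  rcases hs.1.eq_or_lt with rfl | h'
  · simp
  · nlinarith [hs.2, mul_pos h' h]

theorem powerFun_one (s r : ℝ) : powerFun s r 1 = 1 := by
  rw [powerFun]; split_ifs <;> simp

theorem continuousOn_powerFun {s r : ℝ} (hs : s ∈ Icc (0 : ℝ) 1) :
    ContinuousOn (powerFun s r) (Ioi 0) := by
  intro t ht
  refine ContinuousAt.continuousWithinAt ?_
  unfold powerFun
  split_ifs
  · exact Real.continuousAt_rpow_const t s (.inl (ne_of_gt ht))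
  · exact (continuousAt_const.add (continuousAt_const.mul
      (Real.continuousAt_rpow_const t r (.inl (ne_of_gt ht))))).rpow_const
      (.inl (powerFun_base_pos hs ht).ne')

/-- The exponent `-r` is the adjoint of the exponent `r`, which reduces negative exponents to
positive ones. -/
theorem powerFun_neg {s r t : ℝ} (hs : s ∈ Icc (0 : ℝ) 1) (ht : 0 < t) :
    powerFun s (-r) t = (powerFun s r t⁻¹)⁻¹ := by
  unfold powerFun
  by_cases hr : r = 0
  · simp [hr, Real.inv_rpow ht.le]
  · have hb := powerFun_base_pos (r := -r) hs ht
    rw [if_neg hr, if_neg (neg_ne_zero.2 hr), Real.inv_rpow ht.le, ← Real.rpow_neg ht.le,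
      ← Real.rpow_neg hb.le]
    congr 1
    field_simp

/-- For `0 < p ≤ 1` the power function is the deformation of `1 - s + s t` by `t ^ p`: the scalar
equation reads `x ^ (1 - p) (1 - s + s t ^ p) = x`. Negative exponents follow by taking adjoints,
and the exponent `0` is a plain power. -/
theorem isMeanFun_powerFun {s r : ℝ} (hs : s ∈ Icc (0 : ℝ) 1) (hr : r ∈ Icc (-1 : ℝ) 1) :
    IsMeanFun H (powerFun s r) := by
  have key : ∀ p ∈ Ioc (0 : ℝ) 1, IsMeanFun H (powerFun s p) := fun p hp => by
    refine IsMeanFun.deform (isMeanFun_affine hs) (isMeanFun_rpow ⟨hp.1.le, hp.2⟩)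
      (fun a ha b _ hab => Real.rpow_lt_rpow (le_of_lt ha) hab hp.1) (continuousOn_powerFun hs)
      (fun t ht => powerFun_pos hs ht) (powerFun_one s p) fun t ht => ?_
    have hx := powerFun_pos (r := p) hs ht
    have hb := powerFun_base_pos (r := p) hs ht
    have hxp : powerFun s p t ^ p = 1 - s + s * t ^ p := by
      rw [powerFun, if_neg hp.1.ne', ← Real.rpow_mul hb.le, one_div_mul_cancel hp.1.ne',
        Real.rpow_one]
    have hxp0 := Real.rpow_pos_of_pos hx p
    change powerFun s p t * (1 / powerFun s p t) ^ p * (1 - s + s * (powerFun s p t *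
      (t / powerFun s p t) ^ p / (powerFun s p t * (1 / powerFun s p t) ^ p))) = powerFun s p t
    set x := powerFun s p t
    rw [Real.div_rpow one_pos.le hx.le, Real.div_rpow ht.le hx.le, Real.one_rpow]
    field_simp
    linarith
  rcases lt_trichotomy r 0 with h | rfl | h
  · have h' := (key (-r) ⟨by linarith, by linarith [hr.1]⟩).adjoint
    have e : EqOn (powerFun s r) (fun t => (powerFun s (-r) t⁻¹)⁻¹) (Ioi 0) := fun t ht => by
      change _ = (powerFun s (-r) t⁻¹)⁻¹
      rw [← powerFun_neg hs ht, neg_neg]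
    refine ⟨continuousOn_powerFun hs, fun t ht => powerFun_pos hs ht, powerFun_one s r,
      fun A A' B B' hA hB hAA' hBB' => ?_⟩
    rw [perspective_congr e hA hB, perspective_congr e (hA.of_le hAA') (hB.of_le hBB')]
    exact h'.mono A A' B B' hA hB hAA' hBB'
  · have e : powerFun s 0 = fun t => t ^ s := by ext t; simp [powerFun]
    rw [e]; exact isMeanFun_rpow hs
  · exact key r ⟨h, hr.2⟩

theorem strictMonoOn_powerFun {s r : ℝ} (hs : s ∈ Ioc (0 : ℝ) 1) :
    StrictMonoOn (powerFun s r) (Ioi 0) := by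
  have hs' : s ∈ Icc (0 : ℝ) 1 := ⟨hs.1.le, hs.2⟩
  have key : ∀ p : ℝ, 0 ≤ p → StrictMonoOn (powerFun s p) (Ioi 0) := fun p hp a ha b hb hab => by
    unfold powerFun
    rcases hp.eq_or_lt with rfl | hp
    · simpa using Real.rpow_lt_rpow (le_of_lt ha) hab hs.1
    · rw [if_neg hp.ne', if_neg hp.ne']
      refine Real.rpow_lt_rpow (powerFun_base_pos hs' ha).le ?_ (by positivity)
      have := mul_lt_mul_of_pos_left (Real.rpow_lt_rpow (le_of_lt ha) hab hp) hs.1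
      linarith
  rcases le_total 0 r with h | h
  · exact key r h
  · intro a ha b hb hab
    have e : ∀ t ∈ Ioi (0 : ℝ), powerFun s r t = (powerFun s (-r) t⁻¹)⁻¹ := fun t ht => by
      rw [← powerFun_neg hs' ht, neg_neg]
    rw [e a ha, e b hb]
    have ha' : a⁻¹ ∈ Ioi (0 : ℝ) := inv_pos.2 (mem_Ioi.1 ha)
    have hb' : b⁻¹ ∈ Ioi (0 : ℝ) := inv_pos.2 (mem_Ioi.1 hb)
    exact inv_strictAnti₀ (powerFun_pos hs' hb')
      (key (-r) (by linarith) hb' ha' (inv_strictAnti₀ ha hab))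

end

/-! ### Quadratic forms and monotone strong limits -/

section

variable {H : Type*} [NormedAddCommGroup H] [InnerProductSpace ℂ H] [CompleteSpace H]

/-- The real quadratic form of an operator. -/
def quadForm (T : H →L[ℂ] H) (x : H) : ℝ := (inner ℂ (T x) x).re

theorem quadForm_sub (S T : H →L[ℂ] H) (x : H) :
    quadForm (S - T) x = quadForm S x - quadForm T x := by
  simp [quadForm]

theorem quadForm_add (S T : H →L[ℂ] H) (x : H) :
    quadForm (S + T) x = quadForm S x + quadForm T x := by
  simp [quadForm]

theorem quadForm_smul (c : ℝ) (T : H →L[ℂ] H) (x : H) :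
    quadForm (c • T) x = c * quadForm T x := by
  simp [quadForm, inner_smul_left_eq_smul]

theorem quadForm_one (x : H) : quadForm (1 : H →L[ℂ] H) x = ‖x‖ ^ 2 := by
  simpa [quadForm] using inner_self_eq_norm_sq (𝕜 := ℂ) x

theorem quadForm_nonneg {T : H →L[ℂ] H} (hT : 0 ≤ T) (x : H) : 0 ≤ quadForm T x :=
  ((ContinuousLinearMap.nonneg_iff_isPositive T).1 hT).re_inner_nonneg_left x

theorem quadForm_mono {S T : H →L[ℂ] H} (h : S ≤ T) (x : H) : quadForm S x ≤ quadForm T x := by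
  have := quadForm_nonneg (sub_nonneg.2 h) x
  rw [quadForm_sub] at this
  linarith

theorem nonneg_of_quadForm {T : H →L[ℂ] H} (hT : IsSelfAdjoint T) (h : ∀ x, 0 ≤ quadForm T x) :
    0 ≤ T :=
  (ContinuousLinearMap.nonneg_iff_isPositive T).2
    (ContinuousLinearMap.isPositive_def.2
      ⟨ContinuousLinearMap.isSelfAdjoint_iff_isSymmetric.1 hT, h⟩)

theorem le_of_quadForm {S T : H →L[ℂ] H} (hS : IsSelfAdjoint S) (hT : IsSelfAdjoint T)
    (h : ∀ x, quadForm S x ≤ quadForm T x) : S ≤ T :=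
  sub_nonneg.1 (nonneg_of_quadForm (hT.sub hS) fun x => by
    rw [quadForm_sub]; linarith [h x])

/-- Write `D = S S` with `S` the positive square root; then `⟨D x, x⟩ = ‖S x‖²` and `‖S‖² = ‖D‖`.
This upgrades convergence of quadratic forms to strong convergence for bounded families with an
order bound. -/
theorem norm_apply_sq_le {D : H →L[ℂ] H} (hD : 0 ≤ D) (x : H) :
    ‖D x‖ ^ 2 ≤ ‖D‖ * quadForm D x := by
  set S := CFC.sqrt D with hS
  have hSS : S * S = D := CFC.sqrt_mul_sqrt_self D hD
  have hSa : IsSelfAdjoint S := (CFC.sqrt_nonneg D).isSelfAdjoint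
  have hq : quadForm D x = ‖S x‖ ^ 2 := by
    rw [quadForm, ← hSS, mul_apply_eq_comp]
    have := ContinuousLinearMap.isSelfAdjoint_iff_isSymmetric.1 hSa (S x) x
    rw [show inner ℂ (S (S x)) x = inner ℂ (S x) (S x) from this]
    exact inner_self_eq_norm_sq (𝕜 := ℂ) (S x)
  have hn : ‖S‖ ^ 2 = ‖D‖ := by
    rw [hS, CFC.norm_sqrt D hD, Real.sq_sqrt (norm_nonneg D)]
  rw [hq, ← hn, ← mul_pow]
  gcongr
  calc ‖D x‖ = ‖S (S x)‖ := by rw [← hSS]; rfl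
    _ ≤ ‖S‖ * ‖S x‖ := S.le_opNorm _

theorem tendsto_quadForm {ι : Type*} {l : Filter ι} {T : ι → H →L[ℂ] H} {L : H →L[ℂ] H} {x : H}
    (h : Tendsto (fun i => T i x) l (𝓝 (L x))) :
    Tendsto (fun i => quadForm (T i) x) l (𝓝 (quadForm L x)) :=
  (Complex.continuous_re.tendsto _).comp (h.inner tendsto_const_nhds)

theorem nonneg_of_tendsto {ι : Type*} {l : Filter ι} [l.NeBot] {T : ι → H →L[ℂ] H}
    {L : H →L[ℂ] H} (h : ∀ x, Tendsto (fun i => T i x) l (𝓝 (L x))) (h0 : ∀ᶠ i in l, 0 ≤ T i) :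
    0 ≤ L := by
  refine (ContinuousLinearMap.nonneg_iff_isPositive L).2
    (ContinuousLinearMap.isPositive_def.2 ⟨fun x y => ?_, fun x => ?_⟩)
  · refine tendsto_nhds_unique_of_eventuallyEq ((h x).inner tendsto_const_nhds)
      (tendsto_const_nhds.inner (h y)) ?_
    filter_upwards [h0] with i hi
    exact ContinuousLinearMap.isSelfAdjoint_iff_isSymmetric.1 hi.isSelfAdjoint x y
  · refine ge_of_tendsto (tendsto_quadForm (h x)) ?_
    filter_upwards [h0] with i hi
    exact quadForm_nonneg hi x

theorem le_of_tendsto_strong {ι : Type*} {l : Filter ι} [l.NeBot] {S T : ι → H →L[ℂ] H}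
    {K L : H →L[ℂ] H} (hS : ∀ x, Tendsto (fun i => S i x) l (𝓝 (K x)))
    (hT : ∀ x, Tendsto (fun i => T i x) l (𝓝 (L x))) (h : ∀ᶠ i in l, S i ≤ T i) : K ≤ L := by
  refine sub_nonneg.1 (nonneg_of_tendsto (l := l) (T := fun i => T i - S i) (fun x => ?_) ?_)
  · simpa using (hT x).sub (hS x)
  · filter_upwards [h] with i hi
    exact sub_nonneg.2 hi

/-- Weak convergence from above of a bounded family implies strong convergence. -/
theorem tendsto_apply_of_le {ι : Type*} {l : Filter ι} {T : ι → H →L[ℂ] H}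
    {L M : H →L[ℂ] H} (hL : ∀ᶠ i in l, L ≤ T i) (hM : ∀ᶠ i in l, T i ≤ M) {x : H}
    (h : Tendsto (fun i => quadForm (T i) x) l (𝓝 (quadForm L x))) :
    Tendsto (fun i => T i x) l (𝓝 (L x)) := by
  rw [tendsto_iff_norm_sub_tendsto_zero]
  have h0 : Tendsto (fun i => ‖M - L‖ * (quadForm (T i) x - quadForm L x)) l (𝓝 0) := by
    have := (h.sub_const (quadForm L x)).const_mul ‖M - L‖
    simpa using this
  have h1 : Tendsto (fun i => ‖T i x - L x‖ ^ 2) l (𝓝 0) := by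
    refine tendsto_of_tendsto_of_tendsto_of_le_of_le' tendsto_const_nhds h0
      (Eventually.of_forall fun i => by positivity) ?_
    filter_upwards [hL, hM] with i hi hi'
    have hD : 0 ≤ T i - L := sub_nonneg.2 hi
    have hn : ‖T i - L‖ ≤ ‖M - L‖ :=
      CStarAlgebra.norm_le_norm_of_nonneg_of_le hD (sub_le_sub_right hi' L)
    have := norm_apply_sq_le hD x
    rw [quadForm_sub] at this
    refine this.trans (mul_le_mul_of_nonneg_right hn ?_)
    linarith [quadForm_mono hi x]
  have h2 := (Real.continuous_sqrt.tendsto _).comp h1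
  simpa [Function.comp_def, Real.sqrt_sq (norm_nonneg _)] using h2

/-- Vigier's theorem for decreasing sequences of positive operators. -/
theorem exists_strong_limit {T : ℕ → H →L[ℂ] H} (hT : Antitone T) (h0 : ∀ n, 0 ≤ T n) :
    ∃ L : H →L[ℂ] H, 0 ≤ L ∧ (∀ n, L ≤ T n) ∧ ∀ x, Tendsto (fun n => T n x) atTop (𝓝 (L x)) := by
  have hlim : ∀ x, ∃ y, Tendsto (fun n => T n x) atTop (𝓝 y) := fun x => by
    refine cauchySeq_tendsto_of_complete (Metric.cauchySeq_iff'.2 fun ε hε => ?_)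
    have hq : Tendsto (fun n => quadForm (T n) x) atTop (𝓝 (⨅ n, quadForm (T n) x)) :=
      tendsto_atTop_ciInf (fun m n hmn => quadForm_mono (hT hmn) x)
        ⟨0, by rintro _ ⟨n, rfl⟩; exact quadForm_nonneg (h0 n) x⟩
    -- All differences `T N - T n` have norm at most `‖T 0‖`; the added `1` keeps the denominator
    -- positive.
    have hδ : 0 < ε ^ 2 / (‖T 0‖ + 1) := by positivity
    obtain ⟨N, hN⟩ := Metric.cauchySeq_iff'.1 hq.cauchySeq _ hδ
    refine ⟨N, fun n hn => ?_⟩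
    have hD : 0 ≤ T N - T n := sub_nonneg.2 (hT hn)
    have hnorm : ‖T N - T n‖ ≤ ‖T 0‖ := CStarAlgebra.norm_le_norm_of_nonneg_of_le hD
      ((sub_le_self _ (h0 n)).trans (hT (Nat.zero_le N)))
    have h1 := norm_apply_sq_le hD x
    have h2 := hN n hn
    rw [Real.dist_eq, abs_sub_comm] at h2
    have h3 := (le_abs_self _).trans_lt h2
    rw [quadForm_sub] at h1
    have h4 : 0 ≤ quadForm (T N) x - quadForm (T n) x := by
      linarith [quadForm_mono (hT hn) x]
    have h5 : ‖(T N - T n) x‖ ^ 2 < ε ^ 2 := by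
      calc _ ≤ (‖T 0‖ + 1) * (quadForm (T N) x - quadForm (T n) x) :=
            h1.trans (mul_le_mul_of_nonneg_right (by linarith) h4)
        _ < (‖T 0‖ + 1) * (ε ^ 2 / (‖T 0‖ + 1)) := mul_lt_mul_of_pos_left h3 (by positivity)
        _ = ε ^ 2 := by field_simp
    rw [dist_comm, dist_eq_norm]
    exact lt_of_pow_lt_pow_left₀ 2 hε.le h5
  choose y hy using hlim
  let L : H →L[ℂ] H := continuousLinearMapOfTendsto (l := atTop) T (tendsto_pi_nhds.2 hy)
  have hL : ∀ x, Tendsto (fun n => T n x) atTop (𝓝 (L x)) := hy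
  refine ⟨L, nonneg_of_tendsto hL (Eventually.of_forall h0), fun n => ?_, hL⟩
  refine le_of_tendsto_strong hL (fun x => tendsto_const_nhds) ?_
  filter_upwards [eventually_ge_atTop n] with m hm
  exact hT hm

/-- The limit is produced along `ε = 1 / (n + 1)`; monotonicity squeezes every other small `ε`
between the limit and a member of this sequence. -/
theorem exists_strong_limit_of_monotoneOn {T : ℝ → H →L[ℂ] H} (hT : MonotoneOn T (Ioi 0))
    (h0 : ∀ ε, 0 < ε → 0 ≤ T ε) :
    ∃ L : H →L[ℂ] H, ∀ x, Tendsto (fun ε => T ε x) (𝓝[>] 0) (𝓝 (L x)) := by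
  have hp : ∀ n : ℕ, (0 : ℝ) < 1 / ((n : ℝ) + 1) := fun n => Nat.one_div_pos_of_nat
  obtain ⟨L, -, hLn, hL⟩ := exists_strong_limit (T := fun n : ℕ => T (1 / ((n : ℝ) + 1)))
    (fun m n hmn => hT (hp n) (hp m) (Nat.one_div_le_one_div hmn)) fun n => h0 _ (hp n)
  refine ⟨L, fun x => ?_⟩
  have hev : ∀ a > (0 : ℝ), ∀ᶠ ε in 𝓝[>] (0 : ℝ), 0 < ε ∧ ε < a := fun a ha =>
    Ioo_mem_nhdsGT ha
  have hLe : ∀ ε > 0, L ≤ T ε := fun ε hε => by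
    obtain ⟨n, hn⟩ := exists_nat_one_div_lt hε
    exact (hLn n).trans (hT (hp n) hε hn.le)
  refine tendsto_apply_of_le (M := T 1) ?_ ?_ ?_
  · filter_upwards [hev 1 one_pos] with ε hε using hLe ε hε.1
  · filter_upwards [hev 1 one_pos] with ε hε using hT (mem_Ioi.2 hε.1) (mem_Ioi.2 one_pos) hε.2.le
  · refine tendsto_order.2 ⟨fun a ha => ?_, fun a ha => ?_⟩
    · filter_upwards [hev 1 one_pos] with ε hε
      exact ha.trans_le (quadForm_mono (hLe ε hε.1) x)
    · obtain ⟨n, hn⟩ := ((tendsto_order.1 (tendsto_quadForm (hL x))).2 a ha).exists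
      filter_upwards [hev _ (hp n)] with ε hε
      exact (quadForm_mono (hT hε.1 (hp n) hε.2.le) x).trans_lt hn

theorem smul_one_mono {a b : ℝ} (h : a ≤ b) : a • (1 : H →L[ℂ] H) ≤ b • 1 :=
  smul_le_smul_of_nonneg_right h zero_le_one

theorem isStrictlyPositive_add_smul {A : H →L[ℂ] H} (hA : 0 ≤ A) {ε : ℝ} (hε : 0 < ε) :
    IsStrictlyPositive (A + ε • 1) :=
  IsStrictlyPositive.nonneg_add hA (IsStrictlyPositive.smul hε isStrictlyPositive_one)

end

/-! ### Extension of perspectives to positive operators -/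

section

variable {H : Type*} [NormedAddCommGroup H] [InnerProductSpace ℂ H] [CompleteSpace H]

theorem IsMeanFun.perspective_add_mono {f : ℝ → ℝ} (hf : IsMeanFun H f) {A B : H →L[ℂ] H}
    (hA : 0 ≤ A) (hB : 0 ≤ B) :
    MonotoneOn (fun ε : ℝ => perspective f (A + ε • 1) (B + ε • 1)) (Ioi 0) :=
  fun _ hε _ _ h => hf.mono _ _ _ _ (isStrictlyPositive_add_smul hA hε)
    (isStrictlyPositive_add_smul hB hε) (add_le_add_right (smul_one_mono h) A)
    (add_le_add_right (smul_one_mono h) B)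

theorem IsMeanFun.perspective_add_nonneg {f : ℝ → ℝ} (hf : IsMeanFun H f) {A B : H →L[ℂ] H}
    (hA : 0 ≤ A) (hB : 0 ≤ B) {ε : ℝ} (hε : 0 < ε) :
    0 ≤ perspective f (A + ε • 1) (B + ε • 1) :=
  (isStrictlyPositive_perspective hf.continuousOn hf.pos (isStrictlyPositive_add_smul hA hε)
    (isStrictlyPositive_add_smul hB hε)).nonneg

theorem eventually_pos : ∀ᶠ ε in 𝓝[>] (0 : ℝ), 0 < ε := self_mem_nhdsWithin

theorem extend_of_isStrictlyPositive {m : (H →L[ℂ] H) → (H →L[ℂ] H) → (H →L[ℂ] H)}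
    {A B : H →L[ℂ] H} (hA : IsStrictlyPositive A) (hB : IsStrictlyPositive B) :
    extend m A B = m A B := by
  rw [extend, if_pos ⟨hA, hB⟩]

/-- The regularizations `A + ε I`, `B + ε I` are invertible, so the values on invertible pairs
determine the extension on all positive pairs. -/
theorem extend_congr {m m' : (H →L[ℂ] H) → (H →L[ℂ] H) → (H →L[ℂ] H)}
    (h : ∀ A B, IsStrictlyPositive A → IsStrictlyPositive B → m A B = m' A B)
    {A B : H →L[ℂ] H} (hA : 0 ≤ A) (hB : 0 ≤ B) : extend m A B = extend m' A B := by
  by_cases hAB : IsStrictlyPositive A ∧ IsStrictlyPositive B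
  · rw [extend_of_isStrictlyPositive hAB.1 hAB.2, extend_of_isStrictlyPositive hAB.1 hAB.2,
      h A B hAB.1 hAB.2]
  · rw [extend, extend, if_neg hAB, if_neg hAB]
    congr 1
    ext L
    refine forall_congr' fun ξ => tendsto_congr' ?_
    filter_upwards [eventually_pos] with ε hε
    rw [h _ _ (isStrictlyPositive_add_smul hA hε) (isStrictlyPositive_add_smul hB hε)]

theorem exists_one_le_smul {A : H →L[ℂ] H} (hA : IsStrictlyPositive A) :
    ∃ c : ℝ, 0 < c ∧ 1 ≤ c • A :=
  let ⟨c, hc, h⟩ := exists_le_smul (X := (1 : H →L[ℂ] H)) (IsSelfAdjoint.one _) hA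
  ⟨c, one_pos.trans_le hc, h⟩

/-- On invertible pairs the extension is defined by the value itself, which has to be matched with
the limit. If `I ≤ c A` and `I ≤ c B`, then the regularized value lies between the value and `1 + c
ε` times it. On other pairs the limit exists by monotonicity in `ε`. -/
theorem IsMeanFun.tendsto_extend {f : ℝ → ℝ} (hf : IsMeanFun H f) {A B : H →L[ℂ] H}
    (hA : 0 ≤ A) (hB : 0 ≤ B) (x : H) :
    Tendsto (fun ε : ℝ => perspective f (A + ε • 1) (B + ε • 1) x) (𝓝[>] 0)
      (𝓝 (extend (perspective f) A B x)) := by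
  by_cases h : IsStrictlyPositive A ∧ IsStrictlyPositive B
  · rw [extend_of_isStrictlyPositive h.1 h.2]
    obtain ⟨a, ha, hAa⟩ := exists_one_le_smul h.1
    obtain ⟨b, hb, hBb⟩ := exists_one_le_smul h.2
    set c := max a b
    have hc : 0 < c := ha.trans_le (le_max_left _ _)
    have hAc : (1 : H →L[ℂ] H) ≤ c • A :=
      hAa.trans (smul_le_smul_of_nonneg_right (le_max_left _ _) hA)
    have hBc : (1 : H →L[ℂ] H) ≤ c • B :=
      hBb.trans (smul_le_smul_of_nonneg_right (le_max_right _ _) hB)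
    have up : ∀ {X : H →L[ℂ] H} {ε : ℝ}, 0 < ε → 1 ≤ c • X → X + ε • 1 ≤ (1 + c * ε) • X :=
      fun {X ε} hε hX => by
        rw [add_smul, one_smul, mul_comm, mul_smul]
        exact add_le_add_right (smul_le_smul_of_nonneg_left hX hε.le) X
    have hle : ∀ ε : ℝ, 0 < ε →
        perspective f (A + ε • 1) (B + ε • 1) ≤ (1 + c * ε) • perspective f A B := fun ε hε => by
      rw [← perspective_smul hf.continuousOn h.1 h.2 (by positivity)]
      exact hf.mono _ _ _ _ (isStrictlyPositive_add_smul hA hε)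
        (isStrictlyPositive_add_smul hB hε) (up hε hAc) (up hε hBc)
    have hge : ∀ ε : ℝ, 0 < ε →
        perspective f A B ≤ perspective f (A + ε • 1) (B + ε • 1) := fun ε hε =>
      hf.mono _ _ _ _ h.1 h.2 (le_add_of_nonneg_right (smul_nonneg hε.le zero_le_one))
        (le_add_of_nonneg_right (smul_nonneg hε.le zero_le_one))
    refine tendsto_apply_of_le (M := perspective f (A + (1 : ℝ) • 1) (B + (1 : ℝ) • 1)) ?_ ?_ ?_
    · filter_upwards [eventually_pos] with ε hε using hge ε hε
    · filter_upwards [Ioo_mem_nhdsGT one_pos] with ε hε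
      exact hf.perspective_add_mono hA hB hε.1 (mem_Ioi.2 one_pos) hε.2.le
    · have hlim : Tendsto (fun ε : ℝ => (1 + c * ε) * quadForm (perspective f A B) x) (𝓝[>] 0)
          (𝓝 (quadForm (perspective f A B) x)) := by
        have : Tendsto (fun ε : ℝ => (1 + c * ε) * quadForm (perspective f A B) x) (𝓝 0)
            (𝓝 ((1 + c * 0) * quadForm (perspective f A B) x)) :=
          Continuous.tendsto (by fun_prop) 0
        rw [mul_zero, add_zero, one_mul] at this
        exact this.mono_left nhdsWithin_le_nhds
      refine tendsto_of_tendsto_of_tendsto_of_le_of_le' tendsto_const_nhds hlim ?_ ?_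
      · filter_upwards [eventually_pos] with ε hε using quadForm_mono (hge ε hε) x
      · filter_upwards [eventually_pos] with ε hε
        rw [← quadForm_smul]
        exact quadForm_mono (hle ε hε) x
  · rw [extend, if_neg h]
    exact Classical.epsilon_spec (exists_strong_limit_of_monotoneOn
      (hf.perspective_add_mono hA hB) fun ε hε => hf.perspective_add_nonneg hA hB hε) x

theorem IsMeanFun.extend_nonneg {f : ℝ → ℝ} (hf : IsMeanFun H f) {A B : H →L[ℂ] H}
    (hA : 0 ≤ A) (hB : 0 ≤ B) : 0 ≤ extend (perspective f) A B :=
  nonneg_of_tendsto (hf.tendsto_extend hA hB)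
    (eventually_pos.mono fun _ hε => hf.perspective_add_nonneg hA hB hε)

theorem IsMeanFun.extend_le {f : ℝ → ℝ} (hf : IsMeanFun H f) {A B : H →L[ℂ] H}
    (hA : 0 ≤ A) (hB : 0 ≤ B) {ε : ℝ} (hε : 0 < ε) :
    extend (perspective f) A B ≤ perspective f (A + ε • 1) (B + ε • 1) := by
  refine le_of_tendsto_strong (hf.tendsto_extend hA hB) (fun x => tendsto_const_nhds) ?_
  filter_upwards [Ioo_mem_nhdsGT hε] with δ hδ
  exact hf.perspective_add_mono hA hB hδ.1 hε hδ.2.le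

theorem IsMeanFun.extend_mono {f : ℝ → ℝ} (hf : IsMeanFun H f) {A A' B B' : H →L[ℂ] H}
    (hA : 0 ≤ A) (hB : 0 ≤ B) (hAA' : A ≤ A') (hBB' : B ≤ B') :
    extend (perspective f) A B ≤ extend (perspective f) A' B' := by
  refine le_of_tendsto_strong (hf.tendsto_extend hA hB)
    (hf.tendsto_extend (hA.trans hAA') (hB.trans hBB')) ?_
  filter_upwards [eventually_pos] with ε hε
  exact hf.mono _ _ _ _ (isStrictlyPositive_add_smul hA hε) (isStrictlyPositive_add_smul hB hε)
    (add_le_add_left hAA' _) (add_le_add_left hBB' _)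

theorem eventually_le_add_smul {F : ℝ → H →L[ℂ] H} (hF : Continuous F)
    (hsa : ∀ δ, IsSelfAdjoint (F δ)) {η : ℝ} (hη : 0 < η) :
    ∀ᶠ δ in 𝓝[>] (0 : ℝ), F δ ≤ F 0 + η • 1 := by
  have : ∀ᶠ δ in 𝓝 (0 : ℝ), ‖F δ - F 0‖ < η := by
    have h : Tendsto (fun δ => ‖F δ - F 0‖) (𝓝 0) (𝓝 ‖F 0 - F 0‖) :=
      Continuous.tendsto (by fun_prop) 0
    rw [sub_self, norm_zero] at h
    exact (tendsto_order.1 h).2 η hη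
  filter_upwards [nhdsWithin_le_nhds this] with δ hδ
  have h := ((hsa δ).sub (hsa 0)).le_algebraMap_norm_self
  rw [Algebra.algebraMap_eq_smul_one] at h
  have := h.trans (smul_one_mono hδ.le)
  rwa [sub_le_iff_le_add'] at this

theorem continuous_add_smul_one (C : H →L[ℂ] H) : Continuous fun δ : ℝ => C + δ • (1 : H →L[ℂ] H) :=
  continuous_const.add (continuous_id.smul continuous_const)

theorem eventually_conj_le_add_smul {C X : H →L[ℂ] H} (hC : 0 ≤ C) (hX : 0 ≤ X) {η : ℝ}
    (hη : 0 < η) : ∀ᶠ δ in 𝓝[>] (0 : ℝ),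
      (C + δ • 1) * (X + δ • 1) * (C + δ • 1) ≤ C * X * C + η • 1 := by
  have hs1 : ∀ Y : H →L[ℂ] H, 0 ≤ Y → ∀ δ : ℝ, IsSelfAdjoint (Y + δ • (1 : H →L[ℂ] H)) :=
    fun Y hY δ => hY.isSelfAdjoint.add ((IsSelfAdjoint.all δ).smul (IsSelfAdjoint.one _))
  have := eventually_le_add_smul (F := fun δ : ℝ => (C + δ • 1) * (X + δ • 1) * (C + δ • 1))
    (((continuous_add_smul_one C).mul (continuous_add_smul_one X)).mul (continuous_add_smul_one C))
    (fun δ => isSelfAdjoint_conj (hs1 C hC δ) (hs1 X hX δ)) hη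
  simpa only [zero_smul, add_zero] using this

theorem tendsto_conj_add_smul (C X : H →L[ℂ] H) :
    Tendsto (fun δ : ℝ => (C + δ • 1) * X * (C + δ • 1)) (𝓝[>] 0) (𝓝 (C * X * C)) := by
  have h : Continuous fun δ : ℝ => (C + δ • 1) * X * (C + δ • 1) :=
    ((continuous_add_smul_one C).mul continuous_const).mul (continuous_add_smul_one C)
  have := (h.tendsto 0).mono_left (nhdsWithin_le_nhds (s := Ioi 0))
  simpa only [zero_smul, add_zero] using this

/-- For invertible `C` this would be congruence invariance. In general `C` is replaced by `C + δ I`,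
and by norm continuity the error in the conjugated arguments is absorbed by `η I` for small `δ`;
then `δ → 0` and `η → 0`. -/
theorem IsMeanFun.extend_transformer {f : ℝ → ℝ} (hf : IsMeanFun H f) {A B C : H →L[ℂ] H}
    (hA : 0 ≤ A) (hB : 0 ≤ B) (hC : 0 ≤ C) :
    C * extend (perspective f) A B * C ≤ extend (perspective f) (C * A * C) (C * B * C) := by
  have hCs := hC.isSelfAdjoint
  refine le_of_tendsto_strong (l := 𝓝[>] (0 : ℝ)) (fun x => tendsto_const_nhds)
    (hf.tendsto_extend (conj_nonneg hCs hA) (conj_nonneg hCs hB)) ?_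
  filter_upwards [eventually_pos] with η hη
  refine le_of_tendsto (tendsto_conj_add_smul C (extend (perspective f) A B)) ?_
  filter_upwards [eventually_pos, eventually_conj_le_add_smul hC hA hη,
    eventually_conj_le_add_smul hC hB hη] with δ hδ h1 h2
  have spA := isStrictlyPositive_add_smul hA hδ
  have spB := isStrictlyPositive_add_smul hB hδ
  have spC := isStrictlyPositive_add_smul hC hδ
  have h3 := conj_le_conj spC.isSelfAdjoint (hf.extend_le hA hB hδ)
  rw [← perspective_conj hf.continuousOn spA spB spC] at h3
  exact h3.trans (hf.mono _ _ _ _ (isStrictlyPositive_conj spC spA)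
    (isStrictlyPositive_conj spC spB) h1 h2)

theorem tendsto_apply_of_bounded {S : ℕ → H →L[ℂ] H} {S₀ : H →L[ℂ] H} {M : ℝ}
    (hM : ∀ k, ‖S k‖ ≤ M) (hS : ∀ x, Tendsto (fun k => S k x) atTop (𝓝 (S₀ x)))
    {y : ℕ → H} {y₀ : H} (hy : Tendsto y atTop (𝓝 y₀)) :
    Tendsto (fun k => S k (y k)) atTop (𝓝 (S₀ y₀)) := by
  have h1 : Tendsto (fun k => S k (y k - y₀)) atTop (𝓝 0) := by
    refine squeeze_zero_norm (a := fun k => M * ‖y k - y₀‖) (fun k => ?_) ?_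
    · exact ((S k).le_opNorm _).trans (mul_le_mul_of_nonneg_right (hM k) (norm_nonneg _))
    · simpa using (tendsto_iff_norm_sub_tendsto_zero.1 hy).const_mul M
  simpa using h1.add (hS y₀)

theorem norm_le_of_spectrum {X : H →L[ℂ] H} {f : ℝ → ℝ} {c : ℝ}
    (hc : 0 ≤ c) (h : ∀ t ∈ spectrum ℝ X, |f t| ≤ c) : ‖cfc f X‖ ≤ c :=
  norm_cfc_le hc h

/-- The continuous functional calculus is strongly continuous on sets of self-adjoint operators
with spectrum in a compact interval. -/
theorem tendsto_cfc_apply {X : ℕ → H →L[ℂ] H} {X₀ : H →L[ℂ] H} {a b : ℝ} {f : ℝ → ℝ}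
    (hf : ContinuousOn f (Icc a b)) (hX : ∀ k, IsSelfAdjoint (X k)) (hX₀ : IsSelfAdjoint X₀)
    (hs : ∀ k, spectrum ℝ (X k) ⊆ Icc a b) (hs₀ : spectrum ℝ X₀ ⊆ Icc a b)
    (h : ∀ x, Tendsto (fun k => X k x) atTop (𝓝 (X₀ x))) (x : H) :
    Tendsto (fun k => cfc f (X k) x) atTop (𝓝 (cfc f X₀ x)) := by
  have hbd : ∀ k, ‖X k‖ ≤ max |a| |b| := fun k => by
    have := norm_le_of_spectrum (X := X k) (f := fun t => t) (c := max |a| |b|) (by positivity)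
      fun t ht => abs_le_max_abs_abs (hs k ht).1 (hs k ht).2
    rwa [cfc_id' ℝ (X k) (hX k)] at this
  have hpow : ∀ (n : ℕ) (x : H), Tendsto (fun k => (X k ^ n) x) atTop (𝓝 ((X₀ ^ n) x)) := by
    intro n
    induction n with
    | zero => intro x; simp
    | succ n ih =>
      intro x
      simp only [pow_succ', mul_apply_eq_comp]
      exact tendsto_apply_of_bounded hbd h (ih x)
  have hpoly : ∀ (p : Polynomial ℝ) (x : H), Tendsto (fun k => Polynomial.aeval (X k) p x) atTop
      (𝓝 (Polynomial.aeval X₀ p x)) := by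
    intro p x
    induction p using Polynomial.induction_on' with
    | add p q hp hq => simpa using hp.add hq
    | monomial n c =>
      simp only [Polynomial.aeval_monomial, Algebra.algebraMap_eq_smul_one, smul_mul_assoc, one_mul]
      exact (hpow n x).const_smul c
  rw [Metric.tendsto_atTop]
  intro ε hε
  -- The polynomial error, multiplied by `‖x‖`, is to stay below `ε / 3` also when `x = 0`.
  set δ := ε / (3 * (‖x‖ + 1)) with hδ
  have hδ0 : 0 < δ := by positivity
  obtain ⟨p, hp⟩ := exists_polynomial_near_of_continuousOn a b f hf δ hδ0
  have hnear : ∀ Y : H →L[ℂ] H, IsSelfAdjoint Y → spectrum ℝ Y ⊆ Icc a b →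
      ‖Polynomial.aeval Y p x - cfc f Y x‖ < ε / 3 := fun Y hY hYs => by
    have e : Polynomial.aeval Y p - cfc f Y = cfc (fun t => p.eval t - f t) Y := by
      rw [cfc_sub (fun t => p.eval t) f Y (by fun_prop) (hf.mono hYs), cfc_polynomial p Y hY]
    have h1 : ‖Polynomial.aeval Y p - cfc f Y‖ ≤ δ := by
      rw [e]
      exact norm_le_of_spectrum hδ0.le fun t ht => (hp t (hYs ht)).le
    calc ‖Polynomial.aeval Y p x - cfc f Y x‖ = ‖(Polynomial.aeval Y p - cfc f Y) x‖ := rfl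
      _ ≤ δ * ‖x‖ := (ContinuousLinearMap.le_opNorm _ x).trans
          (mul_le_mul_of_nonneg_right h1 (norm_nonneg x))
      _ < δ * (‖x‖ + 1) := mul_lt_mul_of_pos_left (by linarith) hδ0
      _ = ε / 3 := by rw [hδ]; field_simp
  obtain ⟨N, hN⟩ := Metric.tendsto_atTop.1 (hpoly p x) (ε / 3) (by positivity)
  refine ⟨N, fun k hk => ?_⟩
  have h1 := hnear (X k) (hX k) (hs k)
  have h2 := hnear X₀ hX₀ hs₀
  have h3 := hN k hk
  rw [dist_eq_norm] at h3 ⊢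
  have e : cfc f (X k) x - cfc f X₀ x =
      -(Polynomial.aeval (X k) p x - cfc f (X k) x) +
      (Polynomial.aeval (X k) p x - Polynomial.aeval X₀ p x) +
      (Polynomial.aeval X₀ p x - cfc f X₀ x) := by abel
  rw [e]
  calc _ ≤ ‖-(Polynomial.aeval (X k) p x - cfc f (X k) x)‖ +
        ‖Polynomial.aeval (X k) p x - Polynomial.aeval X₀ p x‖ +
        ‖Polynomial.aeval X₀ p x - cfc f X₀ x‖ := norm_add₃_le
    _ < ε / 3 + ε / 3 + ε / 3 := by rw [norm_neg]; gcongr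
    _ = ε := by ring

theorem spectrum_subset_Icc {X : H →L[ℂ] H} (hX : IsSelfAdjoint X) {a b : ℝ}
    (ha : a • (1 : H →L[ℂ] H) ≤ X) (hb : X ≤ b • 1) : spectrum ℝ X ⊆ Icc a b := fun t ht => by
  rw [← Algebra.algebraMap_eq_smul_one] at ha hb
  exact ⟨(algebraMap_le_iff_le_spectrum hX).1 ha t ht, (le_algebraMap_iff_spectrum_le hX).1 hb t ht⟩

theorem isStrictlyPositive_of_smul_one_le {X : H →L[ℂ] H} {a : ℝ} (ha : 0 < a)
    (h : a • (1 : H →L[ℂ] H) ≤ X) : IsStrictlyPositive X :=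
  (IsStrictlyPositive.smul ha isStrictlyPositive_one).of_le h

/-- Perspectives are jointly strongly continuous on order intervals `[a, b]`, `0 < a`. -/
theorem tendsto_perspective_apply {f : ℝ → ℝ} (hf : ContinuousOn f (Ioi 0)) {a b : ℝ} (ha : 0 < a)
    (hb : 0 < b) {A B : ℕ → H →L[ℂ] H} {A₀ B₀ : H →L[ℂ] H}
    (hA : ∀ k, a • 1 ≤ A k ∧ A k ≤ b • 1) (hB : ∀ k, a • 1 ≤ B k ∧ B k ≤ b • 1)
    (hA₀ : a • 1 ≤ A₀ ∧ A₀ ≤ b • 1) (hB₀ : a • 1 ≤ B₀ ∧ B₀ ≤ b • 1)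
    (hAl : ∀ x, Tendsto (fun k => A k x) atTop (𝓝 (A₀ x)))
    (hBl : ∀ x, Tendsto (fun k => B k x) atTop (𝓝 (B₀ x))) (x : H) :
    Tendsto (fun k => perspective f (A k) (B k) x) atTop (𝓝 (perspective f A₀ B₀ x)) := by
  have sp : ∀ {X : H →L[ℂ] H}, a • 1 ≤ X ∧ X ≤ b • 1 → IsStrictlyPositive X := fun h =>
    isStrictlyPositive_of_smul_one_le ha h.1
  have spec : ∀ {X : H →L[ℂ] H}, a • 1 ≤ X ∧ X ≤ b • 1 → spectrum ℝ X ⊆ Icc a b := fun h =>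
    spectrum_subset_Icc (sp h).isSelfAdjoint h.1 h.2
  have hpc : ∀ p : ℝ, ContinuousOn (fun t : ℝ => t ^ p) (Icc a b) := fun p t ht =>
    (Real.continuousAt_rpow_const t p (.inl (ha.trans_le ht.1).ne')).continuousWithinAt
  have hpow : ∀ (p : ℝ) (x : H), Tendsto (fun k => (A k ^ p) x) atTop (𝓝 ((A₀ ^ p) x)) :=
    fun p x => by
      have := tendsto_cfc_apply (hpc p) (fun k => (sp (hA k)).isSelfAdjoint) (sp hA₀).isSelfAdjoint
        (fun k => spec (hA k)) (spec hA₀) hAl x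
      simpa only [cfc_rpow (sp (hA _)), cfc_rpow (sp hA₀)] using this
  have hbdp : ∀ p : ℝ, ∃ M, ∀ k, ‖A k ^ p‖ ≤ M := fun p => by
    obtain ⟨M, hM⟩ := isCompact_Icc.exists_bound_of_continuousOn (hpc p)
    refine ⟨max M 0, fun k => ?_⟩
    rw [← cfc_rpow (sp (hA k))]
    exact norm_le_of_spectrum (le_max_right _ _)
      fun t ht => (hM t (spec (hA k) ht)).trans (le_max_left _ _)
  have bd : ∀ {X : H →L[ℂ] H}, a • 1 ≤ X ∧ X ≤ b • 1 → ‖X‖ ≤ b := fun {X} h => by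
    rw [CStarAlgebra.norm_le_iff_le_algebraMap X hb.le (sp h).nonneg,
      Algebra.algebraMap_eq_smul_one]
    exact h.2
  -- The bounds on `X` and `Y` confine the normalized quotient to `[a / b, b / a]`, one compact
  -- subset of `(0, ∞)` for all indices, on which `f` is bounded and continuous.
  have quot : ∀ {X Y : H →L[ℂ] H}, a • 1 ≤ X ∧ X ≤ b • 1 → a • 1 ≤ Y ∧ Y ≤ b • 1 →
      IsSelfAdjoint (X ^ (-(1 / 2) : ℝ) * Y * X ^ (-(1 / 2) : ℝ)) ∧
      spectrum ℝ (X ^ (-(1 / 2) : ℝ) * Y * X ^ (-(1 / 2) : ℝ)) ⊆ Icc (a / b) (b / a) :=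
    fun {X Y} hX hY => by
      have hs := ((sp hX).rpow (y := -(1 / 2))).isSelfAdjoint
      have e : X ^ (-(1 / 2) : ℝ) * X * X ^ (-(1 / 2) : ℝ) = 1 :=
        CFC.conjugate_rpow_neg_one_half X (sp hX)
      have hsm : ∀ c : ℝ, X ^ (-(1 / 2) : ℝ) * (c • X) * X ^ (-(1 / 2) : ℝ) = c • 1 := fun c => by
        rw [mul_smul_comm, smul_mul_assoc, e]
      have hsa := isSelfAdjoint_conj hs (sp hY).isSelfAdjoint
      refine ⟨hsa, spectrum_subset_Icc hsa ?_ ?_⟩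
      · rw [← hsm]
        refine conj_le_conj hs (le_trans ?_ hY.1)
        calc (a / b) • X ≤ (a / b) • b • (1 : H →L[ℂ] H) :=
              smul_le_smul_of_nonneg_left hX.2 (by positivity)
          _ = a • 1 := by rw [smul_smul, div_mul_cancel₀ _ hb.ne']
      · rw [← hsm]
        refine conj_le_conj hs (hY.2.trans ?_)
        calc b • (1 : H →L[ℂ] H) = (b / a) • a • 1 := by rw [smul_smul, div_mul_cancel₀ _ ha.ne']
          _ ≤ _ := smul_le_smul_of_nonneg_left hX.1 (by positivity)
  obtain ⟨M₁, hM₁⟩ := hbdp (1 / 2)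
  obtain ⟨M₂, hM₂⟩ := hbdp (-(1 / 2))
  have hC : ∀ x, Tendsto (fun k => (A k ^ (-(1 / 2) : ℝ) * B k * A k ^ (-(1 / 2) : ℝ)) x) atTop
      (𝓝 ((A₀ ^ (-(1 / 2) : ℝ) * B₀ * A₀ ^ (-(1 / 2) : ℝ)) x)) := fun x =>
    tendsto_apply_of_bounded hM₂ (hpow _) (tendsto_apply_of_bounded (fun k => bd (hB k)) hBl
      (hpow _ x))
  have hfc : ContinuousOn f (Icc (a / b) (b / a)) :=
    hf.mono fun t ht => (div_pos ha hb).trans_le ht.1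
  obtain ⟨M₃, hM₃⟩ := isCompact_Icc.exists_bound_of_continuousOn hfc
  have hcf := tendsto_cfc_apply hfc (fun k => (quot (hA k) (hB k)).1) (quot hA₀ hB₀).1
    (fun k => (quot (hA k) (hB k)).2) (quot hA₀ hB₀).2 hC
  refine tendsto_apply_of_bounded hM₁ (hpow _) (tendsto_apply_of_bounded (M := max M₃ 0)
    (fun k => ?_) hcf (hpow _ x))
  exact norm_le_of_spectrum (le_max_right _ _)
    fun t ht => (hM₃ t ((quot (hA k) (hB k)).2 ht)).trans (le_max_left _ _)

theorem DecreasesTo.le {A : ℕ → H →L[ℂ] H} {A₀ : H →L[ℂ] H} (h : DecreasesTo A A₀) (k : ℕ) :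
    A₀ ≤ A k :=
  le_of_tendsto_strong h.2 (fun _ => tendsto_const_nhds)
    ((eventually_ge_atTop k).mono fun _ hm => h.1 hm)

/-- Monotonicity gives everything but the upper estimate for the limit. That comes from a fixed
regularization: it majorizes the extension, and after adding `ε I` all operators lie in an interval
`[ε, b]` where perspectives are strongly continuous. -/
theorem IsMeanFun.extend_downward {f : ℝ → ℝ} (hf : IsMeanFun H f) {A B : ℕ → H →L[ℂ] H}
    {A₀ B₀ : H →L[ℂ] H} (hA : ∀ k, 0 ≤ A k) (hB : ∀ k, 0 ≤ B k) (hA₀ : 0 ≤ A₀) (hB₀ : 0 ≤ B₀)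
    (hAl : DecreasesTo A A₀) (hBl : DecreasesTo B B₀) :
    DecreasesTo (fun k => extend (perspective f) (A k) (B k)) (extend (perspective f) A₀ B₀) := by
  have hanti : Antitone fun k => extend (perspective f) (A k) (B k) := fun m n hmn =>
    hf.extend_mono (hA n) (hB n) (hAl.1 hmn) (hBl.1 hmn)
  have hge : ∀ k, extend (perspective f) A₀ B₀ ≤ extend (perspective f) (A k) (B k) := fun k =>
    hf.extend_mono hA₀ hB₀ (hAl.le k) (hBl.le k)
  refine ⟨hanti, fun x => tendsto_apply_of_le (M := extend (perspective f) (A 0) (B 0))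
    (Eventually.of_forall hge) (Eventually.of_forall fun k => hanti (Nat.zero_le k)) ?_⟩
  refine tendsto_order.2 ⟨fun c hc => Eventually.of_forall fun k =>
    hc.trans_le (quadForm_mono (hge k) x), fun c hc => ?_⟩
  -- This `ε` is fixed before `k → ∞`: the regularized value at the limit pair is already below `c`.
  obtain ⟨ε, hε, hε'⟩ := (((tendsto_order.1 (tendsto_quadForm (hf.tendsto_extend hA₀ hB₀ x))).2
    c hc).and eventually_pos).exists
  set b := ‖A 0 + ε • (1 : H →L[ℂ] H)‖ + ‖B 0 + ε • (1 : H →L[ℂ] H)‖ + 1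
  have hle1 : ∀ X : H →L[ℂ] H, 0 ≤ X → ε • 1 ≤ X + ε • 1 := fun X hX => le_add_of_nonneg_left hX
  have hle2 : ∀ X Y : H →L[ℂ] H, 0 ≤ X → X ≤ Y → ‖Y + ε • (1 : H →L[ℂ] H)‖ ≤ b →
      X + ε • 1 ≤ b • 1 := fun X Y hX hXY hY => by
    have h1 := (isStrictlyPositive_add_smul (hX.trans hXY) hε').isSelfAdjoint.le_algebraMap_norm_self
    rw [Algebra.algebraMap_eq_smul_one] at h1
    exact ((add_le_add_left hXY _).trans h1).trans (smul_one_mono hY)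
  have hbA : ‖A 0 + ε • (1 : H →L[ℂ] H)‖ ≤ b := by
    have := norm_nonneg (B 0 + ε • (1 : H →L[ℂ] H)); simp only [b]; linarith
  have hbB : ‖B 0 + ε • (1 : H →L[ℂ] H)‖ ≤ b := by
    have := norm_nonneg (A 0 + ε • (1 : H →L[ℂ] H)); simp only [b]; linarith
  have hlim := tendsto_perspective_apply hf.continuousOn hε' (b := b) (by positivity)
    (A := fun k => A k + ε • 1) (B := fun k => B k + ε • 1) (A₀ := A₀ + ε • 1) (B₀ := B₀ + ε • 1)
    (fun k => ⟨hle1 _ (hA k), hle2 _ _ (hA k) (hAl.1 (Nat.zero_le k)) hbA⟩)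
    (fun k => ⟨hle1 _ (hB k), hle2 _ _ (hB k) (hBl.1 (Nat.zero_le k)) hbB⟩)
    ⟨hle1 _ hA₀, hle2 _ _ hA₀ (hAl.le 0) hbA⟩ ⟨hle1 _ hB₀, hle2 _ _ hB₀ (hBl.le 0) hbB⟩
    (fun x => (hAl.2 x).add_const _) (fun x => (hBl.2 x).add_const _) x
  filter_upwards [(tendsto_order.1 (tendsto_quadForm hlim)).2 c hε] with k hk
  exact (quadForm_mono (hf.extend_le (hA k) (hB k) hε') x).trans_lt hk

theorem IsMeanFun.isOperatorMean {f : ℝ → ℝ} (hf : IsMeanFun H f) :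
    IsOperatorMean (extend (perspective f) : (H →L[ℂ] H) → (H →L[ℂ] H) → (H →L[ℂ] H)) where
  nonneg := fun _ _ hA hB => hf.extend_nonneg hA hB
  mono := fun _ _ _ _ hA hB hAA' hBB' => hf.extend_mono hA hB hAA' hBB'
  transformer := fun _ _ _ hA hB hC => hf.extend_transformer hA hB hC
  downward := fun _ _ _ _ hA hB hA₀ hB₀ hAl hBl => hf.extend_downward hA hB hA₀ hB₀ hAl hBl
  normalized := by
    rw [extend_of_isStrictlyPositive isStrictlyPositive_one isStrictlyPositive_one]
    simpa [hf.map_one] using perspective_one_smul (H := H) (f := f) 1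

theorem IsOperatorMean.congr {σ σ' : (H →L[ℂ] H) → (H →L[ℂ] H) → (H →L[ℂ] H)}
    (hσ : IsOperatorMean σ) (h : ∀ A B, 0 ≤ A → 0 ≤ B → σ' A B = σ A B) : IsOperatorMean σ' where
  nonneg := fun A B hA hB => by rw [h A B hA hB]; exact hσ.nonneg A B hA hB
  mono := fun A A' B B' hA hB hAA' hBB' => by
    rw [h A B hA hB, h A' B' (hA.trans hAA') (hB.trans hBB')]
    exact hσ.mono A A' B B' hA hB hAA' hBB'
  transformer := fun A B C hA hB hC => by
    rw [h A B hA hB, h _ _ (conj_nonneg hC.isSelfAdjoint hA) (conj_nonneg hC.isSelfAdjoint hB)]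
    exact hσ.transformer A B C hA hB hC
  downward := fun A B A₀ B₀ hA hB hA₀ hB₀ hAl hBl => by
    have e : (fun k => σ' (A k) (B k)) = fun k => σ (A k) (B k) :=
      funext fun k => h _ _ (hA k) (hB k)
    rw [e, h A₀ B₀ hA₀ hB₀]
    exact hσ.downward A B A₀ B₀ hA hB hA₀ hB₀ hAl hBl
  normalized := by rw [h 1 1 zero_le_one zero_le_one]; exact hσ.normalized

end

/-! ### The representing function of an operator mean -/

section

variable {H : Type*} [NormedAddCommGroup H] [InnerProductSpace ℂ H] [CompleteSpace H]

section Projections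

theorem quadForm_conj {P : H →L[ℂ] H} (hP : IsSelfAdjoint P) (D : H →L[ℂ] H) (x : H) :
    quadForm (P * D * P) x = quadForm D (P x) := by
  have := ContinuousLinearMap.isSelfAdjoint_iff_isSymmetric.1 hP (D (P x)) x
  simp only [quadForm, mul_apply_eq_comp]
  exact congrArg Complex.re this

theorem apply_eq_zero_of_quadForm {D : H →L[ℂ] H} (hD : 0 ≤ D) {x : H} (h : quadForm D x = 0) :
    D x = 0 := by
  have := norm_apply_sq_le hD x
  rw [h, mul_zero] at this
  exact norm_eq_zero.1 (pow_eq_zero_iff two_ne_zero |>.1 (le_antisymm this (by positivity)))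

theorem mul_eq_zero_of_conj_eq_zero {P D : H →L[ℂ] H} (hP : IsSelfAdjoint P) (hD : 0 ≤ D)
    (h : P * D * P = 0) : D * P = 0 := by
  refine ContinuousLinearMap.ext fun x => ?_
  change D (P x) = 0
  refine apply_eq_zero_of_quadForm hD ?_
  rw [← quadForm_conj hP, h]
  simp [quadForm]

theorem conj_le_of_commute {P A : H →L[ℂ] H} (hP : IsSelfAdjoint P) (hPP : P * P = P)
    (hA : 0 ≤ A) (h : Commute P A) : P * A * P ≤ A := by
  have e : A - P * A * P = (1 - P) * A * (1 - P) := by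
    have h1 : P * A * P = P * A := by rw [mul_assoc, ← h.eq, ← mul_assoc, hPP]
    have h2 : A * P = P * A := h.eq.symm
    have h3 : (1 - P) * A * (1 - P) = A - P * A - A * P + P * A * P := by noncomm_ring
    rw [h3, h1, h2]
    abel
  rw [← sub_nonneg, e]
  exact conj_nonneg ((IsSelfAdjoint.one _).sub hP) hA

theorem quadForm_add_of_commute {P D : H →L[ℂ] H} (hP : IsSelfAdjoint P) (hPP : P * P = P)
    (h : Commute P D) (x : H) :
    quadForm D x = quadForm D (P x) + quadForm D ((1 - P) x) := by
  rw [← quadForm_conj hP, ← quadForm_conj ((IsSelfAdjoint.one _).sub hP), ← quadForm_add]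
  congr 1
  have h1 : P * D * P = P * D := by rw [mul_assoc, ← h.eq, ← mul_assoc, hPP]
  have h2 : D * P = P * D := h.eq.symm
  rw [sub_mul, sub_mul, mul_sub, mul_sub, h1]
  simp only [one_mul, mul_one]
  rw [h2]
  abel

end Projections

section Mean

variable {τ : (H →L[ℂ] H) → (H →L[ℂ] H) → (H →L[ℂ] H)}

/-- The transformer inequality for `C` gives one direction; for the inverse of `C`, conjugated back,
it gives the other. -/
theorem IsOperatorMean.conj_eq (hτ : IsOperatorMean τ) {A B C : H →L[ℂ] H} (hA : 0 ≤ A)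
    (hB : 0 ≤ B) (hC : IsStrictlyPositive C) : C * τ A B * C = τ (C * A * C) (C * B * C) := by
  obtain ⟨S, hCS, hSC⟩ := isUnit_iff_exists.1 hC.isUnit
  have hS : IsStrictlyPositive S := by
    rw [← ringInverse_eq hCS hSC]; exact hC.ringInverse
  have e : ∀ X : H →L[ℂ] H, S * (C * X * C) * S = X := fun X => by
    calc S * (C * X * C) * S = (S * C) * X * (C * S) := by simp only [mul_assoc]
      _ = X := by rw [hCS, hSC, one_mul, mul_one]
  have e' : ∀ X : H →L[ℂ] H, C * (S * X * S) * C = X := fun X => by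
    calc C * (S * X * S) * C = (C * S) * X * (S * C) := by simp only [mul_assoc]
      _ = X := by rw [hCS, hSC, one_mul, mul_one]
  refine le_antisymm (hτ.transformer A B C hA hB hC.nonneg) ?_
  have h := hτ.transformer (C * A * C) (C * B * C) S (conj_nonneg hC.isSelfAdjoint hA)
    (conj_nonneg hC.isSelfAdjoint hB) hS.nonneg
  rw [e, e] at h
  have := conj_le_conj hC.isSelfAdjoint h
  rwa [e'] at this

theorem IsOperatorMean.smul_eq (hτ : IsOperatorMean τ) {A B : H →L[ℂ] H} (hA : 0 ≤ A)
    (hB : 0 ≤ B) {c : ℝ} (hc : 0 < c) : τ (c • A) (c • B) = c • τ A B := by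
  have h := hτ.conj_eq hA hB
    (IsStrictlyPositive.smul (Real.sqrt_pos.2 hc) (isStrictlyPositive_one (A := H →L[ℂ] H)))
  have e : ∀ X : H →L[ℂ] H, (√c • (1 : H →L[ℂ] H)) * X * (√c • 1) = c • X := fun X => by
    simp only [smul_mul_assoc, one_mul, mul_smul_comm, mul_one, smul_smul,
      Real.mul_self_sqrt hc.le]
  rw [e, e, e] at h
  exact h.symm

/-- With `X = τ A B`, the transformer inequality, `P A P ≤ A` and `P B P ≤ B` give `P X P ≤ X`. The
positive operator `X - P X P` has zero compression to the range of `P`, hence vanishes there, and so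
`X` leaves this range invariant. -/
theorem IsOperatorMean.commute_of_commute (hτ : IsOperatorMean τ) {P A B : H →L[ℂ] H}
    (hP : IsSelfAdjoint P) (hPP : P * P = P) (hA : 0 ≤ A) (hB : 0 ≤ B) (hPA : Commute P A)
    (hPB : Commute P B) : Commute P (τ A B) := by
  have hP0 : 0 ≤ P := by
    have := star_mul_self_nonneg P
    rwa [hP.star_eq, hPP] at this
  set X := τ A B
  have hle : P * X * P ≤ X := (hτ.transformer A B P hA hB hP0).trans
    (hτ.mono _ _ _ _ (conj_nonneg hP hA) (conj_nonneg hP hB) (conj_le_of_commute hP hPP hA hPA)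
      (conj_le_of_commute hP hPP hB hPB))
  have h0 : P * (X - P * X * P) * P = 0 := by
    calc P * (X - P * X * P) * P = P * X * P - (P * P) * X * (P * P) := by noncomm_ring
      _ = 0 := by rw [hPP, sub_self]
  have h1 := mul_eq_zero_of_conj_eq_zero hP (sub_nonneg.2 hle) h0
  have h2 : X * P = P * X * P := by
    have : X * P - P * X * (P * P) = 0 := by rw [← h1]; noncomm_ring
    rw [hPP] at this
    exact sub_eq_zero.1 this
  have h3 : P * X = P * X * P := by
    have hX : star X = X := (hτ.nonneg A B hA hB).isSelfAdjoint.star_eq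
    have := congrArg star h2
    simp only [star_mul, hP.star_eq, hX] at this
    exact this.trans (mul_assoc P X P).symm
  exact h3.trans h2.symm

/-- Commuting with the projection onto each line makes every vector an eigenvector, hence `X` is a
scalar; positivity makes the scalar real and nonnegative. -/
theorem exists_eq_smul_one {X : H →L[ℂ] H} (hX : 0 ≤ X)
    (h : ∀ x : H, Commute (Submodule.span ℂ {x}).starProjection X) :
    ∃ c : ℝ, 0 ≤ c ∧ X = c • (1 : H →L[ℂ] H) := by
  have hx : ∀ x : H, ∃ c : ℂ, c • x = X x := fun x => by
    have hPx : (Submodule.span ℂ {x}).starProjection x = x :=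
      Submodule.starProjection_eq_self_iff.2 (Submodule.mem_span_singleton_self x)
    have h1 : (Submodule.span ℂ {x}).starProjection (X x) = X x := by
      have := congrArg (fun T : H →L[ℂ] H => T x) (h x).eq
      simpa only [mul_apply_eq_comp, hPx] using this
    exact Submodule.mem_span_singleton.1 (Submodule.starProjection_eq_self_iff.1 h1)
  obtain ⟨a, ha⟩ := LinearMap.exists_eq_smul_id_of_forall_notLinearIndependent
    (f := (X : H →ₗ[ℂ] H)) fun v hv => by
      obtain ⟨c, hc⟩ := hx v
      have := LinearIndependent.pair_iff.1 hv c (-1) (by simp [hc])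
      exact neg_ne_zero.2 one_ne_zero this.2
  have hXa : ∀ x, X x = a • x := fun x => by
    have := congrArg (fun T : H →ₗ[ℂ] H => T x) ha
    simpa using this
  rcases subsingleton_or_nontrivial H with hs | hs
  · exact ⟨0, le_rfl, by ext x; exact Subsingleton.elim _ _⟩
  obtain ⟨e, he⟩ := exists_ne (0 : H)
  have hpos := ((ContinuousLinearMap.nonneg_iff_isPositive X).1 hX).inner_nonneg_right e
  rw [hXa, inner_smul_right, inner_self_eq_norm_sq_to_K] at hpos
  have hn : (0 : ℝ) < ‖e‖ ^ 2 := by positivity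
  have h3 : 0 ≤ a.re * ‖e‖ ^ 2 ∧ a.im * ‖e‖ ^ 2 = 0 := by
    rw [Complex.le_def] at hpos
    have e1 : (a * ((‖e‖ : ℂ)) ^ 2) = a * ((‖e‖ ^ 2 : ℝ) : ℂ) := by push_cast; rfl
    simp only [Complex.coe_algebraMap, e1, Complex.re_mul_ofReal, Complex.im_mul_ofReal] at hpos
    exact ⟨hpos.1, hpos.2.symm⟩
  have him : a.im = 0 := (mul_eq_zero.1 h3.2).resolve_right hn.ne'
  refine ⟨a.re, nonneg_of_mul_nonneg_left h3.1 hn, ?_⟩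
  ext x
  have : (a.re : ℂ) = a := Complex.ext rfl (by simp [him])
  rw [hXa, ← this]
  simp

theorem smul_one_le_iff [Nontrivial H] {c d : ℝ} :
    c • (1 : H →L[ℂ] H) ≤ d • 1 ↔ c ≤ d := by
  refine ⟨fun h => ?_, smul_one_mono⟩
  obtain ⟨e, he⟩ := exists_ne (0 : H)
  have := quadForm_mono h e
  rw [quadForm_smul, quadForm_smul, quadForm_one] at this
  exact le_of_mul_le_mul_right this (by positivity)

theorem smul_one_inj [Nontrivial H] {c d : ℝ} (h : c • (1 : H →L[ℂ] H) = d • 1) : c = d :=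
  le_antisymm (smul_one_le_iff.1 h.le) (smul_one_le_iff.1 h.ge)

theorem smul_one_nonneg {c : ℝ} (h : 0 ≤ c) : 0 ≤ c • (1 : H →L[ℂ] H) := smul_nonneg h zero_le_one

theorem reprFun_eq_of_eq [Nontrivial H] {σ : (H →L[ℂ] H) → (H →L[ℂ] H) → (H →L[ℂ] H)} {t c : ℝ}
    (h : σ 1 (t • 1) = c • (1 : H →L[ℂ] H)) : reprFun σ t = c :=
  smul_one_inj ((Classical.epsilon_spec (p := fun c : ℝ => σ 1 (t • 1) = c • (1 : H →L[ℂ] H))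
    ⟨c, h⟩).symm.trans h)

theorem IsOperatorMean.exists_smul (hτ : IsOperatorMean τ) {t : ℝ} (ht : 0 ≤ t) :
    ∃ c : ℝ, 0 ≤ c ∧ τ 1 (t • 1) = c • (1 : H →L[ℂ] H) :=
  exists_eq_smul_one (hτ.nonneg _ _ zero_le_one (smul_one_nonneg ht)) fun _ =>
    hτ.commute_of_commute (isSelfAdjoint_starProjection _)
      (Submodule.isIdempotentElem_starProjection _) zero_le_one (smul_one_nonneg ht)
      (Commute.one_right _) ((Commute.one_right _).smul_right t)

theorem IsOperatorMean.one_smul (hτ : IsOperatorMean τ) {t : ℝ} (ht : 0 ≤ t) :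
    τ 1 (t • 1) = reprFun τ t • (1 : H →L[ℂ] H) :=
  let ⟨c, _, hc⟩ := hτ.exists_smul ht
  Classical.epsilon_spec (p := fun c : ℝ => τ 1 (t • 1) = c • (1 : H →L[ℂ] H)) ⟨c, hc⟩

variable [Nontrivial H]

theorem IsOperatorMean.reprFun_nonneg (hτ : IsOperatorMean τ) {t : ℝ} (ht : 0 ≤ t) :
    0 ≤ reprFun τ t := by
  obtain ⟨c, hc, h⟩ := hτ.exists_smul ht
  rwa [reprFun_eq_of_eq h]

theorem IsOperatorMean.reprFun_one (hτ : IsOperatorMean τ) : reprFun τ 1 = 1 :=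
  reprFun_eq_of_eq (by simpa using hτ.normalized)

theorem IsOperatorMean.reprFun_mono (hτ : IsOperatorMean τ) {s t : ℝ} (hs : 0 ≤ s) (hst : s ≤ t) :
    reprFun τ s ≤ reprFun τ t := by
  have := hτ.mono 1 1 (s • 1) (t • 1) zero_le_one (smul_one_nonneg hs) le_rfl (smul_one_mono hst)
  rwa [hτ.one_smul hs, hτ.one_smul (hs.trans hst), smul_one_le_iff] at this

/-- By homogeneity the right side is the mean of `l I` and `l t I`, and `I ≤ l I`. Equivalently
`f(t) / t` is nonincreasing, which is what makes `f` continuous on `(0, ∞)`. -/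
theorem IsOperatorMean.reprFun_mul_le (hτ : IsOperatorMean τ) {l t : ℝ} (hl : 1 ≤ l)
    (ht : 0 ≤ t) : reprFun τ (l * t) ≤ l * reprFun τ t := by
  have hl0 : 0 < l := one_pos.trans_le hl
  have h1 : (1 : H →L[ℂ] H) ≤ l • 1 := by
    simpa using smul_one_mono (H := H) hl
  have := hτ.mono 1 (l • 1) ((l * t) • 1) (l • t • 1) zero_le_one
    (smul_one_nonneg (mul_nonneg hl0.le ht)) h1 (by rw [mul_smul])
  rwa [hτ.smul_eq zero_le_one (smul_one_nonneg ht) hl0, hτ.one_smul ht,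
    hτ.one_smul (mul_nonneg hl0.le ht), smul_smul, smul_one_le_iff] at this

theorem IsOperatorMean.reprFun_le (hτ : IsOperatorMean τ) {b t : ℝ} (hb : 0 < b) (ht : 0 ≤ t) :
    reprFun τ t ≤ reprFun τ b * max 1 (t / b) := by
  have hfb := hτ.reprFun_nonneg hb.le
  rcases le_total t b with h | h
  · exact (hτ.reprFun_mono ht h).trans (le_mul_of_one_le_right hfb (le_max_left _ _))
  · have := hτ.reprFun_mul_le ((one_le_div hb).2 h) hb.le
    rw [div_mul_cancel₀ _ hb.ne'] at this
    refine this.trans ?_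
    rw [mul_comm]
    exact mul_le_mul_of_nonneg_left (le_max_right _ _) hfb

theorem IsOperatorMean.le_reprFun (hτ : IsOperatorMean τ) {a t : ℝ} (ha : 0 < a) (ht : 0 ≤ t) :
    reprFun τ a * min 1 (t / a) ≤ reprFun τ t := by
  have hfa := hτ.reprFun_nonneg ha.le
  have hft := hτ.reprFun_nonneg ht
  rcases ht.eq_or_lt with rfl | ht0
  · simpa using hft
  rcases le_total a t with h | h
  · exact (mul_le_of_le_one_right hfa (min_le_left _ _)).trans (hτ.reprFun_mono ha.le h)
  · have := hτ.reprFun_mul_le ((one_le_div ht0).2 h) ht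
    rw [div_mul_cancel₀ _ ht0.ne'] at this
    calc reprFun τ a * min 1 (t / a) ≤ (a / t * reprFun τ t) * (t / a) :=
          mul_le_mul this (min_le_right _ _) (by positivity) (by positivity)
      _ = reprFun τ t := by field_simp

theorem IsOperatorMean.reprFun_pos (hτ : IsOperatorMean τ) {t : ℝ} (ht : 0 < t) :
    0 < reprFun τ t := by
  have := hτ.le_reprFun one_pos ht.le
  rw [hτ.reprFun_one, one_mul, div_one] at this
  exact (lt_min one_pos ht).trans_le this

theorem IsOperatorMean.continuousAt_reprFun (hτ : IsOperatorMean τ) {t : ℝ} (ht : 0 < t) :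
    ContinuousAt (reprFun τ) t := by
  have h1 : Tendsto (fun s => reprFun τ t * min 1 (s / t)) (𝓝 t) (𝓝 (reprFun τ t)) := by
    have : Tendsto (fun s => reprFun τ t * min 1 (s / t)) (𝓝 t)
        (𝓝 (reprFun τ t * min 1 (t / t))) := Continuous.tendsto (by fun_prop) t
    rwa [div_self ht.ne', min_self, mul_one] at this
  have h2 : Tendsto (fun s => reprFun τ t * max 1 (s / t)) (𝓝 t) (𝓝 (reprFun τ t)) := by
    have : Tendsto (fun s => reprFun τ t * max 1 (s / t)) (𝓝 t)
        (𝓝 (reprFun τ t * max 1 (t / t))) := Continuous.tendsto (by fun_prop) t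
    rwa [div_self ht.ne', max_self, mul_one] at this
  refine tendsto_of_tendsto_of_tendsto_of_le_of_le' h1 h2 ?_ ?_
  · filter_upwards [lt_mem_nhds ht] with s hs using hτ.le_reprFun ht (le_of_lt hs)
  · filter_upwards [lt_mem_nhds ht] with s hs using hτ.reprFun_le ht (le_of_lt hs)

theorem IsOperatorMean.continuousOn_reprFun (hτ : IsOperatorMean τ) :
    ContinuousOn (reprFun τ) (Ici 0) := by
  intro t ht
  rcases (mem_Ici.1 ht).eq_or_lt with rfl | h0
  -- The multiplicative bounds say nothing at `0`; there continuity comes from the downward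
  -- continuity axiom along `1 / (n + 1)` and monotonicity.
  · obtain ⟨e, he⟩ := exists_ne (0 : H)
    have hp : ∀ n : ℕ, (0 : ℝ) < 1 / ((n : ℝ) + 1) := fun n => Nat.one_div_pos_of_nat
    have hd : DecreasesTo (fun n : ℕ => (1 / ((n : ℝ) + 1)) • (1 : H →L[ℂ] H)) ((0 : ℝ) • 1) :=
      ⟨fun m n hmn => smul_one_mono (Nat.one_div_le_one_div hmn), fun x => by
        simpa using (tendsto_one_div_add_atTop_nhds_zero_nat (𝕜 := ℝ)).smul_const x⟩
    have hlim := (hτ.downward (fun _ => 1) _ 1 _ (fun _ => zero_le_one)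
      (fun n => smul_one_nonneg (hp n).le) zero_le_one (smul_one_nonneg le_rfl)
      ⟨fun _ _ _ => le_rfl, fun _ => tendsto_const_nhds⟩ hd).2 e
    have hq := tendsto_quadForm hlim
    simp only [hτ.one_smul (hp _).le, hτ.one_smul le_rfl, quadForm_smul, quadForm_one] at hq
    have hn : ‖e‖ ^ 2 ≠ 0 := by positivity
    have hf : Tendsto (fun n : ℕ => reprFun τ (1 / ((n : ℝ) + 1))) atTop (𝓝 (reprFun τ 0)) := by
      have := hq.div_const (‖e‖ ^ 2)
      simp only [mul_div_cancel_right₀ _ hn] at this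
      exact this
    refine tendsto_order.2 ⟨fun a ha => ?_, fun a ha => ?_⟩
    · filter_upwards [self_mem_nhdsWithin] with s hs
      exact ha.trans_le (hτ.reprFun_mono le_rfl hs)
    · obtain ⟨n, hn⟩ := ((tendsto_order.1 hf).2 a ha).exists
      filter_upwards [self_mem_nhdsWithin, nhdsWithin_le_nhds (gt_mem_nhds (hp n))] with s hs hs'
      exact (hτ.reprFun_mono hs (le_of_lt hs')).trans_lt hn
  · exact (hτ.continuousAt_reprFun h0).continuousWithinAt

end Mean

end

/-! ### The mean of the identity and an operator as a functional calculus -/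

section

variable {H : Type*} [NormedAddCommGroup H] [InnerProductSpace ℂ H] [CompleteSpace H]

/-- The positive part of `B - b`. -/
def excess (B : H →L[ℂ] H) (b : ℝ) : H →L[ℂ] H := cfc (fun t : ℝ => max (t - b) 0) B

/-- The spectral projection of `B` for the interval `(-∞, b]`. -/
def specProj (B : H →L[ℂ] H) (b : ℝ) : H →L[ℂ] H := (excess B b).ker.starProjection

theorem isSelfAdjoint_specProj (B : H →L[ℂ] H) (b : ℝ) : IsSelfAdjoint (specProj B b) :=
  isSelfAdjoint_starProjection _

theorem specProj_mul_self (B : H →L[ℂ] H) (b : ℝ) : specProj B b * specProj B b = specProj B b :=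
  Submodule.isIdempotentElem_starProjection _

theorem specProj_eq_self_iff {B : H →L[ℂ] H} {b : ℝ} {x : H} :
    specProj B b x = x ↔ excess B b x = 0 :=
  Submodule.starProjection_eq_self_iff.trans LinearMap.mem_ker

theorem excess_nonneg (B : H →L[ℂ] H) (b : ℝ) : 0 ≤ excess B b :=
  cfc_nonneg fun _ _ => le_max_right _ _

theorem excess_specProj (B : H →L[ℂ] H) (b : ℝ) (x : H) : excess B b (specProj B b x) = 0 := by
  rw [← specProj_eq_self_iff]
  exact congrArg (fun T : H →L[ℂ] H => T x) (specProj_mul_self B b)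

/-- An operator commuting with the positive part of `B - b` preserves its kernel; being
self-adjoint, it commutes with the projection onto it. -/
theorem specProj_commute {B C : H →L[ℂ] H} {b : ℝ} (hC : IsSelfAdjoint C)
    (h : Commute (excess B b) C) : Commute (specProj B b) C := by
  set P := specProj B b
  have h1 : P * (C * P) = C * P := by
    refine ContinuousLinearMap.ext fun x => ?_
    change P (C (P x)) = C (P x)
    rw [specProj_eq_self_iff]
    have := congrArg (fun T : H →L[ℂ] H => T (P x)) h.eq
    simp only [mul_apply_eq_comp] at this
    rw [this, excess_specProj, map_zero]
  have h2 := congrArg star h1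
  simp only [star_mul, (isSelfAdjoint_specProj B b).star_eq, hC.star_eq, P] at h2
  exact h2.symm.trans ((mul_assoc _ _ _).trans h1)

theorem specProj_commute_cfc (B : H →L[ℂ] H) (b : ℝ) (g : ℝ → ℝ) :
    Commute (specProj B b) (cfc g B) :=
  specProj_commute (isSelfAdjoint_cfc g B) (cfc_commute_cfc _ _ B)

theorem specProj_commute_self {B : H →L[ℂ] H} (hB : IsSelfAdjoint B) (b : ℝ) :
    Commute (specProj B b) B := by
  have := specProj_commute_cfc B b fun t => t
  rwa [cfc_id' ℝ B hB] at this

theorem specProj_apply_of_le {B : H →L[ℂ] H} {b c : ℝ} (hbc : b ≤ c) {x : H}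
    (hx : specProj B b x = x) : specProj B c x = x := by
  rw [specProj_eq_self_iff] at hx ⊢
  refine apply_eq_zero_of_quadForm (excess_nonneg B c) (le_antisymm ?_
    (quadForm_nonneg (excess_nonneg B c) x))
  have hle : excess B c ≤ excess B b := cfc_mono (fun t _ => max_le_max (by linarith) le_rfl)
    (by fun_prop) (by fun_prop)
  have := quadForm_mono hle x
  simpa [quadForm, hx] using this

/-- The product of `(t - a)₊` and `(a - t)₊` is zero, so the range of `(a - B)₊` lies in the range
of the spectral projection, and `(a - B)₊` kills the orthogonal complement. -/
theorem deficit_apply_eq_zero {B : H →L[ℂ] H} {a : ℝ} {x : H}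
    (hx : specProj B a x = 0) : cfc (fun t : ℝ => max (a - t) 0) B x = 0 := by
  set N := cfc (fun t : ℝ => max (a - t) 0) B
  have h1 : excess B a * N = 0 := by
    rw [excess, cfc_mul_cfc (by fun_prop) (by fun_prop), ← cfc_zero ℝ B]
    refine cfc_congr fun t _ => ?_
    rcases le_total t a with h | h
    · simp [max_eq_right (sub_nonpos.2 h)]
    · simp [max_eq_right (sub_nonpos.2 h)]
  have h2 : N * specProj B a = N := by
    rw [← (specProj_commute_cfc B a _).eq]
    refine ContinuousLinearMap.ext fun y => ?_
    change specProj B a (N y) = N y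
    rw [specProj_eq_self_iff]
    exact congrArg (fun T : H →L[ℂ] H => T y) h1
  calc N x = (N * specProj B a) x := by rw [h2]
    _ = N (specProj B a x) := rfl
    _ = 0 := by rw [hx, map_zero]

variable {τ : (H →L[ℂ] H) → (H →L[ℂ] H) → (H →L[ℂ] H)}

theorem quadForm_algebraMap_smul (c : ℝ) (x : H) :
    quadForm (algebraMap ℝ (H →L[ℂ] H) c) x = c * ‖x‖ ^ 2 := by
  rw [Algebra.algebraMap_eq_smul_one, quadForm_smul, quadForm_one]

/-- The term `k (t - b)₊` vanishes on the spectral subspace of `(-∞, b]`. Allowing it in a bound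
over the whole spectrum localizes the estimate while using only continuous functions of `B`. -/
theorem quadForm_cfc_le {B : H →L[ℂ] H} (hB : IsSelfAdjoint B) {f : ℝ → ℝ}
    (hf : ContinuousOn f (spectrum ℝ B)) {b c k : ℝ}
    (h : ∀ t ∈ spectrum ℝ B, f t ≤ c + k * max (t - b) 0) {x : H} (hx : specProj B b x = x) :
    quadForm (cfc f B) x ≤ c * ‖x‖ ^ 2 := by
  have hle := quadForm_mono (cfc_mono (a := B) h hf (by fun_prop)) x
  rw [cfc_const_add c _ B (by fun_prop) hB, cfc_const_mul k _ B (by fun_prop), quadForm_add,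
    quadForm_smul, quadForm_algebraMap_smul] at hle
  have : quadForm (cfc (fun t : ℝ => max (t - b) 0) B) x = 0 := by
    have := specProj_eq_self_iff.1 hx
    rw [excess] at this
    simp [quadForm, this]
  rwa [this, mul_zero, add_zero] at hle

theorem le_quadForm_cfc {B : H →L[ℂ] H} (hB : IsSelfAdjoint B) {f : ℝ → ℝ}
    (hf : ContinuousOn f (spectrum ℝ B)) {a c k : ℝ}
    (h : ∀ t ∈ spectrum ℝ B, c + k * max (a - t) 0 ≤ f t) {x : H} (hx : specProj B a x = 0) :
    c * ‖x‖ ^ 2 ≤ quadForm (cfc f B) x := by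
  have hle := quadForm_mono (cfc_mono (a := B) h (by fun_prop) hf) x
  rw [cfc_const_add c _ B (by fun_prop) hB, cfc_const_mul k _ B (by fun_prop), quadForm_add,
    quadForm_smul, quadForm_algebraMap_smul] at hle
  have : quadForm (cfc (fun t : ℝ => max (a - t) 0) B) x = 0 := by
    simp [quadForm, deficit_apply_eq_zero hx]
  rwa [this, mul_zero, add_zero] at hle

theorem conj_specProj_le {B : H →L[ℂ] H} (hB : IsSelfAdjoint B) (b : ℝ) :
    specProj B b * B * specProj B b ≤ b • specProj B b := by
  have hP := isSelfAdjoint_specProj B b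
  refine le_of_quadForm (isSelfAdjoint_conj hP hB) ((IsSelfAdjoint.all b).smul hP) fun x => ?_
  have hPx : specProj B b (specProj B b x) = specProj B b x :=
    congrArg (fun T : H →L[ℂ] H => T x) (specProj_mul_self B b)
  have h := quadForm_cfc_le hB (f := fun t => t) continuousOn_id (b := b) (c := b) (k := 1)
    (fun t _ => by linarith [le_max_left (t - b) 0]) hPx
  rw [cfc_id' ℝ B hB] at h
  rw [quadForm_conj hP, quadForm_smul]
  refine h.trans_eq ?_
  rw [← quadForm_one, ← quadForm_conj hP, mul_one, specProj_mul_self]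

theorem smul_compl_specProj_le {B : H →L[ℂ] H} (hB : IsSelfAdjoint B) (a : ℝ) :
    a • (1 - specProj B a) ≤ (1 - specProj B a) * B * (1 - specProj B a) := by
  have hP := (IsSelfAdjoint.one (H →L[ℂ] H)).sub (isSelfAdjoint_specProj B a)
  have hPP : (1 - specProj B a) * (1 - specProj B a) = 1 - specProj B a := by
    rw [mul_sub, mul_one, sub_mul, one_mul, specProj_mul_self, sub_self, sub_zero]
  refine le_of_quadForm ((IsSelfAdjoint.all a).smul hP) (isSelfAdjoint_conj hP hB) fun x => ?_
  have hPx : specProj B a ((1 - specProj B a) x) = 0 := by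
    change specProj B a (x - specProj B a x) = 0
    rw [map_sub]
    exact sub_eq_zero.2 (congrArg (fun T : H →L[ℂ] H => T x) (specProj_mul_self B a)).symm
  have h := le_quadForm_cfc hB (f := fun t => t) continuousOn_id (a := a) (c := a) (k := -1)
    (fun t _ => by linarith [le_max_left (a - t) 0]) hPx
  rw [cfc_id' ℝ B hB] at h
  rw [quadForm_conj hP, quadForm_smul]
  refine Eq.trans_le ?_ h
  rw [← quadForm_one, ← quadForm_conj hP, mul_one, hPP]

theorem nonneg_of_isSelfAdjoint_of_mul_self {P : H →L[ℂ] H} (hP : IsSelfAdjoint P)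
    (hPP : P * P = P) : 0 ≤ P := by
  have := star_mul_self_nonneg P
  rwa [hP.star_eq, hPP] at this

theorem le_one_of_isSelfAdjoint_of_mul_self {P : H →L[ℂ] H} (hP : IsSelfAdjoint P)
    (hPP : P * P = P) : P ≤ 1 := by
  have := nonneg_of_isSelfAdjoint_of_mul_self ((IsSelfAdjoint.one (H →L[ℂ] H)).sub hP)
    (by rw [mul_sub, mul_one, sub_mul, one_mul, hPP, sub_self, sub_zero])
  exact sub_nonneg.1 this

theorem IsOperatorMean.smul_le_of_projection (hτ : IsOperatorMean τ) {P : H →L[ℂ] H}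
    (hP : IsSelfAdjoint P) (hPP : P * P = P) {t : ℝ} (ht : 0 ≤ t) :
    reprFun τ t • P ≤ τ P (t • P) := by
  have h := hτ.transformer 1 (t • 1) P zero_le_one (smul_one_nonneg ht)
    (nonneg_of_isSelfAdjoint_of_mul_self hP hPP)
  simp only [hτ.one_smul ht, mul_smul_comm, mul_one, smul_mul_assoc, hPP] at h
  exact h

/-- The transformer inequality gives `P (I τ B) P ≤ P τ (P B P)`, and monotonicity bounds this by `I
τ (b I) = f(b) I`; compressing once more by `P` restores the projection on the right. -/
theorem IsOperatorMean.conj_le_of_conj_le (hτ : IsOperatorMean τ) {P B : H →L[ℂ] H}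
    (hP : IsSelfAdjoint P) (hPP : P * P = P) (hB : 0 ≤ B) {b : ℝ} (hb : 0 ≤ b)
    (h : P * B * P ≤ b • P) : P * τ 1 B * P ≤ reprFun τ b • P := by
  have hP0 := nonneg_of_isSelfAdjoint_of_mul_self hP hPP
  have h1 := hτ.transformer 1 B P zero_le_one hB hP0
  rw [mul_one, hPP] at h1
  have h2 := h1.trans (hτ.mono P 1 _ (b • 1) hP0 (conj_nonneg hP hB)
    (le_one_of_isSelfAdjoint_of_mul_self hP hPP) (h.trans (smul_le_smul_of_nonneg_left
      (le_one_of_isSelfAdjoint_of_mul_self hP hPP) hb)))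
  have h3 := conj_le_conj hP h2
  rw [hτ.one_smul hb, mul_smul_comm, mul_one, smul_mul_assoc, hPP] at h3
  have h4 : P * (P * τ 1 B * P) * P = P * τ 1 B * P := by
    calc _ = (P * P) * τ 1 B * (P * P) := by simp only [mul_assoc]
      _ = _ := by rw [hPP]
  rwa [h4] at h3

/-- The chain is `f(a) P ≤ P τ (a P) ≤ I τ (P B P) ≤ I τ B`; commutation enters through `P B P ≤ B`.
-/
theorem IsOperatorMean.smul_le_of_le_conj (hτ : IsOperatorMean τ) {P B : H →L[ℂ] H}
    (hP : IsSelfAdjoint P) (hPP : P * P = P) (hB : 0 ≤ B) (hPB : Commute P B) {a : ℝ} (ha : 0 ≤ a)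
    (h : a • P ≤ P * B * P) : reprFun τ a • P ≤ τ 1 B := by
  have hP0 := nonneg_of_isSelfAdjoint_of_mul_self hP hPP
  exact (hτ.smul_le_of_projection hP hPP ha).trans (hτ.mono _ _ _ _ hP0 (smul_nonneg ha hP0)
    (le_one_of_isSelfAdjoint_of_mul_self hP hPP) (h.trans (conj_le_of_commute hP hPP hB hPB)))

theorem IsOperatorMean.quadForm_one_le (hτ : IsOperatorMean τ) {B : H →L[ℂ] H} (hB : 0 ≤ B)
    {b : ℝ} (hb : 0 ≤ b) {x : H} (hx : specProj B b x = x) :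
    quadForm (τ 1 B) x ≤ reprFun τ b * ‖x‖ ^ 2 := by
  have hP := isSelfAdjoint_specProj B b
  have h := quadForm_mono (hτ.conj_le_of_conj_le hP (specProj_mul_self B b) hB hb
    (conj_specProj_le hB.isSelfAdjoint b)) x
  rw [quadForm_conj hP, hx, quadForm_smul] at h
  have e : quadForm (specProj B b) x = ‖x‖ ^ 2 := by
    rw [← specProj_mul_self, ← mul_one (specProj B b * specProj B b), mul_assoc, ← mul_assoc,
      mul_one, ← quadForm_one]
    have := quadForm_conj hP 1 x
    rw [mul_one, hx] at this
    exact this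
  rwa [e] at h

theorem IsOperatorMean.le_quadForm_one (hτ : IsOperatorMean τ) {B : H →L[ℂ] H} (hB : 0 ≤ B)
    {a : ℝ} (ha : 0 ≤ a) {x : H} (hx : specProj B a x = 0) :
    reprFun τ a * ‖x‖ ^ 2 ≤ quadForm (τ 1 B) x := by
  have hP := (IsSelfAdjoint.one (H →L[ℂ] H)).sub (isSelfAdjoint_specProj B a)
  have hPP : (1 - specProj B a) * (1 - specProj B a) = 1 - specProj B a := by
    rw [mul_sub, mul_one, sub_mul, one_mul, specProj_mul_self, sub_self, sub_zero]
  have h := quadForm_mono (hτ.smul_le_of_le_conj hP hPP hB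
    ((Commute.one_left B).sub_left (specProj_commute_self hB.isSelfAdjoint a)) ha
    (smul_compl_specProj_le hB.isSelfAdjoint a)) x
  rw [quadForm_smul, quadForm_sub, quadForm_one] at h
  have : quadForm (specProj B a) x = 0 := by simp [quadForm, hx]
  rwa [this, sub_zero] at h

variable [Nontrivial H]

theorem IsOperatorMean.continuousOn_reprFun_spectrum (hτ : IsOperatorMean τ) {B : H →L[ℂ] H}
    (hB : 0 ≤ B) : ContinuousOn (reprFun τ) (spectrum ℝ B) :=
  hτ.continuousOn_reprFun.mono fun _ ht => spectrum_nonneg_of_nonneg hB ht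

theorem IsOperatorMean.quadForm_cfc_reprFun_le (hτ : IsOperatorMean τ) {B : H →L[ℂ] H}
    (hB : 0 ≤ B) {b : ℝ} (hb : 0 < b) {x : H} (hx : specProj B b x = x) :
    quadForm (cfc (reprFun τ) B) x ≤ reprFun τ b * ‖x‖ ^ 2 := by
  refine quadForm_cfc_le hB.isSelfAdjoint (hτ.continuousOn_reprFun_spectrum hB)
    (k := reprFun τ b / b) (fun t ht => ?_) hx
  refine (hτ.reprFun_le hb (spectrum_nonneg_of_nonneg hB ht)).trans_eq ?_
  have : max 1 (t / b) = 1 + max (t - b) 0 / b := by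
    rcases le_total t b with h | h
    · rw [max_eq_left ((div_le_one hb).2 h), max_eq_right (by linarith)]; simp
    · rw [max_eq_right ((one_le_div hb).2 h), max_eq_left (by linarith)]; field_simp; ring
  rw [this]; ring

theorem IsOperatorMean.le_quadForm_cfc_reprFun (hτ : IsOperatorMean τ) {B : H →L[ℂ] H}
    (hB : 0 ≤ B) {a : ℝ} (ha : 0 < a) {x : H} (hx : specProj B a x = 0) :
    reprFun τ a * ‖x‖ ^ 2 ≤ quadForm (cfc (reprFun τ) B) x := by
  refine le_quadForm_cfc hB.isSelfAdjoint (hτ.continuousOn_reprFun_spectrum hB)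
    (k := -(reprFun τ a / a)) (fun t ht => ?_) hx
  refine le_trans (le_of_eq ?_) (hτ.le_reprFun ha (spectrum_nonneg_of_nonneg hB ht))
  have : min 1 (t / a) = 1 - max (a - t) 0 / a := by
    rcases le_total t a with h | h
    · rw [min_eq_right ((div_le_one ha).2 h), max_eq_left (by linarith)]; field_simp; ring
    · rw [min_eq_left ((one_le_div ha).2 h), max_eq_right (by linarith)]; simp
  rw [this]; ring

/-- On the range of a spectral projection, `I τ B` and `f(B)` differ by at most the oscillation
of `f` on a grid. -/
theorem IsOperatorMean.abs_quadForm_sub_le (hτ : IsOperatorMean τ) {B : H →L[ℂ] H} (hB : 0 ≤ B)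
    {h ω : ℝ} (hh : 0 < h) (N : ℕ)
    (hω : ∀ k : ℕ, k ≤ N → reprFun τ ((k + 1) * h) - reprFun τ (k * h) ≤ ω) :
    ∀ k : ℕ, k ≤ N → ∀ x : H, specProj B ((k + 1) * h) x = x →
      |quadForm (τ 1 B - cfc (reprFun τ) B) x| ≤ ω * ‖x‖ ^ 2 := by
  -- On one grid cell both quadratic forms lie between `f(a) ‖x‖²` and `f(b) ‖x‖²`, so they differ
  -- by at most the oscillation of `f`.
  have cell : ∀ {a b : ℝ} {x : H}, reprFun τ b - reprFun τ a ≤ ω →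
      quadForm (τ 1 B) x ≤ reprFun τ b * ‖x‖ ^ 2 →
      quadForm (cfc (reprFun τ) B) x ≤ reprFun τ b * ‖x‖ ^ 2 →
      reprFun τ a * ‖x‖ ^ 2 ≤ quadForm (τ 1 B) x →
      reprFun τ a * ‖x‖ ^ 2 ≤ quadForm (cfc (reprFun τ) B) x →
      |quadForm (τ 1 B - cfc (reprFun τ) B) x| ≤ ω * ‖x‖ ^ 2 := fun {a b x} h0 h1 h2 h3 h4 => by
    have := mul_le_mul_of_nonneg_right h0 (sq_nonneg ‖x‖)
    rw [quadForm_sub, abs_le]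
    constructor <;> nlinarith
  intro k
  induction k with
  | zero =>
    intro _ x hx
    have hω0 := hω 0 (Nat.zero_le N)
    simp only [Nat.cast_zero, zero_add, one_mul, zero_mul] at hx hω0
    refine cell hω0 (hτ.quadForm_one_le hB hh.le hx) (hτ.quadForm_cfc_reprFun_le hB hh hx) ?_ ?_
    -- The first cell starts at `0`, where the localized lower bound for `f(B)` is not available;
    -- the global bound by `f(0)` serves for both operators.
    · have := hτ.mono 1 1 ((0 : ℝ) • 1) B zero_le_one (smul_one_nonneg le_rfl) le_rfl (by simpa)
      rw [hτ.one_smul le_rfl] at this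
      simpa only [quadForm_smul, quadForm_one] using quadForm_mono this x
    · have := algebraMap_le_cfc (reprFun τ) (reprFun τ 0) B
        (fun t ht => hτ.reprFun_mono le_rfl (spectrum_nonneg_of_nonneg hB ht))
        (hτ.continuousOn_reprFun_spectrum hB) hB.isSelfAdjoint
      simpa only [quadForm_algebraMap_smul] using quadForm_mono this x
  | succ k ih =>
    intro hk x hx
    set b : ℝ := (k + 1) * h with hb
    have hb0 : 0 < b := by positivity
    have hb' : (((k + 1 : ℕ) : ℝ) + 1) * h = b + h := by push_cast; ring
    rw [hb'] at hx
    have hωk := hω (k + 1) hk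
    rw [hb', Nat.cast_add, Nat.cast_one, ← hb] at hωk
    set P := specProj B b
    have hP := isSelfAdjoint_specProj B b
    have hPP := specProj_mul_self B b
    -- Because the difference commutes with `P`, there are no cross terms between the old cells,
    -- covered by `P x`, and the new cell, which contains `z`.
    have hcomm : Commute P (τ 1 B - cfc (reprFun τ) B) :=
      (hτ.commute_of_commute hP hPP zero_le_one hB (Commute.one_right _)
        (specProj_commute_self hB.isSelfAdjoint b)).sub_right (specProj_commute_cfc B b _)
    have hPx : P (P x) = P x := congrArg (fun T : H →L[ℂ] H => T x) hPP
    set z := (1 - P) x with hz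
    have hz' : z = x - P x := rfl
    have hPz : P z = 0 := by rw [hz', map_sub, hPx, sub_self]
    have hQz : specProj B (b + h) z = z := by
      rw [hz', map_sub, hx, specProj_apply_of_le (by linarith) hPx]
    have hn : ‖x‖ ^ 2 = ‖P x‖ ^ 2 + ‖z‖ ^ 2 := by
      simpa only [quadForm_one] using quadForm_add_of_commute hP hPP (Commute.one_right P) x
    rw [quadForm_add_of_commute hP hPP hcomm x, hn, mul_add]
    refine (abs_add_le _ _).trans (add_le_add (ih (by omega) (P x) hPx) ?_)
    exact cell hωk (hτ.quadForm_one_le hB (by positivity) hQz)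
      (hτ.quadForm_cfc_reprFun_le hB (by positivity) hQz) (hτ.le_quadForm_one hB hb0.le hPz)
      (hτ.le_quadForm_cfc_reprFun hB hb0 hPz)

theorem specProj_apply_of_norm_le {B : H →L[ℂ] H} {M : ℝ} (hM : ‖B‖ ≤ M)
    (x : H) : specProj B M x = x := by
  rw [specProj_eq_self_iff, excess]
  have : cfc (fun t : ℝ => max (t - M) 0) B = cfc (0 : ℝ → ℝ) B := cfc_congr fun t ht => by
    have h1 : ‖t‖ ≤ ‖B‖ := spectrum.norm_le_norm_of_mem ht
    have h2 : t ≤ M := (le_abs_self t).trans (h1.trans hM)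
    exact max_eq_right (by linarith)
  rw [this, cfc_zero ℝ B]
  rfl

/-- `I τ B` is the function `f_τ` of `B`. -/
theorem IsOperatorMean.one_left (hτ : IsOperatorMean τ) {B : H →L[ℂ] H} (hB : 0 ≤ B) :
    τ 1 B = cfc (reprFun τ) B := by
  have key : ∀ x : H, ∀ ω > 0, |quadForm (τ 1 B - cfc (reprFun τ) B) x| ≤ ω * ‖x‖ ^ 2 := by
    intro x ω hω
    set M := ‖B‖ + 1
    have hM : 0 < M := by positivity
    have huc := isCompact_Icc.uniformContinuousOn_of_continuous
      (hτ.continuousOn_reprFun.mono (Icc_subset_Ici_self : Icc 0 M ⊆ Ici 0))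
    obtain ⟨δ, hδ, hδω⟩ := Metric.uniformContinuousOn_iff.1 huc ω hω
    obtain ⟨N, hN⟩ := exists_nat_gt (M / δ)
    have hN1 : (0 : ℝ) < N + 1 := by positivity
    -- The `N + 1` cells of width `h < δ` exhaust `[0, M]`, and `M ≥ ‖B‖` makes the last spectral
    -- projection the identity.
    set h := M / (N + 1) with hh
    have hh0 : 0 < h := by positivity
    have hhδ : h < δ := by
      rw [hh, div_lt_iff₀ hN1]
      rw [div_lt_iff₀ hδ] at hN
      nlinarith
    have hNh : ((N : ℝ) + 1) * h = M := by rw [hh]; field_simp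
    refine hτ.abs_quadForm_sub_le hB hh0 N (fun k hk => ?_) N le_rfl x ?_
    · have hk' : ((k : ℝ) + 1) * h ≤ M := by
        rw [← hNh]
        exact mul_le_mul_of_nonneg_right (by exact_mod_cast Nat.succ_le_succ hk) hh0.le
      have hk0 : (0 : ℝ) ≤ k * h := by positivity
      have := hδω ((k + 1) * h) ⟨by positivity, hk'⟩ (k * h) ⟨hk0, by linarith⟩ (by
        rw [Real.dist_eq, show ((k : ℝ) + 1) * h - k * h = h by ring, abs_of_pos hh0]
        exact hhδ)
      rw [Real.dist_eq] at this
      exact (le_abs_self _).trans this.le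
    · rw [hNh]
      exact specProj_apply_of_norm_le (by simp [M]) x
  have hzero : ∀ x : H, quadForm (τ 1 B) x = quadForm (cfc (reprFun τ) B) x := fun x => by
    rw [← sub_eq_zero, ← quadForm_sub, ← abs_nonpos_iff]
    refine le_of_forall_pos_le_add fun ε hε => ?_
    refine (key x (ε / (‖x‖ ^ 2 + 1)) (by positivity)).trans ?_
    rw [zero_add, div_mul_eq_mul_div, div_le_iff₀ (by positivity)]
    nlinarith [sq_nonneg ‖x‖]
  have h1 := (hτ.nonneg 1 B zero_le_one hB).isSelfAdjoint
  have h2 := isSelfAdjoint_cfc (reprFun τ) B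
  exact le_antisymm (le_of_quadForm h1 h2 fun x => (hzero x).le)
    (le_of_quadForm h2 h1 fun x => (hzero x).ge)

theorem IsOperatorMean.eq_perspective (hτ : IsOperatorMean τ) {A B : H →L[ℂ] H}
    (hA : IsStrictlyPositive A) (hB : IsStrictlyPositive B) :
    τ A B = perspective (reprFun τ) A B := by
  obtain ⟨T, C, hT, hC, rfl, rfl, h⟩ := exists_congruence hA hB
  rw [h, ← hτ.one_left hC.nonneg, hτ.conj_eq zero_le_one hC.nonneg hT, mul_one]

theorem IsOperatorMean.represents (hτ : IsOperatorMean τ) : Represents (reprFun τ) τ where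
  nonneg := fun _ ht => hτ.reprFun_nonneg ht
  continuousOn := hτ.continuousOn_reprFun
  operatorMonotone := fun A B hA hAB => by
    rw [← hτ.one_left hA, ← hτ.one_left (hA.trans hAB)]
    exact hτ.mono 1 1 A B zero_le_one hA le_rfl hAB
  map_one := hτ.reprFun_one
  formula := fun _ _ hA hB => hτ.eq_perspective hA hB

theorem IsOperatorMean.isMeanFun (hτ : IsOperatorMean τ) : IsMeanFun H (reprFun τ) where
  continuousOn := hτ.continuousOn_reprFun.mono Ioi_subset_Ici_self
  pos := fun _ ht => hτ.reprFun_pos ht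
  map_one := hτ.reprFun_one
  mono := fun A A' B B' hA hB hAA' hBB' => by
    rw [← hτ.eq_perspective hA hB, ← hτ.eq_perspective (hA.of_le hAA') (hB.of_le hBB')]
    exact hτ.mono A A' B B' hA.nonneg hB.nonneg hAA' hBB'

end

/-! ### Concavity and differentiability of the representing function at `1` -/

section

variable {H : Type*} [NormedAddCommGroup H] [InnerProductSpace ℂ H] [CompleteSpace H]

theorem quadForm_projection {P : H →L[ℂ] H} (hP : IsSelfAdjoint P) (hPP : P * P = P) (x : H) :
    quadForm P x = ‖P x‖ ^ 2 := by
  rw [← quadForm_one, ← quadForm_conj hP, mul_one, hPP]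

theorem compl_mul_self {P : H →L[ℂ] H} (hPP : P * P = P) : (1 - P) * (1 - P) = 1 - P := by
  rw [mul_sub, mul_one, sub_mul, one_mul, hPP, sub_self, sub_zero]

/-- The operator with eigenvalues `x` on the range and `y` on the kernel of `Q`. -/
def twoPoint (Q : H →L[ℂ] H) (x y : ℝ) : H →L[ℂ] H := x • Q + y • (1 - Q)

section TwoPoint

variable {Q : H →L[ℂ] H} (x y : ℝ)

theorem isSelfAdjoint_twoPoint (hQ : IsSelfAdjoint Q) : IsSelfAdjoint (twoPoint Q x y) :=
  ((IsSelfAdjoint.all x).smul hQ).add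
    ((IsSelfAdjoint.all y).smul ((IsSelfAdjoint.one _).sub hQ))

theorem quadForm_twoPoint (hQ : IsSelfAdjoint Q) (hQQ : Q * Q = Q) (v : H) :
    quadForm (twoPoint Q x y) v = x * ‖Q v‖ ^ 2 + y * ‖(1 - Q) v‖ ^ 2 := by
  rw [twoPoint, quadForm_add, quadForm_smul, quadForm_smul, quadForm_projection hQ hQQ,
    quadForm_projection ((IsSelfAdjoint.one _).sub hQ) (compl_mul_self hQQ)]

theorem conj_twoPoint (hQQ : Q * Q = Q) : Q * twoPoint Q x y * Q = x • Q := by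
  have h : Q * (1 - Q) = 0 := by rw [mul_sub, mul_one, hQQ, sub_self]
  rw [twoPoint, mul_add, mul_smul_comm, mul_smul_comm, h, hQQ, smul_zero, add_zero,
    smul_mul_assoc, hQQ]

theorem conj_compl_twoPoint (hQQ : Q * Q = Q) :
    (1 - Q) * twoPoint Q x y * (1 - Q) = y • (1 - Q) := by
  have h : (1 - Q) * Q = 0 := by rw [sub_mul, one_mul, hQQ, sub_self]
  rw [twoPoint, mul_add, mul_smul_comm, mul_smul_comm, h, compl_mul_self hQQ, smul_zero, zero_add,
    smul_mul_assoc, compl_mul_self hQQ]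

theorem commute_twoPoint : Commute Q (twoPoint Q x y) :=
  ((Commute.refl Q).smul_right x).add_right
    (((Commute.one_right Q).sub_right (Commute.refl Q)).smul_right y)

end TwoPoint

variable {τ : (H →L[ℂ] H) → (H →L[ℂ] H) → (H →L[ℂ] H)}

theorem IsOperatorMean.conj_eq_smul (hτ : IsOperatorMean τ) {P B : H →L[ℂ] H}
    (hP : IsSelfAdjoint P) (hPP : P * P = P) (hB : 0 ≤ B) (hPB : Commute P B) {b : ℝ} (hb : 0 ≤ b)
    (h : P * B * P = b • P) : P * τ 1 B * P = reprFun τ b • P := by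
  refine le_antisymm (hτ.conj_le_of_conj_le hP hPP hB hb h.le) ?_
  have := conj_le_conj hP (hτ.smul_le_of_le_conj hP hPP hB hPB hb h.ge)
  rwa [mul_smul_comm, smul_mul_assoc, hPP, hPP] at this

/-- The mean commutes with `Q`, and its compressions to the range and to the kernel of `Q` are the
scalars `f(x)` and `f(y)`. -/
theorem IsOperatorMean.one_twoPoint (hτ : IsOperatorMean τ) {Q : H →L[ℂ] H}
    (hQ : IsSelfAdjoint Q) (hQQ : Q * Q = Q) {x y : ℝ} (hx : 0 ≤ x) (hy : 0 ≤ y) :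
    τ 1 (twoPoint Q x y) = twoPoint Q (reprFun τ x) (reprFun τ y) := by
  have hB : 0 ≤ twoPoint Q x y := nonneg_of_quadForm (isSelfAdjoint_twoPoint x y hQ) fun v => by
    rw [quadForm_twoPoint x y hQ hQQ]; positivity
  have hQ' := (IsSelfAdjoint.one (H →L[ℂ] H)).sub hQ
  have hcomm := commute_twoPoint (Q := Q) x y
  have h1 := hτ.conj_eq_smul hQ hQQ hB hcomm hx (conj_twoPoint x y hQQ)
  have h2 := hτ.conj_eq_smul hQ' (compl_mul_self hQQ) hB ((Commute.one_left _).sub_left hcomm) hy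
    (conj_compl_twoPoint x y hQQ)
  have hX := hτ.commute_of_commute hQ hQQ zero_le_one hB (Commute.one_right Q) hcomm
  have hs := (hτ.nonneg 1 _ zero_le_one hB).isSelfAdjoint
  have key : ∀ v, quadForm (τ 1 (twoPoint Q x y)) v =
      quadForm (twoPoint Q (reprFun τ x) (reprFun τ y)) v := fun v => by
    rw [quadForm_add_of_commute hQ hQQ hX, ← quadForm_conj hQ, ← quadForm_conj hQ', h1, h2,
      twoPoint, quadForm_add]
  exact le_antisymm (le_of_quadForm hs (isSelfAdjoint_twoPoint _ _ hQ) fun v => (key v).le)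
    (le_of_quadForm (isSelfAdjoint_twoPoint _ _ hQ) hs fun v => (key v).ge)

section RankOne

variable {ξ : H}

theorem quadForm_span_singleton (hξ : ‖ξ‖ = 1) (v : H) :
    quadForm (Submodule.span ℂ {ξ}).starProjection v = ‖(inner ℂ ξ v : ℂ)‖ ^ 2 := by
  rw [quadForm_projection (isSelfAdjoint_starProjection _)
    (Submodule.isIdempotentElem_starProjection _),
    Submodule.starProjection_unit_singleton (𝕜 := ℂ) hξ, norm_smul, hξ, mul_one]

theorem conj_span_singleton_le (hξ : ‖ξ‖ = 1) {B : H →L[ℂ] H} (hB : IsSelfAdjoint B) :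
    (Submodule.span ℂ {ξ}).starProjection * B * (Submodule.span ℂ {ξ}).starProjection ≤
      quadForm B ξ • (Submodule.span ℂ {ξ}).starProjection := by
  set P := (Submodule.span ℂ {ξ}).starProjection
  have hP : IsSelfAdjoint P := isSelfAdjoint_starProjection _
  refine le_of_quadForm (isSelfAdjoint_conj hP hB) ((IsSelfAdjoint.all _).smul hP) fun v => ?_
  rw [quadForm_conj hP, quadForm_smul, quadForm_span_singleton hξ,
    Submodule.starProjection_unit_singleton (𝕜 := ℂ) hξ, quadForm, map_smul, inner_smul_left,
    inner_smul_right, ← mul_assoc, Complex.conj_mul', quadForm, mul_comm (inner ℂ (B ξ) ξ).re,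
    ← Complex.ofReal_pow, Complex.re_ofReal_mul]

end RankOne

variable [Nontrivial H]

/-- Jensen's inequality for vector states. -/
theorem IsOperatorMean.quadForm_le_reprFun (hτ : IsOperatorMean τ) {B : H →L[ℂ] H} (hB : 0 ≤ B)
    {ξ : H} (hξ : ‖ξ‖ = 1) : quadForm (τ 1 B) ξ ≤ reprFun τ (quadForm B ξ) := by
  have hP := isSelfAdjoint_starProjection (Submodule.span ℂ {ξ})
  have h := quadForm_mono (hτ.conj_le_of_conj_le hP (Submodule.isIdempotentElem_starProjection _)
    hB (quadForm_nonneg hB ξ) (conj_span_singleton_le hξ hB.isSelfAdjoint)) ξ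
  have hPξ : (Submodule.span ℂ {ξ}).starProjection ξ = ξ :=
    Submodule.starProjection_eq_self_iff.2 (Submodule.mem_span_singleton_self ξ)
  rw [quadForm_conj hP, hPξ, quadForm_smul, quadForm_span_singleton hξ,
    inner_self_eq_norm_sq_to_K, hξ] at h
  simpa using h

/-- The dual of Jensen's inequality, for rank one minorants. -/
theorem IsOperatorMean.reprFun_smul_le (hτ : IsOperatorMean τ) {B : H →L[ℂ] H}
    {ξ : H} {c : ℝ} (hc : 0 ≤ c)
    (h : c • (Submodule.span ℂ {ξ}).starProjection ≤ B) :
    reprFun τ c • (Submodule.span ℂ {ξ}).starProjection ≤ τ 1 B := by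
  have hP := isSelfAdjoint_starProjection (Submodule.span ℂ {ξ})
  have hPP : (Submodule.span ℂ {ξ}).starProjection * (Submodule.span ℂ {ξ}).starProjection =
    (Submodule.span ℂ {ξ}).starProjection := Submodule.isIdempotentElem_starProjection _
  have hP0 := nonneg_of_isSelfAdjoint_of_mul_self hP hPP
  exact (hτ.smul_le_of_projection hP hPP hc).trans (hτ.mono _ _ _ _ hP0 (smul_nonneg hc hP0)
    (le_one_of_isSelfAdjoint_of_mul_self hP hPP) h)

theorem exists_orthonormal_pair (hH : ¬ FiniteDimensional ℂ H) :
    ∃ u v : H, ‖u‖ = 1 ∧ ‖v‖ = 1 ∧ inner ℂ u v = (0 : ℂ) := by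
  obtain ⟨u, hu⟩ := exists_norm_eq H (zero_le_one (α := ℝ))
  have hne : (Submodule.span ℂ {u})ᗮ ≠ ⊥ := fun h => by
    rw [Submodule.orthogonal_eq_bot_iff] at h
    exact hH (Module.finite_def.2 (h ▸ Submodule.fg_span_singleton u))
  obtain ⟨w, hw, hw0⟩ := Submodule.exists_mem_ne_zero_of_ne_bot hne
  refine ⟨u, (‖w‖⁻¹ : ℂ) • w, hu, ?_, ?_⟩
  · rw [norm_smul, norm_inv, Complex.norm_real, norm_norm, inv_mul_cancel₀ (norm_ne_zero_iff.2 hw0)]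
  · rw [inner_smul_right, Submodule.mem_orthogonal_singleton_iff_inner_right.1 hw, mul_zero]

/-- A projection and a unit vector whose component in the range of the projection has prescribed
length. -/
theorem exists_projection (hH : ¬ FiniteDimensional ℂ H) {p q : ℝ} (hp : 0 ≤ p) (hq : 0 ≤ q)
    (hpq : p + q = 1) : ∃ (Q : H →L[ℂ] H) (ξ : H), IsSelfAdjoint Q ∧ Q * Q = Q ∧ ‖ξ‖ = 1 ∧
      ‖Q ξ‖ ^ 2 = p ∧ ‖(1 - Q) ξ‖ ^ 2 = q := by
  obtain ⟨u, v, hu, hv, huv⟩ := exists_orthonormal_pair hH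
  set Q := (Submodule.span ℂ {u}).starProjection
  have hQ : IsSelfAdjoint Q := isSelfAdjoint_starProjection _
  have hQQ : Q * Q = Q := Submodule.isIdempotentElem_starProjection _
  have hQξ : Q ((√p : ℂ) • u + (√q : ℂ) • v) = (√p : ℂ) • u := by
    rw [Submodule.starProjection_unit_singleton (𝕜 := ℂ) hu, inner_add_right, inner_smul_right,
      inner_smul_right, huv, inner_self_eq_norm_sq_to_K, hu]
    simp
  have hQξ' : (1 - Q) ((√p : ℂ) • u + (√q : ℂ) • v) = (√q : ℂ) • v := by
    change _ - Q _ = _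
    rw [hQξ]; simp
  have h1 : ‖Q ((√p : ℂ) • u + (√q : ℂ) • v)‖ ^ 2 = p := by
    rw [hQξ, norm_smul, hu, Complex.norm_real, mul_one, Real.norm_of_nonneg (Real.sqrt_nonneg p),
      Real.sq_sqrt hp]
  have h2 : ‖(1 - Q) ((√p : ℂ) • u + (√q : ℂ) • v)‖ ^ 2 = q := by
    rw [hQξ', norm_smul, hv, Complex.norm_real, mul_one, Real.norm_of_nonneg (Real.sqrt_nonneg q),
      Real.sq_sqrt hq]
  refine ⟨Q, _, hQ, hQQ, ?_, h1, h2⟩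
  have := quadForm_add_of_commute hQ hQQ (Commute.one_right Q) ((√p : ℂ) • u + (√q : ℂ) • v)
  rw [quadForm_one, quadForm_one, quadForm_one, h1, h2, hpq] at this
  exact (pow_eq_one_iff_of_nonneg (norm_nonneg _) two_ne_zero).1 this

/-- Jensen's inequality for an operator with eigenvalues `x`, `y` and a unit vector that has weights
`p`, `q` on the two eigenspaces. Two orthonormal vectors suffice to build these. -/
theorem IsOperatorMean.concaveOn_reprFun (hτ : IsOperatorMean τ) (hH : ¬ FiniteDimensional ℂ H) :
    ConcaveOn ℝ (Ioi 0) (reprFun τ) := by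
  refine ⟨convex_Ioi 0, fun x hx y hy p q hp hq hpq => ?_⟩
  obtain ⟨Q, ξ, hQ, hQQ, hξ, h1, h2⟩ := exists_projection hH hp hq hpq
  have hB : 0 ≤ twoPoint Q x y := nonneg_of_quadForm (isSelfAdjoint_twoPoint x y hQ) fun v => by
    rw [quadForm_twoPoint x y hQ hQQ]
    exact add_nonneg (mul_nonneg (le_of_lt hx) (sq_nonneg _))
      (mul_nonneg (le_of_lt hy) (sq_nonneg _))
  have := hτ.quadForm_le_reprFun hB hξ
  rw [hτ.one_twoPoint hQ hQQ (le_of_lt hx) (le_of_lt hy), quadForm_twoPoint _ _ hQ hQQ,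
    quadForm_twoPoint _ _ hQ hQQ, h1, h2] at this
  simpa only [smul_eq_mul, mul_comm] using this

theorem inner_eq_add_of_projection {Q : H →L[ℂ] H} (hQ : IsSelfAdjoint Q) (hQQ : Q * Q = Q)
    (u v : H) : (inner ℂ u v : ℂ) = inner ℂ (Q u) (Q v) + inner ℂ ((1 - Q) u) ((1 - Q) v) := by
  have hs := ContinuousLinearMap.isSelfAdjoint_iff_isSymmetric.1 hQ
  have hPP : ∀ w, Q (Q w) = Q w := fun w => congrArg (fun T : H →L[ℂ] H => T w) hQQ
  have e1 : (inner ℂ (Q u) (Q v) : ℂ) = inner ℂ u (Q v) := by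
    rw [show (inner ℂ (Q u) (Q v) : ℂ) = inner ℂ u (Q (Q v)) from hs u (Q v), hPP]
  have e2 : (inner ℂ (Q u) v : ℂ) = inner ℂ u (Q v) := hs u v
  change _ = _ + inner ℂ (u - Q u) (v - Q v)
  rw [inner_sub_left, inner_sub_right, inner_sub_right, e1, e2]
  ring

/-- Midpoint concavity of the adjoint function `t ↦ 1 / f (1 / t)` at `1`. -/
theorem IsOperatorMean.inv_add_inv_le (hτ : IsOperatorMean τ) (hH : ¬ FiniteDimensional ℂ H)
    {x y : ℝ} (hx : 0 < x) (hy : 0 < y) (hxy : x⁻¹ + y⁻¹ = 2) :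
    (reprFun τ x)⁻¹ + (reprFun τ y)⁻¹ ≤ 2 := by
  obtain ⟨Q, ξ, hQ, hQQ, hξ, h1, h2⟩ := exists_projection (H := H) hH
    (p := 1 / 2) (q := 1 / 2) (by norm_num) (by norm_num) (by norm_num)
  have hQ' := (IsSelfAdjoint.one (H →L[ℂ] H)).sub hQ
  have hfx := hτ.reprFun_pos hx
  have hfy := hτ.reprFun_pos hy
  -- The projection onto `ξ` is below `B` exactly when `⟨B⁻¹ ξ, ξ⟩ ≤ 1`; here that quantity is `(x⁻¹
  -- + y⁻¹) / 2 = 1`.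
  have hle : (1 : ℝ) • (Submodule.span ℂ {ξ}).starProjection ≤ twoPoint Q x y := by
    rw [_root_.one_smul]
    refine le_of_quadForm (isSelfAdjoint_starProjection _) (isSelfAdjoint_twoPoint x y hQ)
      fun v => ?_
    rw [quadForm_span_singleton hξ, quadForm_twoPoint x y hQ hQQ,
      inner_eq_add_of_projection hQ hQQ]
    have hn : ‖(inner ℂ (Q ξ) (Q v) + inner ℂ ((1 - Q) ξ) ((1 - Q) v) : ℂ)‖ ≤
        ‖Q ξ‖ * ‖Q v‖ + ‖(1 - Q) ξ‖ * ‖(1 - Q) v‖ :=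
      (norm_add_le _ _).trans (add_le_add (norm_inner_le_norm _ _) (norm_inner_le_norm _ _))
    refine (pow_le_pow_left₀ (norm_nonneg _) hn 2).trans ?_
    set a := ‖Q v‖
    set b := ‖(1 - Q) v‖
    have hs : ‖Q ξ‖ = ‖(1 - Q) ξ‖ := by
      rw [← sq_eq_sq₀ (norm_nonneg _) (norm_nonneg _), h1, h2]
    have e : (‖Q ξ‖ * a + ‖(1 - Q) ξ‖ * b) ^ 2 = 1 / 2 * (a + b) ^ 2 := by
      rw [← hs, ← mul_add, mul_pow, h1]
    rw [e]
    have hxy' : x + y = 2 * (x * y) := by field_simp at hxy; linarith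
    have h3 : x * a ^ 2 + y * b ^ 2 - 1 / 2 * (a + b) ^ 2 =
        ((2 * x - 1) * a ^ 2 - 2 * a * b + (2 * y - 1) * b ^ 2) / 2 := by ring
    -- The constraint on `x` and `y` makes the binary form in `a`, `b` degenerate: up to the
    -- positive factor `2 x - 1` it is a square.
    have h4 : (2 * x - 1) * (2 * y - 1) = 1 := by linarith
    have h5 : 0 < 2 * x - 1 := by
      by_contra hcon
      have hx2 : x ≤ 1 / 2 := by linarith
      have : 2 ≤ x⁻¹ := by
        rw [le_inv_comm₀ two_pos hx]; linarith
      linarith [inv_pos.2 hy]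
    have h6 : 0 ≤ (2 * x - 1) * ((2 * x - 1) * a ^ 2 - 2 * a * b + (2 * y - 1) * b ^ 2) := by
      have : (2 * x - 1) * ((2 * x - 1) * a ^ 2 - 2 * a * b + (2 * y - 1) * b ^ 2) =
          ((2 * x - 1) * a - b) ^ 2 + ((2 * x - 1) * (2 * y - 1) - 1) * b ^ 2 := by ring
      rw [this, h4]
      nlinarith [sq_nonneg ((2 * x - 1) * a - b)]
    have h7 := nonneg_of_mul_nonneg_right h6 h5
    linarith
  have h := hτ.reprFun_smul_le zero_le_one hle
  rw [hτ.reprFun_one, _root_.one_smul, hτ.one_twoPoint hQ hQQ hx.le hy.le] at h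
  set a := reprFun τ x
  set b := reprFun τ y
  -- The extremal test vector is `f(B)⁻¹ ξ`. With `w = a⁻¹ + b⁻¹` the operator inequality becomes
  -- `(w / 2)² ≤ w / 2`.
  set η : H := (a⁻¹ : ℂ) • Q ξ + (b⁻¹ : ℂ) • (1 - Q) ξ with hη
  have hPP : Q (Q ξ) = Q ξ := congrArg (fun T : H →L[ℂ] H => T ξ) hQQ
  have hQc : Q ((1 - Q) ξ) = 0 := by
    change Q (ξ - Q ξ) = 0
    rw [map_sub, hPP, sub_self]
  have hQη : Q η = (a⁻¹ : ℂ) • Q ξ := by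
    rw [hη, map_add, map_smul, map_smul, hPP, hQc, smul_zero, add_zero]
  have hQη' : (1 - Q) η = (b⁻¹ : ℂ) • (1 - Q) ξ := by
    change η - Q η = _
    rw [hQη, hη, add_sub_cancel_left]
  have hq := quadForm_mono h η
  have hin : (inner ℂ ξ η : ℂ) = (((a⁻¹ + b⁻¹) / 2 : ℝ) : ℂ) := by
    rw [inner_eq_add_of_projection hQ hQQ, hQη, hQη', inner_smul_right, inner_smul_right,
      inner_self_eq_norm_sq_to_K, inner_self_eq_norm_sq_to_K]
    have e1 : ((‖Q ξ‖ : ℂ)) ^ 2 = 1 / 2 := by rw [← Complex.ofReal_pow, h1]; norm_num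
    have e2 : ((‖(1 - Q) ξ‖ : ℂ)) ^ 2 = 1 / 2 := by rw [← Complex.ofReal_pow, h2]; norm_num
    simp only [Complex.coe_algebraMap, e1, e2]
    push_cast
    ring
  rw [quadForm_span_singleton hξ, hin, quadForm_twoPoint _ _ hQ hQQ, hQη, hQη', norm_smul, norm_smul,
    mul_pow, mul_pow, h1, h2, ← Complex.ofReal_inv, ← Complex.ofReal_inv, Complex.norm_real,
    Complex.norm_real, Complex.norm_real, Real.norm_eq_abs, Real.norm_eq_abs, Real.norm_eq_abs,
    sq_abs, sq_abs, sq_abs] at hq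
  have e1 : a * (a⁻¹ ^ 2 * (1 / 2)) = a⁻¹ / 2 := by field_simp
  have e2 : b * (b⁻¹ ^ 2 * (1 / 2)) = b⁻¹ / 2 := by field_simp
  rw [e1, e2] at hq
  set w := a⁻¹ + b⁻¹ with hw
  have hw0 : 0 < w := by positivity
  have : w / 2 * (w / 2) ≤ 1 * (w / 2) := by nlinarith
  have := le_of_mul_le_mul_right this (by positivity)
  linarith

/-- Concavity gives both one-sided derivatives, the right one at most the left one. The reciprocal
inequality gives the reverse, because `t ↦ 1/t` swaps the two sides of `1`. -/
theorem differentiableAt_of_concaveOn {f : ℝ → ℝ} (hf : ConcaveOn ℝ (Ioi 0) f) (h1 : f 1 = 1)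
    (h : ∀ x y, 0 < x → 0 < y → x⁻¹ + y⁻¹ = 2 → (f x)⁻¹ + (f y)⁻¹ ≤ 2) :
    DifferentiableAt ℝ f 1 := by
  have hint : (1 : ℝ) ∈ interior (Ioi 0) := by simp
  have hr := hf.neg.hasDerivWithinAt_rightDeriv_of_mem_interior hint
  have hl := hf.neg.hasDerivWithinAt_leftDeriv_of_mem_interior hint
  have hle := hf.neg.leftDeriv_le_rightDeriv_of_mem_interior hint
  set R := derivWithin (-f) (Ioi 1) 1
  set L := derivWithin (-f) (Iio 1) 1
  have hr' : HasDerivWithinAt f (-R) (Ioi 1) 1 := by simpa using hr.neg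
  have hl' : HasDerivWithinAt f (-L) (Iio 1) 1 := by simpa using hl.neg
  have hRL : R ≤ L := by
    have d1 : HasDerivAt (fun t : ℝ => (1 - t)⁻¹) 1 0 := by
      have := ((hasDerivAt_id (0 : ℝ)).const_sub 1).fun_inv (by norm_num)
      exact this.congr_deriv (by norm_num)
    have d2 : HasDerivAt (fun t : ℝ => (1 + t)⁻¹) (-1) 0 := by
      have := ((hasDerivAt_id (0 : ℝ)).const_add 1).fun_inv (by norm_num)
      exact this.congr_deriv (by norm_num)
    have hev : ∀ t ∈ Ioo (0 : ℝ) 1, 1 < (1 - t)⁻¹ ∧ (1 + t)⁻¹ < 1 := fun t ht =>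
      ⟨(one_lt_inv₀ (by linarith [ht.2])).2 (by linarith [ht.1]),
        inv_lt_one_of_one_lt₀ (by linarith [ht.1])⟩
    have c1 : HasDerivWithinAt (fun t : ℝ => f (1 - t)⁻¹) (-R * 1) (Ioo 0 1) 0 := by
      refine HasDerivWithinAt.comp (0 : ℝ) (s' := Ioi 1) (h₂ := f) ?_ d1.hasDerivWithinAt
        fun t ht => (hev t ht).1
      simpa using hr'
    have c2 : HasDerivWithinAt (fun t : ℝ => f (1 + t)⁻¹) (-L * -1) (Ioo 0 1) 0 := by
      refine HasDerivWithinAt.comp (0 : ℝ) (s' := Iio 1) (h₂ := f) ?_ d2.hasDerivWithinAt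
        fun t ht => (hev t ht).2
      simpa using hl'
    -- The sum of `1 / f` at `(1 - t)⁻¹` and `(1 + t)⁻¹` equals `2` at `t = 0` and is at most `2` on
    -- `(0, 1)`, so its right derivative `R - L` is nonpositive.
    have c3 := (c1.inv (by simp [h1])).add (c2.inv (by simp [h1]))
    have hval : -(-R * 1) / f (1 - 0)⁻¹ ^ 2 + -(-L * -1) / f (1 + 0)⁻¹ ^ 2 = R - L := by
      simp [h1]; ring
    rw [hval, hasDerivWithinAt_iff_tendsto_slope] at c3
    have hne : (𝓝[Ioo 0 1 \ {0}] (0 : ℝ)).NeBot := by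
      have : Ioo (0 : ℝ) 1 \ {0} = Ioo 0 1 := by
        ext t; simp only [Set.mem_sdiff, mem_Ioo, mem_singleton_iff]; constructor
        · exact fun h => h.1
        · exact fun h => ⟨h, h.1.ne'⟩
      rw [this, nhdsWithin_Ioo_eq_nhdsGT one_pos]
      infer_instance
    have := le_of_tendsto c3 (b := 0) (by
      filter_upwards [self_mem_nhdsWithin] with t ht
      have ht' := ht.1
      rw [slope_def_field]
      have hle2 := h (1 - t)⁻¹ (1 + t)⁻¹ (inv_pos.2 (by linarith [ht'.2]))
        (inv_pos.2 (by linarith [ht'.1])) (by rw [inv_inv, inv_inv]; ring)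
      refine div_nonpos_of_nonpos_of_nonneg ?_ (by linarith [ht'.1])
      simp only [Pi.add_apply, Pi.inv_apply, sub_zero, add_zero, inv_one, h1]
      linarith)
    linarith
  have hEq : L = R := le_antisymm hle hRL
  rw [hEq] at hl'
  have := hl'.Iic_of_Iio.union hr'.Ici_of_Ioi
  rw [Iic_union_Ici, hasDerivWithinAt_univ] at this
  exact this.differentiableAt

theorem IsOperatorMean.differentiableAt_reprFun (hτ : IsOperatorMean τ)
    (hH : ¬ FiniteDimensional ℂ H) : DifferentiableAt ℝ (reprFun τ) 1 :=
  differentiableAt_of_concaveOn (hτ.concaveOn_reprFun hH) hτ.reprFun_one fun _ _ hx hy hxy =>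
    hτ.inv_add_inv_le hH hx hy hxy

theorem IsOperatorMean.deriv_reprFun_mem (hτ : IsOperatorMean τ) (hH : ¬ FiniteDimensional ℂ H) :
    deriv (reprFun τ) 1 ∈ Icc (0 : ℝ) 1 := by
  have hd := (hτ.differentiableAt_reprFun hH).hasDerivAt.tendsto_slope
  have hd' := hd.mono_left (nhdsWithin_mono 1 (s := Ioi 1) fun x (hx : 1 < x) => ne_of_gt hx)
  constructor
  · refine ge_of_tendsto hd' ?_
    filter_upwards [self_mem_nhdsWithin] with x hx
    have hx : 1 < x := hx
    rw [slope_def_field]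
    exact div_nonneg (sub_nonneg.2 (hτ.reprFun_mono zero_le_one hx.le)) (by linarith)
  · refine le_of_tendsto hd' ?_
    filter_upwards [self_mem_nhdsWithin] with x hx
    have hx : 1 < x := hx
    rw [slope_def_field, hτ.reprFun_one]
    have := hτ.reprFun_mul_le hx.le zero_le_one
    rw [hτ.reprFun_one, mul_one] at this
    exact div_le_one_of_le₀ (by linarith) (by linarith)

end

/-! ### The scalar fixed point equation in logarithmic form -/

section

/-- `(exp z - 1) / z`, continuously extended. -/
def expSlope (z : ℝ) : ℝ := dslope Real.exp 0 z

/-- `log (1 + z) / z`, continuously extended. -/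
def logSlope (z : ℝ) : ℝ := dslope (fun z => Real.log (1 + z)) 0 z

theorem continuous_expSlope : Continuous expSlope := by
  rw [← continuousOn_univ]
  exact (continuousOn_dslope univ_mem).2
    ⟨Real.continuous_exp.continuousOn, Real.differentiableAt_exp⟩

theorem continuousOn_logSlope : ContinuousOn logSlope (Ioi (-1)) := by
  refine (continuousOn_dslope (Ioi_mem_nhds (by norm_num))).2 ⟨fun z hz => ?_, ?_⟩
  · have hz : -1 < z := hz
    exact ((continuousAt_const.add continuousAt_id).log
      (show (1 + z) ≠ 0 by linarith)).continuousWithinAt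
  · exact ((differentiableAt_const _).add differentiableAt_id).log (by norm_num)

theorem mul_expSlope (z : ℝ) : z * expSlope z = Real.exp z - 1 := by
  simpa [expSlope] using sub_smul_dslope Real.exp 0 z

theorem mul_logSlope (z : ℝ) : z * logSlope z = Real.log (1 + z) := by
  simpa [logSlope] using sub_smul_dslope (fun z => Real.log (1 + z)) 0 z

theorem expSlope_zero : expSlope 0 = 1 := by simp [expSlope]

theorem logSlope_zero : logSlope 0 = 1 := by
  have : HasDerivAt (fun z : ℝ => Real.log (1 + z)) 1 0 := by
    have := ((hasDerivAt_id (0 : ℝ)).const_add 1).log (by norm_num)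
    exact this.congr_deriv (by norm_num)
  rw [logSlope, dslope_same, this.deriv]

/-- `log (powerFun s r (exp v)) / s`, continuously extended. -/
def powerLog (s r v : ℝ) : ℝ := v * expSlope (r * v) * logSlope (s * (Real.exp (r * v) - 1))

theorem mul_exp_sub_one_gt {s : ℝ} (hs : s ∈ Icc (0 : ℝ) 1) (v : ℝ) :
    -1 < s * (Real.exp v - 1) := by
  have := Real.exp_pos v
  rcases hs.1.eq_or_lt with rfl | h
  · simp
  · nlinarith [mul_pos h this, hs.2]

theorem powerFun_exp {s : ℝ} (hs : s ∈ Icc (0 : ℝ) 1) (r v : ℝ) :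
    powerFun s r (Real.exp v) = Real.exp (s * powerLog s r v) := by
  rw [powerFun, powerLog]
  split_ifs with hr
  · subst hr
    simp [expSlope_zero, logSlope_zero, ← Real.exp_mul, mul_comm]
  · have hb := mul_exp_sub_one_gt hs (r * v)
    have e : 1 - s + s * Real.exp v ^ r = 1 + s * (Real.exp (r * v) - 1) := by
      rw [← Real.exp_mul, mul_comm v r]; ring
    rw [e, Real.rpow_def_of_pos (by linarith), ← mul_logSlope]
    congr 1
    have := mul_expSlope (r * v)
    rw [mul_one_div, div_eq_iff hr]
    linear_combination (-s * logSlope (s * (Real.exp (r * v) - 1))) * this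

theorem powerLog_zero_left (r v : ℝ) : powerLog 0 r v = v * expSlope (r * v) := by
  simp [powerLog, logSlope_zero]

theorem powerLog_zero_right (s r : ℝ) : powerLog s r 0 = 0 := by simp [powerLog]

theorem strictMono_powerLog {s r : ℝ} (hs : s ∈ Icc (0 : ℝ) 1) : StrictMono (powerLog s r) := by
  rcases hs.1.eq_or_lt with rfl | h
  · intro a b hab
    rw [powerLog_zero_left, powerLog_zero_left]
    rcases lt_trichotomy r 0 with hr | rfl | hr
    · have h1 : Real.exp (r * b) < Real.exp (r * a) :=
        Real.exp_lt_exp.2 (mul_lt_mul_of_neg_left hab hr)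
      nlinarith [mul_expSlope (r * a), mul_expSlope (r * b)]
    · simpa [expSlope_zero] using hab
    · have h1 : Real.exp (r * a) < Real.exp (r * b) :=
        Real.exp_lt_exp.2 (mul_lt_mul_of_pos_left hab hr)
      nlinarith [mul_expSlope (r * a), mul_expSlope (r * b)]
  · intro a b hab
    have := strictMonoOn_powerFun (r := r) ⟨h, hs.2⟩ (Real.exp_pos a) (Real.exp_pos b)
      (Real.exp_lt_exp.2 hab)
    rw [powerFun_exp hs, powerFun_exp hs, Real.exp_lt_exp] at this
    exact lt_of_mul_lt_mul_left this hs.1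

/-- The divided differences remove both singularities, at `r = 0` and at `s = 0`, so no case
distinction on the parameters remains. -/
theorem continuousOn_powerLog :
    ContinuousOn (fun p : ℝ × ℝ × ℝ => powerLog p.1 p.2.1 p.2.2) (Icc 0 1 ×ˢ univ) := by
  have h1 : Continuous fun p : ℝ × ℝ × ℝ => p.2.2 * expSlope (p.2.1 * p.2.2) :=
    (by fun_prop : Continuous fun p : ℝ × ℝ × ℝ => p.2.2).mul
      (continuous_expSlope.comp (by fun_prop))
  refine h1.continuousOn.mul (continuousOn_logSlope.comp (f := fun p : ℝ × ℝ × ℝ =>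
    p.1 * (Real.exp (p.2.1 * p.2.2) - 1)) (by fun_prop) fun p hp => mul_exp_sub_one_gt hp.1 _)

/-- The properties of representing functions which matter for the scalar fixed point equation. -/
structure IsScalarMean (f : ℝ → ℝ) : Prop where
  pos : ∀ t, 0 < t → 0 < f t
  map_one : f 1 = 1
  continuousOn : ContinuousOn f (Ioi 0)
  mono : ∀ a b, 0 < a → a ≤ b → f a ≤ f b
  mul_le : ∀ l t, 1 ≤ l → 0 < t → f (l * t) ≤ l * f t
  differentiableAt : DifferentiableAt ℝ f 1

/-- `log (f (exp z)) / z`, continuously extended. -/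
def meanSlope (f : ℝ → ℝ) (z : ℝ) : ℝ := dslope (fun z => Real.log (f (Real.exp z))) 0 z

/-- The logarithm of the two-variable mean of `exp (s a)` and `exp (s b)`, divided by `s`. -/
def logMean (f : ℝ → ℝ) (s a b : ℝ) : ℝ := a + (b - a) * meanSlope f (s * (b - a))

/-- The logarithmic form of the scalar fixed point equation. -/
def logDefect (f : ℝ → ℝ) (s r w y : ℝ) : ℝ :=
  logMean f s (powerLog s r (-y)) (powerLog s r (w - y))

namespace IsScalarMean

variable {f : ℝ → ℝ}

theorem mul_meanSlope (hf : IsScalarMean f) (z : ℝ) :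
    z * meanSlope f z = Real.log (f (Real.exp z)) := by
  simpa [meanSlope, hf.map_one] using sub_smul_dslope (fun z => Real.log (f (Real.exp z))) 0 z

theorem hasDerivAt_log (hf : IsScalarMean f) :
    HasDerivAt (fun z => Real.log (f (Real.exp z))) (deriv f 1) 0 := by
  have h1 : HasDerivAt f (deriv f 1) (Real.exp 0) := by
    rw [Real.exp_zero]; exact hf.differentiableAt.hasDerivAt
  have := (h1.comp 0 (Real.hasDerivAt_exp 0)).log (by simp [hf.map_one])
  exact this.congr_deriv (by simp [hf.map_one])

theorem meanSlope_zero (hf : IsScalarMean f) : meanSlope f 0 = deriv f 1 := by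
  rw [meanSlope, dslope_same, hf.hasDerivAt_log.deriv]

theorem continuous_meanSlope (hf : IsScalarMean f) : Continuous (meanSlope f) := by
  rw [← continuousOn_univ]
  refine (continuousOn_dslope univ_mem).2 ⟨fun z _ => ?_, hf.hasDerivAt_log.differentiableAt⟩
  have h := hf.continuousOn.continuousAt (Ioi_mem_nhds (Real.exp_pos z))
  exact ((h.comp Real.continuous_exp.continuousAt).log
    (hf.pos _ (Real.exp_pos z)).ne').continuousWithinAt

theorem log_sub_mem (hf : IsScalarMean f) {a b : ℝ} (hab : a ≤ b) :
    Real.log (f (Real.exp b)) - Real.log (f (Real.exp a)) ∈ Icc 0 (b - a) := by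
  have ha := hf.pos _ (Real.exp_pos a)
  constructor
  · exact sub_nonneg.2 (Real.log_le_log ha (hf.mono _ _ (Real.exp_pos a) (Real.exp_le_exp.2 hab)))
  · have := hf.mul_le (Real.exp (b - a)) (Real.exp a) (Real.one_le_exp (sub_nonneg.2 hab))
      (Real.exp_pos a)
    rw [← Real.exp_add, sub_add_cancel] at this
    have := Real.log_le_log (hf.pos _ (Real.exp_pos b)) this
    rw [Real.log_mul (Real.exp_pos _).ne' ha.ne', Real.log_exp] at this
    linarith

theorem meanSlope_mem (hf : IsScalarMean f) (z : ℝ) : meanSlope f z ∈ Icc (0 : ℝ) 1 := by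
  have key : ∀ z ∈ ({0}ᶜ : Set ℝ), meanSlope f z ∈ Icc (0 : ℝ) 1 := fun z (hz : z ≠ 0) => by
    have e := hf.mul_meanSlope z
    rcases lt_or_gt_of_ne hz with h | h
    · have := hf.log_sub_mem h.le
      rw [Real.exp_zero, hf.map_one, Real.log_one, ← e] at this
      constructor <;> nlinarith [this.1, this.2]
    · have := hf.log_sub_mem h.le
      rw [Real.exp_zero, hf.map_one, Real.log_one, ← e] at this
      constructor <;> nlinarith [this.1, this.2]
  -- The value at `0`, which is `f'(1)`, is reached by continuity from the punctured line.
  exact isClosed_Icc.closure_subset_iff.2 (image_subset_iff.2 key) (image_closure_subset_closure_image hf.continuous_meanSlope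
      ⟨z, by rw [closure_compl_singleton]; trivial, rfl⟩)

theorem mul_meanSlope_sub_mem (hf : IsScalarMean f) {s : ℝ} (hs : 0 ≤ s) {a b : ℝ} (hab : a ≤ b) :
    b * meanSlope f (s * b) - a * meanSlope f (s * a) ∈ Icc 0 (b - a) := by
  rcases hs.eq_or_lt with rfl | h
  · have := hf.meanSlope_mem 0
    rw [zero_mul, zero_mul, ← sub_mul]
    exact ⟨mul_nonneg (by linarith) this.1, mul_le_of_le_one_right (by linarith) this.2⟩
  · have := hf.log_sub_mem (mul_le_mul_of_nonneg_left hab hs)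
    rw [← hf.mul_meanSlope, ← hf.mul_meanSlope] at this
    have h1 := this.1
    have h2 := this.2
    constructor
    · refine nonneg_of_mul_nonneg_right (a := s) ?_ h
      linarith
    · refine le_of_mul_le_mul_left (a := s) ?_ h
      linarith

theorem logMean_lt (hf : IsScalarMean f) {s : ℝ} (hs : 0 ≤ s) {a b a' b' : ℝ} (ha : a < a')
    (hb : b < b') : logMean f s a b < logMean f s a' b' := by
  unfold logMean
  rcases le_total (b - a) (b' - a') with h | h
  · linarith [(hf.mul_meanSlope_sub_mem hs h).1]
  · linarith [(hf.mul_meanSlope_sub_mem hs h).2]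

theorem strictAnti_logDefect (hf : IsScalarMean f) {s : ℝ} (hs : s ∈ Icc (0 : ℝ) 1) (r w : ℝ) :
    StrictAnti (logDefect f s r w) := fun y y' h =>
  hf.logMean_lt hs.1 (strictMono_powerLog hs (by linarith)) (strictMono_powerLog hs (by linarith))

theorem continuousOn_logDefect (hf : IsScalarMean f) :
    ContinuousOn (fun p : ℝ × ℝ × ℝ × ℝ => logDefect f p.1 p.2.1 p.2.2.1 p.2.2.2)
      (Icc 0 1 ×ˢ univ) := by
  have h1 : ContinuousOn (fun p : ℝ × ℝ × ℝ × ℝ => powerLog p.1 p.2.1 (-p.2.2.2))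
      (Icc 0 1 ×ˢ univ) :=
    continuousOn_powerLog.comp (f := fun p : ℝ × ℝ × ℝ × ℝ => (p.1, p.2.1, -p.2.2.2))
      (by fun_prop) fun p hp => ⟨hp.1, trivial⟩
  have h2 : ContinuousOn (fun p : ℝ × ℝ × ℝ × ℝ => powerLog p.1 p.2.1 (p.2.2.1 - p.2.2.2))
      (Icc 0 1 ×ˢ univ) :=
    continuousOn_powerLog.comp (f := fun p : ℝ × ℝ × ℝ × ℝ => (p.1, p.2.1, p.2.2.1 - p.2.2.2))
      (by fun_prop) fun p hp => ⟨hp.1, trivial⟩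
  have h3 := h2.sub h1
  exact h1.add (h3.mul (hf.continuous_meanSlope.comp_continuousOn (continuousOn_fst.mul h3)))

/-- The defect is a convex combination of `powerLog` at `-y` and at `w - y`. Both arguments are
nonpositive for `y = max 0 w` and nonnegative for `y = min 0 w`, so the intermediate value theorem
applies. -/
theorem exists_logDefect_eq_zero (hf : IsScalarMean f) {s : ℝ} (hs : s ∈ Icc (0 : ℝ) 1)
    (r w : ℝ) : ∃ y, logDefect f s r w y = 0 := by
  have hcont : Continuous (logDefect f s r w) := by
    rw [← continuousOn_univ]
    exact hf.continuousOn_logDefect.comp (f := fun y : ℝ => (s, r, w, y)) (by fun_prop)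
      fun y _ => ⟨hs, trivial⟩
  have hmono := (strictMono_powerLog (r := r) hs).monotone
  have h0 := powerLog_zero_right s r
  have e : ∀ y, ∃ m ∈ Icc (0 : ℝ) 1, logDefect f s r w y =
      (1 - m) * powerLog s r (-y) + m * powerLog s r (w - y) := fun y =>
    ⟨_, hf.meanSlope_mem _, by rw [logDefect, logMean]; ring⟩
  refine mem_range_of_exists_le_of_exists_ge hcont ⟨max 0 w, ?_⟩ ⟨min 0 w, ?_⟩
  · obtain ⟨m, hm, h⟩ := e (max 0 w)
    have h1 := hmono (show -max 0 w ≤ 0 by simp)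
    have h2 := hmono (show w - max 0 w ≤ 0 by simp)
    rw [h]
    nlinarith [hm.1, hm.2]
  · obtain ⟨m, hm, h⟩ := e (min 0 w)
    have h1 := hmono (show 0 ≤ -min 0 w by simp)
    have h2 := hmono (show 0 ≤ w - min 0 w by simp)
    rw [h]
    nlinarith [hm.1, hm.2]

end IsScalarMean

/-- The logarithm of the solution of the scalar fixed point equation. -/
def logSolution (f : ℝ → ℝ) (s r w : ℝ) : ℝ := Classical.epsilon fun y => logDefect f s r w y = 0

/-- The solution of the scalar fixed point equation. -/
def solution (f : ℝ → ℝ) (s r t : ℝ) : ℝ := Real.exp (logSolution f s r (Real.log t))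

theorem solution_pos (f : ℝ → ℝ) (s r t : ℝ) : 0 < solution f s r t := Real.exp_pos _

namespace IsScalarMean

variable {f : ℝ → ℝ} {s : ℝ}

theorem logDefect_logSolution (hf : IsScalarMean f) (hs : s ∈ Icc (0 : ℝ) 1) (r w : ℝ) :
    logDefect f s r w (logSolution f s r w) = 0 :=
  Classical.epsilon_spec (hf.exists_logDefect_eq_zero hs r w)

theorem logSolution_eq (hf : IsScalarMean f) (hs : s ∈ Icc (0 : ℝ) 1) {r w y : ℝ}
    (h : logDefect f s r w y = 0) : logSolution f s r w = y :=
  (hf.strictAnti_logDefect hs r w).injective ((hf.logDefect_logSolution hs r w).trans h.symm)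

/-- An implicit function theorem from monotonicity alone: a number `c` lies below the root exactly
when the defect at `c` is positive, which is an open condition on the parameters; similarly above.
-/
theorem continuousOn_logSolution (hf : IsScalarMean f) :
    ContinuousOn (fun p : ℝ × ℝ × ℝ => logSolution f p.1 p.2.1 p.2.2) (Icc 0 1 ×ˢ univ) := by
  intro p₀ hp₀
  have hc : ∀ c : ℝ, ContinuousWithinAt (fun p : ℝ × ℝ × ℝ => logDefect f p.1 p.2.1 p.2.2 c)
      (Icc 0 1 ×ˢ univ) p₀ := fun c =>
    (hf.continuousOn_logDefect.comp (f := fun p : ℝ × ℝ × ℝ => (p.1, p.2.1, p.2.2, c))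
      (by fun_prop) fun p hp => ⟨hp.1, trivial⟩) p₀ hp₀
  refine tendsto_order.2 ⟨fun c hcy => ?_, fun c hcy => ?_⟩
  · have := hf.strictAnti_logDefect hp₀.1 p₀.2.1 p₀.2.2 hcy
    rw [hf.logDefect_logSolution hp₀.1] at this
    filter_upwards [(hc c).eventually_const_lt this, self_mem_nhdsWithin] with p hp hpm
    rw [← hf.logDefect_logSolution hpm.1 p.2.1 p.2.2] at hp
    exact (hf.strictAnti_logDefect hpm.1 _ _).lt_iff_gt.1 hp
  · have := hf.strictAnti_logDefect hp₀.1 p₀.2.1 p₀.2.2 hcy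
    rw [hf.logDefect_logSolution hp₀.1] at this
    filter_upwards [(hc c).eventually_lt_const this, self_mem_nhdsWithin] with p hp hpm
    rw [← hf.logDefect_logSolution hpm.1 p.2.1 p.2.2] at hp
    exact (hf.strictAnti_logDefect hpm.1 _ _).lt_iff_gt.1 hp

theorem continuousOn_solution (hf : IsScalarMean f) :
    ContinuousOn (fun p : ℝ × ℝ × ℝ => solution f p.1 p.2.1 p.2.2)
      (Icc 0 1 ×ˢ univ ×ˢ Ioi 0) := by
  refine Real.continuous_exp.comp_continuousOn (hf.continuousOn_logSolution.comp
    (f := fun p : ℝ × ℝ × ℝ => (p.1, p.2.1, Real.log p.2.2)) ?_ fun p hp => ⟨hp.1, trivial⟩)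
  exact continuousOn_fst.prodMk ((by fun_prop : ContinuousOn (fun p : ℝ × ℝ × ℝ => p.2.1) _).prodMk
    (ContinuousOn.log (by fun_prop) fun p hp => (ne_of_gt hp.2.2)))

theorem continuousOn_solution_right (hf : IsScalarMean f) (hs : s ∈ Icc (0 : ℝ) 1) (r : ℝ) :
    ContinuousOn (solution f s r) (Ioi 0) :=
  hf.continuousOn_solution.comp (f := fun t : ℝ => (s, r, t)) (by fun_prop)
    fun _ ht => ⟨hs, trivial, ht⟩

theorem solution_one (hf : IsScalarMean f) (hs : s ∈ Icc (0 : ℝ) 1) (r : ℝ) :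
    solution f s r 1 = 1 := by
  rw [solution, Real.log_one, hf.logSolution_eq hs (y := 0), Real.exp_zero]
  simp [logDefect, logMean, powerLog_zero_right]

theorem isScalarSolution_solution (hf : IsScalarMean f) (hs : s ∈ Icc (0 : ℝ) 1) (r : ℝ) :
    IsScalarSolution f (powerFun s r) (solution f s r) := fun t ht => by
  have h := hf.logDefect_logSolution hs r (Real.log t)
  rw [solution]
  set y := logSolution f s r (Real.log t)
  have e1 : 1 / Real.exp y = Real.exp (-y) := by rw [Real.exp_neg, one_div]
  have e2 : t / Real.exp y = Real.exp (Real.log t - y) := by rw [Real.exp_sub, Real.exp_log ht]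
  rw [e1, e2, powerFun_exp hs, powerFun_exp hs, mul_div_mul_left _ _ (Real.exp_pos y).ne',
    ← Real.exp_sub, ← mul_sub, mul_assoc]
  rw [logDefect, logMean] at h
  set a := powerLog s r (-y)
  set b := powerLog s r (Real.log t - y)
  -- In exponential form the remaining factor is `exp (s * logDefect)`, which is `exp 0`.
  rw [← Real.exp_log (hf.pos _ (Real.exp_pos (s * (b - a)))), ← hf.mul_meanSlope, ← Real.exp_add,
    show s * a + s * (b - a) * meanSlope f (s * (b - a)) = 0 by linear_combination s * h,
    Real.exp_zero, mul_one]

/-- At `s = 0` the slope of `f` is frozen at `α`, and the logarithm of the power function solves the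
resulting equation. Uniqueness of the root identifies the solution. -/
theorem solution_zero (hf : IsScalarMean f) (r : ℝ) {t : ℝ} (ht : 0 < t) :
    solution f 0 r t = powerFun (deriv f 1) r t := by
  have hα : deriv f 1 ∈ Icc (0 : ℝ) 1 := hf.meanSlope_zero ▸ hf.meanSlope_mem 0
  obtain ⟨w, rfl⟩ : ∃ w, Real.exp w = t := ⟨_, Real.exp_log ht⟩
  rw [solution, Real.log_exp, powerFun_exp hα]
  congr 1
  refine hf.logSolution_eq ⟨le_rfl, zero_le_one⟩ ?_
  have hy := powerFun_exp hα r w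
  set α := deriv f 1
  set y := α * powerLog α r w
  rw [logDefect, logMean, zero_mul, hf.meanSlope_zero, powerLog_zero_left, powerLog_zero_left]
  by_cases hr : r = 0
  · subst hr
    have : y = α * w := by
      rw [powerFun, if_pos rfl, ← Real.exp_mul] at hy
      linarith [Real.exp_injective hy]
    simp only [zero_mul, expSlope_zero, this]
    ring
  · have hb := powerFun_base_pos (r := r) hα (Real.exp_pos w)
    -- This is the defining relation of the power mean; multiplied by `exp (-r y)` it is `r` times
    -- the equation at `s = 0`.
    have h1 : Real.exp (r * y) = 1 - α + α * Real.exp (r * w) := by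
      rw [mul_comm, Real.exp_mul, ← hy, powerFun, if_neg hr, ← Real.rpow_mul hb.le,
        one_div_mul_cancel hr, Real.rpow_one, ← Real.exp_mul, mul_comm w r]
    have h2 := mul_expSlope (r * -y)
    have h3 := mul_expSlope (r * (w - y))
    have h4 : Real.exp (r * y) * Real.exp (r * -y) = 1 := by
      rw [← Real.exp_add, mul_neg, add_neg_cancel, Real.exp_zero]
    have h5 : Real.exp (r * (w - y)) = Real.exp (r * w) * Real.exp (r * -y) := by
      rw [← Real.exp_add]; congr 1; ring
    rw [h5] at h3
    refine mul_left_cancel₀ hr ?_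
    rw [h1] at h4
    linear_combination (1 - α) * h2 + α * h3 + h4

end IsScalarMean

variable {H : Type*} [NormedAddCommGroup H] [InnerProductSpace ℂ H] [CompleteSpace H]
variable {τ : (H →L[ℂ] H) → (H →L[ℂ] H) → (H →L[ℂ] H)}

theorem IsOperatorMean.isScalarMean (hτ : IsOperatorMean τ) [Nontrivial H]
    (hH : ¬ FiniteDimensional ℂ H) : IsScalarMean (reprFun τ) where
  pos := fun _ ht => hτ.reprFun_pos ht
  map_one := hτ.reprFun_one
  continuousOn := hτ.isMeanFun.continuousOn
  mono := fun _ _ ha hab => hτ.reprFun_mono ha.le hab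
  mul_le := fun _ _ hl ht => hτ.reprFun_mul_le hl ht.le
  differentiableAt := hτ.differentiableAt_reprFun hH

end

/-! ### Deformed means and proper convergence -/

section

variable {H : Type*} [NormedAddCommGroup H] [InnerProductSpace ℂ H] [CompleteSpace H]
variable {τ : (H →L[ℂ] H) → (H →L[ℂ] H) → (H →L[ℂ] H)}

/-- Joint continuity in parameters and variable is uniform over the compact set of values of `t`. -/
theorem tendstoUniformlyOn_solution {f : ℝ → ℝ} (hf : IsScalarMean f) {s r : ℕ → ℝ} {s₀ r₀ : ℝ}
    (hs : ∀ k, s k ∈ Icc (0 : ℝ) 1) (hs₀ : Tendsto s atTop (𝓝 s₀)) (hr₀ : Tendsto r atTop (𝓝 r₀))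
    {K : Set ℝ} (hK : IsCompact K) (hK0 : K ⊆ Ioi 0) :
    TendstoUniformlyOn (fun k => solution f (s k) (r k)) (solution f s₀ r₀) atTop K := by
  have hmem : s₀ ∈ Icc (0 : ℝ) 1 := isClosed_Icc.mem_of_tendsto hs₀ (.of_forall hs)
  intro u hu
  obtain ⟨v, hv, h⟩ := hK.mem_uniformity_of_prod
    (f := fun (p : ℝ × ℝ) t => solution f p.1 p.2 t) (s := Icc 0 1 ×ˢ univ) (q := (s₀, r₀))
    (hf.continuousOn_solution.comp (f := fun q : (ℝ × ℝ) × ℝ => (q.1.1, q.1.2, q.2))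
      (by fun_prop) fun q hq => ⟨hq.1.1, trivial, hK0 hq.2⟩) ⟨hmem, trivial⟩ (symm_le_uniformity hu)
  have hp : Tendsto (fun k => (s k, r k)) atTop (𝓝[Icc 0 1 ×ˢ univ] (s₀, r₀)) :=
    tendsto_nhdsWithin_iff.2 ⟨hs₀.prodMk_nhds hr₀, .of_forall fun k => ⟨hs k, trivial⟩⟩
  filter_upwards [hp hv] with k hk t ht using h _ hk t ht

theorem tendsto_perspective {f : ℕ → ℝ → ℝ} {g : ℝ → ℝ} (hf : ∀ k, ContinuousOn (f k) (Ioi 0))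
    (h : ∀ K : Set ℝ, IsCompact K → K ⊆ Ioi 0 → TendstoUniformlyOn f g atTop K)
    {A B : H →L[ℂ] H} (hA : IsStrictlyPositive A) (hB : IsStrictlyPositive B) :
    Tendsto (fun k => perspective (f k) A B) atTop (𝓝 (perspective g A B)) := by
  obtain ⟨T, C, -, hC, -, -, h'⟩ := exists_congruence hA hB
  simp only [h']
  have hsp : spectrum ℝ C ⊆ Ioi 0 := fun t ht => hC.spectrum_pos ht
  exact ((tendsto_cfc_fun (h _ (spectrum.isCompact C) hsp)
    (.of_forall fun k => (hf k).mono hsp)).const_mul T).mul_const T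

theorem powerMean_of_isStrictlyPositive (s r : ℝ) {A B : H →L[ℂ] H} (hA : IsStrictlyPositive A)
    (hB : IsStrictlyPositive B) : powerMean s r A B = perspective (powerFun s r) A B :=
  extend_of_isStrictlyPositive hA hB

section Deformation

variable [Nontrivial H] {s r : ℝ}

theorem IsOperatorMean.isFixedSolution_iff (hτ : IsOperatorMean τ) (hH : ¬ FiniteDimensional ℂ H)
    (hs : s ∈ Ioc (0 : ℝ) 1) (hr : r ∈ Icc (-1 : ℝ) 1) {A B X : H →L[ℂ] H}
    (hA : IsStrictlyPositive A) (hB : IsStrictlyPositive B) :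
    IsFixedSolution τ (powerMean s r) A B X ↔ X = perspective (solution (reprFun τ) s r) A B := by
  have hf := hτ.isScalarMean hH
  have hs' : s ∈ Icc (0 : ℝ) 1 := Ioc_subset_Icc_self hs
  have hg : IsMeanFun H (powerFun s r) := isMeanFun_powerFun hs' hr
  have hx := hf.continuousOn_solution_right hs' r
  have hxpos : ∀ t, 0 < t → 0 < solution (reprFun τ) s r t := fun t _ => solution_pos _ _ _ t
  have e : ∀ X : H →L[ℂ] H, IsStrictlyPositive X → τ (powerMean s r X A) (powerMean s r X B) =
      deformMap (reprFun τ) (powerFun s r) A B X := fun X hX => by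
    rw [powerMean_of_isStrictlyPositive _ _ hX hA, powerMean_of_isStrictlyPositive _ _ hX hB,
      hτ.eq_perspective (isStrictlyPositive_perspective hg.continuousOn hg.pos hX hA)
        (isStrictlyPositive_perspective hg.continuousOn hg.pos hX hB), deformMap]
  constructor
  · rintro ⟨hX, h⟩
    rw [e X hX] at h
    exact eq_perspective_of_eq_deformMap hτ.isMeanFun hg (strictMonoOn_powerFun hs) hx hxpos
      (hf.isScalarSolution_solution hs' r) hA hB hX h
  · rintro rfl
    have hX := isStrictlyPositive_perspective hx hxpos hA hB
    refine ⟨hX, ?_⟩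
    rw [e _ hX, perspective_eq_deformMap hf.continuousOn hg.continuousOn hg.pos hx hxpos
      (hf.isScalarSolution_solution hs' r) hA hB]

/-- For `s > 0` this is the comparison principle. At `s = 0` the function `powerFun s r` is constant
and the strict improvement breaks down, but the solution is then explicitly a power function. -/
theorem IsOperatorMean.isMeanFun_solution (hτ : IsOperatorMean τ) (hH : ¬ FiniteDimensional ℂ H)
    (hs : s ∈ Icc (0 : ℝ) 1) (hr : r ∈ Icc (-1 : ℝ) 1) :
    IsMeanFun H (solution (reprFun τ) s r) := by
  have hf := hτ.isScalarMean hH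
  have hx := hf.continuousOn_solution_right hs r
  rcases hs.1.eq_or_lt with rfl | h
  · have hα : IsMeanFun H (powerFun (deriv (reprFun τ) 1) r) :=
      isMeanFun_powerFun (hτ.deriv_reprFun_mem hH) hr
    have e : EqOn (solution (reprFun τ) 0 r) (powerFun (deriv (reprFun τ) 1) r) (Ioi 0) :=
      fun t ht => hf.solution_zero r ht
    refine ⟨hx, fun t _ => solution_pos _ _ _ t, hf.solution_one hs r,
      fun A A' B B' hA hB hAA' hBB' => ?_⟩
    rw [perspective_congr e hA hB, perspective_congr e (hA.of_le hAA') (hB.of_le hBB')]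
    exact hα.mono A A' B B' hA hB hAA' hBB'
  · exact hτ.isMeanFun.deform (isMeanFun_powerFun hs hr) (strictMonoOn_powerFun ⟨h, hs.2⟩) hx
      (fun t _ => solution_pos _ _ _ t) (hf.solution_one hs r) (hf.isScalarSolution_solution hs r)

/-- One formula covers the interior `s > 0` and the boundary `s = 0`, so the limit in the first
claim becomes a special case of continuity. -/
theorem IsOperatorMean.deformFamily_eq (hτ : IsOperatorMean τ) (hH : ¬ FiniteDimensional ℂ H)
    (hs : s ∈ Icc (0 : ℝ) 1) (hr : r ∈ Icc (-1 : ℝ) 1) {A B : H →L[ℂ] H} (hA : 0 ≤ A)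
    (hB : 0 ≤ B) :
    deformFamily τ s r A B = extend (perspective (solution (reprFun τ) s r)) A B := by
  rw [deformFamily]
  split_ifs with h
  · subst h
    refine extend_congr (fun A B hA hB => (perspective_congr (fun t ht => ?_) hA hB).symm) hA hB
    exact (hτ.isScalarMean hH).solution_zero r ht
  · have hs' : s ∈ Ioc (0 : ℝ) 1 := ⟨hs.1.lt_of_ne' h, hs.2⟩
    refine extend_congr (fun A B hA hB => ?_) hA hB
    have := hτ.isFixedSolution_iff hH hs' hr (X := perspective (solution (reprFun τ) s r) A B) hA hB
    exact (hτ.isFixedSolution_iff hH hs' hr hA hB).1 (Classical.epsilon_spec ⟨_, this.2 rfl⟩)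

theorem IsOperatorMean.deformFamily_of_isStrictlyPositive (hτ : IsOperatorMean τ)
    (hH : ¬ FiniteDimensional ℂ H) (hs : s ∈ Icc (0 : ℝ) 1) (hr : r ∈ Icc (-1 : ℝ) 1)
    {A B : H →L[ℂ] H} (hA : IsStrictlyPositive A) (hB : IsStrictlyPositive B) :
    deformFamily τ s r A B = perspective (solution (reprFun τ) s r) A B := by
  rw [hτ.deformFamily_eq hH hs hr hA.nonneg hB.nonneg, extend_of_isStrictlyPositive hA hB]

theorem IsOperatorMean.isOperatorMean_deformFamily (hτ : IsOperatorMean τ)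
    (hH : ¬ FiniteDimensional ℂ H) (hs : s ∈ Icc (0 : ℝ) 1) (hr : r ∈ Icc (-1 : ℝ) 1) :
    IsOperatorMean (deformFamily τ s r) :=
  (hτ.isMeanFun_solution hH hs hr).isOperatorMean.congr fun _ _ hA hB =>
    hτ.deformFamily_eq hH hs hr hA hB

theorem IsOperatorMean.reprFun_deformFamily (hτ : IsOperatorMean τ)
    (hH : ¬ FiniteDimensional ℂ H) (hs : s ∈ Icc (0 : ℝ) 1) (hr : r ∈ Icc (-1 : ℝ) 1) {t : ℝ}
    (ht : 0 < t) : reprFun (deformFamily τ s r) t = solution (reprFun τ) s r t := by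
  refine reprFun_eq_of_eq ?_
  rw [hτ.deformFamily_of_isStrictlyPositive hH hs hr isStrictlyPositive_one
    (isStrictlyPositive_one.smul ht), perspective_one_smul]

theorem IsOperatorMean.tendstoProperly_deformFamily (hτ : IsOperatorMean τ)
    (hH : ¬ FiniteDimensional ℂ H) {s r : ℕ → ℝ} {s₀ r₀ : ℝ} (hs : ∀ k, s k ∈ Icc (0 : ℝ) 1)
    (hr : ∀ k, r k ∈ Icc (-1 : ℝ) 1) (hs₀ : Tendsto s atTop (𝓝 s₀))
    (hr₀ : Tendsto r atTop (𝓝 r₀)) :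
    TendstoProperly (fun k => deformFamily τ (s k) (r k)) (deformFamily τ s₀ r₀) := by
  have hf := hτ.isScalarMean hH
  have hms : s₀ ∈ Icc (0 : ℝ) 1 := isClosed_Icc.mem_of_tendsto hs₀ (.of_forall hs)
  have hmr : r₀ ∈ Icc (-1 : ℝ) 1 := isClosed_Icc.mem_of_tendsto hr₀ (.of_forall hr)
  have key : ∀ K : Set ℝ, IsCompact K → K ⊆ Ioi 0 → TendstoUniformlyOn
      (fun k => solution (reprFun τ) (s k) (r k)) (solution (reprFun τ) s₀ r₀) atTop K :=
    fun K hK hK0 => tendstoUniformlyOn_solution hf hs hs₀ hr₀ hK hK0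
  have key' : ∀ K : Set ℝ, IsCompact K → K ⊆ Ioi 0 → TendstoUniformlyOn
      (fun k => reprFun (deformFamily τ (s k) (r k))) (reprFun (deformFamily τ s₀ r₀)) atTop K :=
    fun K hK hK0 => ((key K hK hK0).congr (.of_forall fun k t ht =>
      (hτ.reprFun_deformFamily hH (hs k) (hr k) (hK0 ht)).symm)).congr_right fun t ht =>
        (hτ.reprFun_deformFamily hH hms hmr (hK0 ht)).symm
  refine ⟨fun t ht => ?_, fun δ hδ _ => ?_, fun A B hA hB => ?_⟩
  · exact (key' {t} isCompact_singleton (singleton_subset_iff.2 ht)).tendsto_at rfl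
  · exact key' _ isCompact_Icc fun t ht => hδ.trans_le ht.1
  · rw [hτ.deformFamily_of_isStrictlyPositive hH hms hmr hA hB]
    refine (tendsto_perspective (fun k => hf.continuousOn_solution_right (hs k) (r k)) key
      hA hB).congr fun k => ?_
    rw [hτ.deformFamily_of_isStrictlyPositive hH (hs k) (hr k) hA hB]

end Deformation

end

end OpMean

end

theorem theorem3p9 {H : Type*} [NormedAddCommGroup H] [InnerProductSpace ℂ H] [CompleteSpace H]
    [TopologicalSpace.SeparableSpace H] (hH : ¬ FiniteDimensional ℂ H)
    (τ : (H →L[ℂ] H) → (H →L[ℂ] H) → (H →L[ℂ] H)) (hτ : OpMean.IsOperatorMean τ) :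
    -- the representing function of `τ`, and the number `α`
    OpMean.Represents (OpMean.reprFun τ) τ ∧
    DifferentiableAt ℝ (OpMean.reprFun τ) 1 ∧
    deriv (OpMean.reprFun τ) 1 ∈ Icc (0 : ℝ) 1 ∧
    -- the deformations are well defined
    (∀ s ∈ Ioc (0 : ℝ) 1, ∀ r ∈ Icc (-1 : ℝ) 1, ∀ A B : H →L[ℂ] H,
      IsStrictlyPositive A → IsStrictlyPositive B →
        ∃! X, OpMean.IsFixedSolution τ (OpMean.powerMean s r) A B X) ∧
    -- the limit `s → 0`
    (∀ (s r : ℕ → ℝ) (r₀ : ℝ), (∀ k, s k ∈ Ioc (0 : ℝ) 1) → (∀ k, r k ∈ Icc (-1 : ℝ) 1) →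
      Tendsto s atTop (𝓝 0) → Tendsto r atTop (𝓝 r₀) →
        OpMean.TendstoProperly (fun k => OpMean.deform τ (OpMean.powerMean (s k) (r k)))
          (OpMean.powerMean (deriv (OpMean.reprFun τ) 1) r₀)) ∧
    -- the continuous two-parameter family of operator means
    (∀ s ∈ Icc (0 : ℝ) 1, ∀ r ∈ Icc (-1 : ℝ) 1,
      OpMean.IsOperatorMean (OpMean.deformFamily τ s r)) ∧
    (∀ (s r : ℕ → ℝ) (s₀ r₀ : ℝ), (∀ k, s k ∈ Icc (0 : ℝ) 1) → (∀ k, r k ∈ Icc (-1 : ℝ) 1) →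
      Tendsto s atTop (𝓝 s₀) → Tendsto r atTop (𝓝 r₀) →
        OpMean.TendstoProperly (fun k => OpMean.deformFamily τ (s k) (r k))
          (OpMean.deformFamily τ s₀ r₀)) := by
  have : Nontrivial H := not_subsingleton_iff_nontrivial.1 fun _ => hH inferInstance
  refine ⟨hτ.represents, hτ.differentiableAt_reprFun hH, hτ.deriv_reprFun_mem hH, ?_, ?_, ?_, ?_⟩
  · intro s hs r hr A B hA hB
    exact ⟨_, (hτ.isFixedSolution_iff hH hs hr hA hB).2 rfl,
      fun X hX => (hτ.isFixedSolution_iff hH hs hr hA hB).1 hX⟩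
  · intro s r r₀ hs hr hs₀ hr₀
    have h := hτ.tendstoProperly_deformFamily hH (fun k => Ioc_subset_Icc_self (hs k)) hr hs₀ hr₀
    have e : (fun k => OpMean.deformFamily τ (s k) (r k)) =
        fun k => OpMean.deform τ (OpMean.powerMean (s k) (r k)) :=
      funext fun k => if_neg (hs k).1.ne'
    rwa [e, OpMean.deformFamily, if_pos rfl] at h
  · exact fun s hs r hr => hτ.isOperatorMean_deformFamily hH hs hr
  · exact fun s r s₀ r₀ hs hr hs₀ hr₀ => hτ.tendstoProperly_deformFamily hH hs hr hs₀ hr₀
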